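/- Let $k$ be an algebraically closed field of characteristic $0$, let $m\ge 2$ and $d\ge 1$ be integers such that $(1+m)d$ is even, let $\xi\in k$ be a primitive $2m$-th root of $1$, and put $\gamma:=\xi^2$ and $\phi_i:=1-\gamma^{-i-1}x^d$. Let $D=D(m,d,\xi)$ be the associative unital $k$-algebra generated by $x^{\pm1},g,y,u_0,\dots,u_{m-1}$ (the index of $u_i$ being read modulo $m$), subject to the relations $$xx^{-1}=x^{-1}x=1,\quad xg=gx,\quad xy=yx,\quad yg=\gamma gy,\quad y^m=1-x^{md}=1-g^m,$$ $$xu_i=u_ix^{-1},\quad yu_i=\phi_iu_{i+1}=\xi x^du_iy,\quad u_ig=\gamma^ix^{-2d}gu_i,$$ $$u_iu_j=(-1)^{-j}\xi^{-j}\gamma^{\frac{j(j+1)}2}\,\tfrac1m\,x^{-\frac{1+m}2d}\cdot\begin{cases}\phi_i\phi_{i+1}\cdots\phi_{m-2-j}\,y^{i+j}g & \text{if } i+j\le m-2,\\ y^{i+j}g & \text{if } i+j=m-1,\\ \phi_i\cdots\phi_{m-1}\phi_0\cdots\phi_{m-2-j}\,y^{i+j-m}g & \text{if } i+j\ge m,\end{cases}$$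 for $0\le i,j\le m-1$. Then $D$ is a Hopf algebra with coproduct $\Delta$, counit $\epsilon$ and antipode $S$ determined by $$\Delta(x)=x\otimes x,\quad \Delta(g)=g\otimes g,\quad \Delta(y)=y\otimes g+1\otimes y,\quad \Delta(u_i)=\sum_{j=0}^{m-1}\gamma^{j(i-j)}u_j\otimes x^{-jd}g^ju_{i-j},$$ $$\epsilon(x)=\epsilon(g)=\epsilon(u_0)=1,\qquad \epsilon(y)=\epsilon(u_s)=0\quad(1\le s\le m-1),$$ $$S(x)=x^{-1},\quad S(g)=g^{-1},\quad S(y)=-yg^{-1},\quad S(u_i)=(-1)^i\xi^{-i}\gamma^{-\frac{i(i+1)}2}x^{id+\frac32(1-m)d}g^{m-i-1}u_i\quad(0\le i\le m-1),$$ and this Hopf algebra is not pointed; that is, not every simple subcoalgebra of $D$ is one-dimensional. -/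

import Mathlib

open scoped TensorProduct

/-! ### Pointed coalgebras -/

/-- A subspace `V` of a coalgebra is a subcoalgebra if `Δ(V) ⊆ V ⊗ V`, where `V ⊗ V` is regarded
as a subspace of `C ⊗ C`. -/
def IsSubcoalgebra {k C : Type*} [Field k] [AddCommGroup C] [Module k C] [Coalgebra k C]
    (V : Submodule k C) : Prop :=
  ∀ c ∈ V, Coalgebra.comul (R := k) c ∈
    LinearMap.range (TensorProduct.map V.subtype V.subtype)

/-- A subcoalgebra is simple if it is nonzero and has no subcoalgebras but zero and itself. -/
structure IsSimpleSubcoalgebra {k C : Type*} [Field k] [AddCommGroup C] [Module k C]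
    [Coalgebra k C] (V : Submodule k C) : Prop where
  isSubcoalgebra : IsSubcoalgebra V
  ne_bot : V ≠ ⊥
  eq_bot_or_eq : ∀ W : Submodule k C, IsSubcoalgebra W → W ≤ V → W = ⊥ ∨ W = V

/-- A coalgebra is pointed if each of its simple subcoalgebras is one-dimensional. -/
def IsPointedCoalgebra (k C : Type*) [Field k] [AddCommGroup C] [Module k C]
    [Coalgebra k C] : Prop :=
  ∀ V : Submodule k C, IsSimpleSubcoalgebra V → Module.finrank k V = 1

/-- A Hopf algebra is pointed if its underlying coalgebra is. -/
def IsPointedHopfAlgebra (k A : Type*) [Field k] [Ring A] [HopfAlgebra k A] : Prop :=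
  IsPointedCoalgebra k A

/-! ### The algebra `D(m, d, ξ)` -/

namespace DHopf

/-- The generators `x`, `x⁻¹`, `g`, `y`, `u_i`. The index of `u_i` is read modulo `m`. -/
inductive Gen (m : ℕ) : Type
  | x : Gen m
  | xinv : Gen m
  | g : Gen m
  | y : Gen m
  | u (i : ZMod m) : Gen m

section Presentation

variable {k : Type*} [Field k]

open Polynomial in
/-- The polynomial `φ_i = 1 - γ^{-i-1} x^d`, where `γ = ξ²`. -/
noncomputable def phi (d : ℕ) (ξ : k) (i : ℕ) : k[X] :=
  1 - C (((ξ ^ 2) ^ (i + 1))⁻¹) * X ^ d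

open Polynomial in
/-- The product of the `φ`'s that occurs in the relation for `u_i u_j`, with `0 ≤ i, j ≤ m - 1`:
`φ_i φ_{i+1} ⋯ φ_{m-2-j}` if `i + j ≤ m - 2`, `1` if `i + j = m - 1`, and
`φ_i ⋯ φ_{m-1} φ_0 ⋯ φ_{m-2-j}` otherwise. -/
noncomputable def phiProd (m d : ℕ) (ξ : k) (i j : ℕ) : k[X] :=
  if i + j + 2 ≤ m then ∏ t ∈ Finset.Ico i (m - 1 - j), phi d ξ t
  else if i + j + 1 = m then 1
  else (∏ t ∈ Finset.Ico i m, phi d ξ t) * ∏ t ∈ Finset.range (m - 1 - j), phi d ξ t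

/-- The scalar `(-1)^{-j} ξ^{-j} γ^{j(j+1)/2} / m`, where `γ = ξ²`. -/
noncomputable def uuCoeff (m : ℕ) (ξ : k) (j : ℕ) : k :=
  (-1) ^ j * (ξ ^ j)⁻¹ * (ξ ^ 2) ^ (j * (j + 1) / 2) * (m : k)⁻¹

/-- A generator, as an element of the free algebra. -/
abbrev gen (k : Type*) [Field k] {m : ℕ} (a : Gen m) : FreeAlgebra k (Gen m) :=
  FreeAlgebra.ι k a

open Gen in
/-- The defining relations of `D(m, d, ξ)`. -/
inductive Rel (m d : ℕ) (ξ : k) : FreeAlgebra k (Gen m) → FreeAlgebra k (Gen m) → Prop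
  | x_xinv : Rel m d ξ (gen k x * gen k xinv) 1
  | xinv_x : Rel m d ξ (gen k xinv * gen k x) 1
  | x_g : Rel m d ξ (gen k x * gen k g) (gen k g * gen k x)
  | x_y : Rel m d ξ (gen k x * gen k y) (gen k y * gen k x)
  | y_g : Rel m d ξ (gen k y * gen k g) (ξ ^ 2 • (gen k g * gen k y))
  | y_pow_x : Rel m d ξ (gen k y ^ m) (1 - gen k x ^ (m * d))
  | y_pow_g : Rel m d ξ (gen k y ^ m) (1 - gen k g ^ m)
  | x_u (i : ℕ) (hi : i < m) : Rel m d ξ (gen k x * gen k (u i)) (gen k (u i) * gen k xinv)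
  | y_u (i : ℕ) (hi : i < m) : Rel m d ξ (gen k y * gen k (u i))
      (Polynomial.aeval (gen k x) (phi d ξ i) * gen k (u ((i : ZMod m) + 1)))
  | y_u' (i : ℕ) (hi : i < m) : Rel m d ξ (gen k y * gen k (u i))
      (ξ • (gen k x ^ d * gen k (u i) * gen k y))
  | u_g (i : ℕ) (hi : i < m) : Rel m d ξ (gen k (u i) * gen k g)
      ((ξ ^ 2) ^ i • (gen k xinv ^ (2 * d) * gen k g * gen k (u i)))
  | u_u (i j : ℕ) (hi : i < m) (hj : j < m) : Rel m d ξ (gen k (u i) * gen k (u j))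
      (uuCoeff m ξ j • (gen k xinv ^ ((1 + m) * d / 2) *
        Polynomial.aeval (gen k x) (phiProd m d ξ i j) *
        gen k y ^ (if i + j < m then i + j else i + j - m) * gen k g))

/-- The algebra `D(m, d, ξ)`. -/
abbrev D (m d : ℕ) (ξ : k) : Type _ := RingQuot (Rel m d ξ)

/-- The image of a generator in `D(m, d, ξ)`. -/
noncomputable def D.of (m d : ℕ) (ξ : k) (a : Gen m) : D m d ξ :=
  RingQuot.mkAlgHom k (Rel m d ξ) (gen k a)

end Presentation

/-! ### The coproduct, the counit and the antipode on the generators -/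

open Coalgebra HopfAlgebra Gen in
/-- In a Hopf algebra `A` with a choice `a` of elements indexed by the generators, `Δ`, `ε` and `S`
are given on these elements by the formulas for `D(m, d, ξ)`. Here `γ = ξ²`, and `g⁻¹` is written
as `x^{-md} g^{m-1}`, since `g^m = x^{md}`. -/
structure HasHopfFormulas {k A : Type*} [Field k] [Ring A] [HopfAlgebra k A]
    (m d : ℕ) (ξ : k) (a : Gen m → A) : Prop where
  comul_x : comul (R := k) (a x) = a x ⊗ₜ[k] a x
  comul_g : comul (R := k) (a g) = a g ⊗ₜ[k] a g
  comul_y : comul (R := k) (a y) = a y ⊗ₜ[k] a g + 1 ⊗ₜ[k] a y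
  comul_u : ∀ i : ℕ, i < m → comul (R := k) (a (u i)) =
    ∑ j ∈ Finset.range m, (ξ ^ 2) ^ ((j : ℤ) * ((i : ℤ) - (j : ℤ))) •
      (a (u j) ⊗ₜ[k] (a xinv ^ (j * d) * a g ^ j * a (u ((i : ZMod m) - (j : ZMod m)))))
  counit_x : counit (R := k) (a x) = 1
  counit_g : counit (R := k) (a g) = 1
  counit_y : counit (R := k) (a y) = 0
  counit_u_zero : counit (R := k) (a (u 0)) = 1
  counit_u : ∀ s : ℕ, 1 ≤ s → s < m → counit (R := k) (a (u s)) = 0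
  antipode_x : antipode k (a x) = a xinv
  antipode_g : antipode k (a g) = a xinv ^ (m * d) * a g ^ (m - 1)
  antipode_y : antipode k (a y) = -(a y * (a xinv ^ (m * d) * a g ^ (m - 1)))
  antipode_u : ∀ i : ℕ, i < m → antipode k (a (u i)) =
    ((-1) ^ i * (ξ ^ i)⁻¹ * ((ξ ^ 2) ^ (i * (i + 1) / 2))⁻¹) •
      (a x ^ (i * d) * a xinv ^ (3 * ((m - 1) * d / 2)) * a g ^ (m - 1 - i) * a (u i))

/-- `H` is the Hopf algebra structure of `D(m, d, ξ)`: it extends the given algebra structure, and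
its coproduct, counit and antipode are given on the generators by the defining formulas. -/
def IsHopfStructure {k : Type*} [Field k] (m d : ℕ) (ξ : k) (H : HopfAlgebra k (D m d ξ)) : Prop :=
  H.toAlgebra = (inferInstance : Algebra k (D m d ξ)) ∧ HasHopfFormulas m d ξ (D.of m d ξ)

end DHopf

/-! Put `γ = ξ²`, `c = (1+m)d/2` and `h = x^{-d} g`. The two expressions for `y^m` give `g^m =
x^{md}`, so `h^m = 1`; moreover `h` commutes with `x`, and commutes with `y` and the `u_i` up to
powers of `γ`. With `h` in place of `g`, exponents of `h` and indices of `u` are both residues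
modulo `m`, and `Δ(u_i) = ∑_j γ^{j(i-j)} u_j ⊗ h^j u_{i-j}`, while `S(u_i)` is a multiple of
`x^{d-c} h^{-i-1} u_i`. The `γ`-binomial theorem (`prod_one_sub_smul`) turns the products of the
`φ_i` into sums, and the three cases for `u_i u_j` become one: `u_i u_j = q(j) γ^n / m · ∑_a [n+a
choose a] γ^{-ia} x^{da+d-c} h y^n`, where `n` represents `i + j` and `q(a) = (-1)^a ξ^{a²}` is a
quadratic function on `ℤ/m` with `q(a+b) = q(a) q(b) γ^{ab}`. The Gaussian coefficient vanishes once
`n + a ≥ m`, so `a` may run over all of `ℤ/m`.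

A family in a ring `B` that satisfies these relations (a model) is the same as a homomorphism from
`D` to `B`. The maps `Δ`, `ε`, `S` thus come from models in `D ⊗ D`, in `k` and in the opposite
algebra of `D`. The hard relation is the one for `u_i u_j`. In `D ⊗ D` the orthogonality of the
characters of `ℤ/m` collapses the product to a single family of terms, which the trinomial identity
for Gaussian coefficients identifies (`Data.tensor_u_u`). In the opposite algebra it is the
reflection `a ↦ -1-n-a` of Gaussian coefficients at a root of unity (`qChoose_reflect`,
`Data.opposite_u_u`). The Hopf axioms need checking on generators only, and the antipode axiom for
`u_i` is once more orthogonality.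

For non-pointedness, the elements `c_{ij} = γ^{i(j-i)} h^i u_{j-i}` satisfy `Δ(c_{ij}) = ∑_l c_{il}
⊗ c_{lj}`. If they are linearly independent they span a simple subcoalgebra of dimension `m² > 1`.
Independence is shown without a basis of `D`, by dual functionals (`D.exists_functional_umon`): a
two-dimensional representation detects `u_1`, its convolution powers detect the other `u_i`, and
convolution with characters separates the powers of `h`. -/

namespace DHopf

/-! ### Characters, the quadratic function and Gaussian coefficients on `ℤ/m`. -/

section Scalars

variable {k : Type*} [Field k] {m : ℕ}

/-- The character `a ↦ γ^a` of `ℤ/m`, where `γ = ξ²`. -/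
def rootPow (ξ : k) (a : ZMod m) : k := (ξ ^ 2) ^ a.val

/-- The function `a ↦ (-1)^a ξ^(a²)` on `ℤ/m`. -/
def quadChar (ξ : k) (a : ZMod m) : k := (-1) ^ a.val * ξ ^ (a.val ^ 2)

/-- The `γ`-factorial `(1 - γ)(1 - γ²) ⋯ (1 - γⁿ)`, where `γ = ξ²`. -/
def qFactorial (ξ : k) (n : ℕ) : k := ∏ t ∈ Finset.range n, (1 - (ξ ^ 2) ^ (t + 1))

/-- The Gaussian binomial coefficient of `a + b` over `a`, for residues `a`, `b` modulo `m`. -/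
def qChoose (ξ : k) (a b : ZMod m) : k :=
  qFactorial ξ (a.val + b.val) / (qFactorial ξ a.val * qFactorial ξ b.val)

theorem sum_zmod_eq_sum_range [NeZero m] {M : Type*} [AddCommMonoid M] (f : ZMod m → M) :
    ∑ a, f a = ∑ j ∈ Finset.range m, f (j : ZMod m) := by
  symm
  refine Finset.sum_bij (fun j _ => (j : ZMod m)) (fun _ _ => Finset.mem_univ _) ?_ ?_
    (fun _ _ => rfl)
  · intro a ha b hb hab
    have := congrArg ZMod.val hab
    rwa [ZMod.val_cast_of_lt (Finset.mem_range.1 ha),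
      ZMod.val_cast_of_lt (Finset.mem_range.1 hb)] at this
  · intro b _
    exact ⟨b.val, Finset.mem_range.2 (ZMod.val_lt b), ZMod.natCast_zmod_val b⟩

theorem val_add_val_lt_iff [NeZero m] (a b : ZMod m) :
    a.val + b.val < m ↔ (a + b).val = a.val + b.val := by
  refine ⟨ZMod.val_add_of_lt, fun h => h ▸ ZMod.val_lt _⟩

variable {ξ : k} (hξ : IsPrimitiveRoot ξ (2 * m))
include hξ

theorem isPrimitiveRoot_sq [NeZero m] : IsPrimitiveRoot (ξ ^ 2) m :=
  hξ.pow (by have := NeZero.pos m; omega) rfl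

theorem pow_eq_neg_one [NeZero m] : ξ ^ m = -1 := by
  have h : IsPrimitiveRoot (ξ ^ m) 2 := hξ.pow (by have := NeZero.pos m; omega) (mul_comm 2 m)
  exact h.eq_neg_one_of_two_right

theorem root_ne_zero [NeZero m] : ξ ≠ 0 :=
  hξ.ne_zero (by have := NeZero.pos m; omega)

theorem rootPow_intCast [NeZero m] (z : ℤ) : rootPow ξ (z : ZMod m) = (ξ ^ 2) ^ z := by
  have h0 : ξ ^ 2 ≠ 0 := pow_ne_zero _ (root_ne_zero hξ)
  obtain ⟨t, ht⟩ : ∃ t, z = ((z : ZMod m).val : ℤ) + m * t := by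
    refine ⟨z / m, ?_⟩
    rw [ZMod.val_intCast]
    exact (Int.emod_add_mul_ediv z m).symm
  conv_rhs => rw [ht]
  rw [rootPow, zpow_add₀ h0, zpow_mul, zpow_natCast, zpow_natCast,
    (isPrimitiveRoot_sq hξ).pow_eq_one, one_zpow, mul_one]

theorem rootPow_natCast [NeZero m] (n : ℕ) : rootPow ξ (n : ZMod m) = (ξ ^ 2) ^ n := by
  simpa using rootPow_intCast hξ n



theorem rootPow_add [NeZero m] (a b : ZMod m) :
    rootPow ξ (a + b) = rootPow ξ a * rootPow ξ b := by
  obtain ⟨a, rfl⟩ := ZMod.intCast_surjective a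
  obtain ⟨b, rfl⟩ := ZMod.intCast_surjective b
  rw [← Int.cast_add, rootPow_intCast hξ, rootPow_intCast hξ, rootPow_intCast hξ,
    zpow_add₀ (pow_ne_zero _ (root_ne_zero hξ))]

omit hξ in
@[simp] theorem rootPow_zero : rootPow ξ (0 : ZMod m) = 1 := by
  simp [rootPow]

theorem rootPow_one [NeZero m] : rootPow ξ (1 : ZMod m) = ξ ^ 2 := by
  simpa using rootPow_natCast hξ 1

theorem rootPow_ne_zero [NeZero m] (a : ZMod m) : rootPow ξ a ≠ 0 :=
  pow_ne_zero _ (pow_ne_zero _ (root_ne_zero hξ))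

theorem rootPow_neg [NeZero m] (a : ZMod m) : rootPow ξ (-a) = (rootPow ξ a)⁻¹ := by
  apply eq_inv_of_mul_eq_one_left
  rw [← rootPow_add hξ, neg_add_cancel, rootPow_zero]

theorem rootPow_eq_one_iff [NeZero m] (a : ZMod m) : rootPow ξ a = 1 ↔ a = 0 := by
  rw [rootPow, (isPrimitiveRoot_sq hξ).pow_eq_one_iff_dvd]
  constructor
  · intro h
    have := Nat.eq_zero_of_dvd_of_lt h (ZMod.val_lt a)
    exact (ZMod.val_eq_zero a).1 this
  · rintro rfl
    simp

theorem rootPow_nsmul [NeZero m] (a : ZMod m) (n : ℕ) :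
    rootPow ξ ((n : ZMod m) * a) = rootPow ξ a ^ n := by
  induction n with
  | zero => simp
  | succ n ih => rw [Nat.cast_succ, add_mul, rootPow_add hξ, ih, one_mul, pow_succ]

theorem sum_rootPow_mul [NeZero m] (a : ZMod m) :
    ∑ s : ZMod m, rootPow ξ (s * a) = if a = 0 then (m : k) else 0 := by
  split_ifs with h
  · simp [h, ZMod.card]
  · have hne : rootPow ξ a - 1 ≠ 0 := sub_ne_zero.2 fun h' => h ((rootPow_eq_one_iff hξ a).1 h')
    rw [sum_zmod_eq_sum_range]
    simp_rw [rootPow_nsmul hξ]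
    refine (mul_left_injective₀ hne).eq_iff.1 ?_
    rw [geom_sum_mul, ← rootPow_nsmul hξ]
    simp

/-- Replacing `z` by `z + mt` multiplies the right side by `(-1)^{mt} ξ^{2mzt} ξ^{m²t²} =
(-1)^{mt(t+1)} = 1`, because `ξ^m = -1`. For odd `m` the sign in the definition is what makes the
function periodic. -/
theorem quadChar_intCast [NeZero m] (z : ℤ) :
    quadChar ξ (z : ZMod m) = (-1) ^ z * ξ ^ (z ^ 2) := by
  have h0 := root_ne_zero hξ
  have h1 : (-1 : k) ≠ 0 := neg_ne_zero.2 one_ne_zero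
  obtain ⟨t, ht⟩ : ∃ t, z = ((z : ZMod m).val : ℤ) + m * t := by
    refine ⟨z / m, ?_⟩
    rw [ZMod.val_intCast]
    exact (Int.emod_add_mul_ediv z m).symm
  conv_rhs => rw [ht]
  set v := (z : ZMod m).val
  rw [quadChar]
  have e1 : ((v : ℤ) + m * t) ^ 2 = (v ^ 2 : ℕ) + (2 * m : ℕ) * (v * t) + (m : ℕ) * (m * t ^ 2) := by
    push_cast
    ring
  rw [e1, zpow_add₀ h0, zpow_add₀ h0, zpow_add₀ h1, zpow_mul ξ _ (v * t), zpow_natCast, zpow_natCast,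
    zpow_natCast _ (2 * m), hξ.pow_eq_one, one_zpow, zpow_mul ξ (m : ℤ), zpow_natCast ξ m,
    pow_eq_neg_one hξ]
  have : (-1 : k) ^ ((m : ℤ) * t) * (-1) ^ ((m : ℤ) * t ^ 2) = 1 := by
    rw [← zpow_add₀ h1]
    apply Even.neg_one_zpow
    have : (m : ℤ) * t + m * t ^ 2 = m * (t * (t + 1)) := by ring
    rw [this]
    exact (Int.even_mul_succ_self t).mul_left _
  linear_combination (-(-1) ^ v * ξ ^ v ^ 2) * this

theorem quadChar_natCast [NeZero m] (n : ℕ) :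
    quadChar ξ (n : ZMod m) = (-1) ^ n * ξ ^ (n ^ 2) := by
  have := quadChar_intCast hξ n
  rw [Int.cast_natCast] at this
  rw [this]
  norm_cast

theorem quadChar_add [NeZero m] (a b : ZMod m) :
    quadChar ξ (a + b) = quadChar ξ a * quadChar ξ b * rootPow ξ (a * b) := by
  have h0 := root_ne_zero hξ
  have h1 : (-1 : k) ≠ 0 := neg_ne_zero.2 one_ne_zero
  obtain ⟨a, rfl⟩ := ZMod.intCast_surjective a
  obtain ⟨b, rfl⟩ := ZMod.intCast_surjective b
  rw [← Int.cast_add, ← Int.cast_mul, rootPow_intCast hξ, quadChar_intCast hξ, quadChar_intCast hξ,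
    quadChar_intCast hξ]
  have e1 : (a + b) ^ 2 = a ^ 2 + b ^ 2 + (2 : ℕ) * (a * b) := by
    push_cast
    ring
  rw [e1, zpow_add₀ h0, zpow_add₀ h0, zpow_add₀ h1, zpow_mul, zpow_natCast]
  ring

theorem quadChar_ne_zero [NeZero m] (a : ZMod m) : quadChar ξ a ≠ 0 :=
  mul_ne_zero (pow_ne_zero _ (neg_ne_zero.2 one_ne_zero)) (pow_ne_zero _ (root_ne_zero hξ))

omit hξ in
@[simp] theorem quadChar_zero : quadChar ξ (0 : ZMod m) = 1 := by
  simp [quadChar]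

theorem quadChar_one [NeZero m] : quadChar ξ (1 : ZMod m) = -ξ := by
  simpa using quadChar_natCast hξ 1

theorem quadChar_sq [NeZero m] (a : ZMod m) : quadChar ξ a * quadChar ξ a = rootPow ξ (a * a) := by
  have h := quadChar_natCast hξ a.val
  have h' := rootPow_natCast hξ (a.val * a.val)
  rw [Nat.cast_mul] at h'
  rw [ZMod.natCast_zmod_val] at h h'
  rw [h, h', ← pow_mul, mul_mul_mul_comm, ← pow_add, ← pow_add, ← two_mul, pow_mul]
  simp [sq, two_mul]

omit hξ in
theorem qFactorial_succ (n : ℕ) :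
    qFactorial ξ (n + 1) = qFactorial ξ n * (1 - (ξ ^ 2) ^ (n + 1)) :=
  Finset.prod_range_succ _ _

omit hξ in
@[simp] theorem qFactorial_zero : qFactorial ξ 0 = 1 := rfl

theorem one_sub_pow_ne_zero [NeZero m] {n : ℕ} (h0 : 0 < n) (hn : n < m) :
    1 - (ξ ^ 2) ^ n ≠ 0 :=
  sub_ne_zero.2 fun h => (isPrimitiveRoot_sq hξ).pow_ne_one_of_pos_of_lt h0.ne' hn h.symm

theorem qFactorial_ne_zero [NeZero m] {n : ℕ} (hn : n < m) : qFactorial ξ n ≠ 0 :=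
  Finset.prod_ne_zero_iff.2 fun t ht =>
    one_sub_pow_ne_zero hξ t.succ_pos (by have := Finset.mem_range.1 ht; omega)

/-- The factor `1 - γ^m` is zero. Since the Gaussian coefficient has this factorial in its
numerator, it vanishes whenever the sum of representatives reaches `m`; every sum over `ℤ/m` below
is truncated in this way. -/
theorem qFactorial_eq_zero [NeZero m] {n : ℕ} (hn : m ≤ n) : qFactorial ξ n = 0 := by
  refine Finset.prod_eq_zero (i := m - 1) ?_ ?_
  · have := NeZero.pos m
    exact Finset.mem_range.2 (by omega)
  · rw [Nat.sub_add_cancel (NeZero.pos m), (isPrimitiveRoot_sq hξ).pow_eq_one, sub_self]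

theorem qChoose_eq_zero [NeZero m] {a b : ZMod m} (h : m ≤ a.val + b.val) :
    qChoose ξ a b = 0 := by
  rw [qChoose, qFactorial_eq_zero hξ h, zero_div]

@[simp] theorem qChoose_zero_left [NeZero m] (a : ZMod m) : qChoose ξ 0 a = 1 := by
  simp [qChoose, div_self (qFactorial_ne_zero hξ (ZMod.val_lt a))]

/-- The trinomial identity for Gaussian binomial coefficients. -/
theorem qChoose_mul_qChoose [NeZero m] (a b c : ZMod m) :
    qChoose ξ a c * qChoose ξ b (a + c) = qChoose ξ a b * qChoose ξ (a + b) c := by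
  have hF (x : ZMod m) : qFactorial ξ x.val ≠ 0 := qFactorial_ne_zero hξ (ZMod.val_lt x)
  by_cases h : a.val + b.val + c.val < m
  · have h1 := (val_add_val_lt_iff a b).1 (by omega)
    have h2 := (val_add_val_lt_iff a c).1 (by omega)
    have hab := hF (a + b)
    have hac := hF (a + c)
    have ha := hF a
    have hb := hF b
    have hc := hF c
    rw [h1] at hab
    rw [h2] at hac
    simp only [qChoose, h1, h2]
    rw [show b.val + (a.val + c.val) = a.val + b.val + c.val by ring]
    field_simp
  -- If the three representatives add up to at least `m`, a carry occurs either in the inner sum or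
  -- in the outer one, on each side of the identity, so both sides vanish.
  · have hl : qChoose ξ a c * qChoose ξ b (a + c) = 0 := by
      by_cases h2 : a.val + c.val < m
      · rw [qChoose_eq_zero hξ (a := b) (b := a + c), mul_zero]
        rw [(val_add_val_lt_iff a c).1 h2]
        omega
      · rw [qChoose_eq_zero hξ (not_lt.1 h2), zero_mul]
    have hr : qChoose ξ a b * qChoose ξ (a + b) c = 0 := by
      by_cases h2 : a.val + b.val < m
      · rw [qChoose_eq_zero hξ (a := a + b) (b := c), mul_zero]
        rw [(val_add_val_lt_iff a b).1 h2]
        omega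
      · rw [qChoose_eq_zero hξ (not_lt.1 h2), zero_mul]
    rw [hl, hr]

/-- Since `γ^m = 1`, `1 - γ^{n+1} = -γ^{n+1} (1 - γ^{m-1-n})`: each step of the induction moves one
factor from the first factorial to the second, at the cost of `-γ^{n+1}`. -/
theorem qFactorial_mul_reflect [NeZero m] (n : ℕ) (hn : n < m) :
    qFactorial ξ (m - 1 - n) * qFactorial ξ n =
      qFactorial ξ (m - 1) * ((-1) ^ n * ξ ^ (n * (n + 1))) := by
  induction n with
  | zero => simp
  | succ n ih =>
    have ih := ih (by omega)
    obtain ⟨l, rfl⟩ : ∃ l, m = l + n + 2 := ⟨m - n - 2, by omega⟩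
    have e1 : l + n + 2 - 1 - n = l + 1 := by omega
    have e2 : l + n + 2 - 1 - (n + 1) = l := by omega
    rw [e1, qFactorial_succ] at ih
    rw [e2, qFactorial_succ n]
    have hne : 1 - (ξ ^ 2) ^ (l + 1) ≠ 0 := one_sub_pow_ne_zero hξ l.succ_pos (by omega)
    have hm := (isPrimitiveRoot_sq hξ).pow_eq_one
    have key : 1 - (ξ ^ 2) ^ (n + 1) = -(ξ ^ 2) ^ (n + 1) * (1 - (ξ ^ 2) ^ (l + 1)) := by
      have : (ξ ^ 2) ^ (n + 1) * (ξ ^ 2) ^ (l + 1) = 1 := by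
        rw [← pow_add, ← hm]
        congr 1
        omega
      linear_combination -this
    rw [key]
    have e3 : ξ ^ ((n + 1) * (n + 1 + 1)) = ξ ^ (n * (n + 1)) * (ξ ^ 2) ^ (n + 1) := by
      rw [← pow_mul, ← pow_add]
      congr 1
      ring
    rw [e3]
    linear_combination (-(ξ ^ 2) ^ (n + 1)) * ih

/-- The truncated `γ`-binomial theorem. -/
theorem prod_one_sub_smul [NeZero m] {R : Type*} [CommRing R] [Algebra k R] (Z : R)
    (N : ℕ) (hN : N < m) :
    ∏ t ∈ Finset.range N, (1 - ((ξ ^ 2) ^ (t + 1))⁻¹ • Z) =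
      ∑ j ∈ Finset.range m,
        (qFactorial ξ (m - 1 - N + j) / (qFactorial ξ (m - 1 - N) * qFactorial ξ j)) • Z ^ j := by
  induction N with
  | zero =>
    obtain ⟨l, rfl⟩ : ∃ l, m = l + 1 := ⟨m - 1, by omega⟩
    -- For the empty product only the term `j = 0` survives: the others contain `(γ)_{m-1+j}` with
    -- `j ≥ 1`, which is zero.
    rw [Finset.sum_range_succ']
    have : ∀ j ∈ Finset.range l, (qFactorial ξ (l + 1 - 1 - 0 + (j + 1)) /
        (qFactorial ξ (l + 1 - 1 - 0) * qFactorial ξ (j + 1))) • Z ^ (j + 1) = 0 := by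
      intro j _
      rw [qFactorial_eq_zero hξ (by omega), zero_div, zero_smul]
    rw [Finset.sum_eq_zero this]
    simp [div_self (qFactorial_ne_zero hξ (show l < l + 1 by omega))]
  | succ N ih =>
    rw [Finset.prod_range_succ, ih (by omega)]
    obtain ⟨l, rfl⟩ : ∃ l, m = l + N + 2 := ⟨m - N - 2, by omega⟩
    have e1 : l + N + 2 - 1 - N = l + 1 := by omega
    have e2 : l + N + 2 - 1 - (N + 1) = l := by omega
    -- With `l = m - N - 2`, the new factor is `1 - γ^{l+1} Z`, and comparing coefficients becomes
    -- the Pascal rule for Gaussian coefficients.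
    have e3 : ((ξ ^ 2) ^ (N + 1))⁻¹ = (ξ ^ 2) ^ (l + 1) := by
      apply inv_eq_of_mul_eq_one_right
      rw [← pow_add, ← (isPrimitiveRoot_sq hξ).pow_eq_one]
      congr 1
      omega
    rw [e1, e2, e3, mul_sub, mul_one, mul_smul_comm, Finset.sum_mul, Finset.smul_sum]
    conv_lhs =>
      rw [Finset.sum_range_succ']
      arg 2
      rw [Finset.sum_range_succ]
    conv_rhs => rw [Finset.sum_range_succ']
    have hl := qFactorial_ne_zero hξ (show l < l + N + 2 by omega)
    have hl1 := qFactorial_ne_zero hξ (show l + 1 < l + N + 2 by omega)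
    have top : qFactorial ξ (l + 1 + (l + N + 1)) = 0 := qFactorial_eq_zero hξ (by omega)
    have low : qFactorial ξ (l + 1 + 0) / (qFactorial ξ (l + 1) * qFactorial ξ 0) =
        qFactorial ξ (l + 0) / (qFactorial ξ l * qFactorial ξ 0) := by
      simp [div_self hl, div_self hl1]
    rw [top, zero_div, zero_smul, zero_mul, smul_zero, low, add_zero (Finset.sum _ _),
      add_sub_right_comm, ← Finset.sum_sub_distrib]
    congr 1
    refine Finset.sum_congr rfl fun j hj => ?_
    have hj := Finset.mem_range.1 hj
    rw [smul_mul_assoc, ← pow_succ, smul_smul, ← sub_smul]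
    congr 1
    have hj0 := qFactorial_ne_zero hξ (show j < l + N + 2 by omega)
    have hj1 := one_sub_pow_ne_zero hξ (show 0 < j + 1 by omega) (show j + 1 < l + N + 2 by omega)
    have hl2 := one_sub_pow_ne_zero hξ (show 0 < l + 1 by omega) (show l + 1 < l + N + 2 by omega)
    rw [show l + 1 + (j + 1) = l + j + 1 + 1 by ring, show l + (j + 1) = l + j + 1 by ring,
      show l + 1 + j = l + j + 1 by ring, qFactorial_succ (l + j + 1), qFactorial_succ l,
      qFactorial_succ j]
    have e4 : (ξ ^ 2) ^ (l + j + 1 + 1) = (ξ ^ 2) ^ (l + 1) * (ξ ^ 2) ^ (j + 1) := by ring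
    rw [e4]
    generalize (ξ ^ 2) ^ (l + 1) = A at *
    generalize (ξ ^ 2) ^ (j + 1) = B at *
    field_simp
    ring

end Scalars

end DHopf

namespace DHopf

/-! ### The products of the `φ_i` as Gaussian sums. -/

section Polynomials

variable {k : Type*} [Field k] {m : ℕ} [NeZero m] {ξ : k} (hξ : IsPrimitiveRoot ξ (2 * m))
include hξ

theorem phi_add_modulus (d t : ℕ) : phi d ξ (t + m) = phi d ξ t := by
  rw [phi, phi, add_right_comm, pow_add _ (t + 1), (isPrimitiveRoot_sq hξ).pow_eq_one, mul_one]

/-- As `φ_t` depends only on `t` modulo `m`, each of the three cases is the cyclic product of `m - 1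
- n` consecutive factors from `φ_i` on, with `n` the representative of `i + j`. -/
theorem phiProd_eq_prod_range (d : ℕ) {i j : ℕ} (hi : i < m) (hj : j < m) :
    phiProd m d ξ i j =
      ∏ t ∈ Finset.range (m - 1 - ((i : ZMod m) + (j : ZMod m)).val), phi d ξ (i + t) := by
  have hv : ((i : ZMod m) + (j : ZMod m)).val = (i + j) % m := by
    rw [← Nat.cast_add, ZMod.val_natCast]
  rw [hv, phiProd]
  split_ifs with h1 h2
  · rw [Nat.mod_eq_of_lt (by omega), Finset.prod_Ico_eq_prod_range]
    congr 2
    omega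
  · rw [Nat.mod_eq_of_lt (by omega)]
    have : m - 1 - (i + j) = 0 := by omega
    simp [this]
  · have : (i + j) % m = i + j - m := by
      rw [Nat.mod_eq_sub_mod (by omega), Nat.mod_eq_of_lt (by omega)]
    rw [this, show m - 1 - (i + j - m) = (m - i) + (m - 1 - j) by omega, Finset.prod_range_add,
      Finset.prod_Ico_eq_prod_range]
    congr 1
    refine Finset.prod_congr rfl fun t _ => ?_
    rw [show i + (m - i + t) = t + m by omega, phi_add_modulus hξ]

-- This is the truncated `γ`-binomial theorem for `Z = γ^{-i} X^d` and `N = m - 1 - n`, so that `m -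
-- 1 - N = n`.
open Polynomial in
theorem phiProd_eq_sum (d : ℕ) {i j : ℕ} (hi : i < m) (hj : j < m) :
    phiProd m d ξ i j = ∑ a : ZMod m,
      (qChoose ξ ((i : ZMod m) + (j : ZMod m)) a * rootPow ξ (-((i : ZMod m) * a))) •
        (X : k[X]) ^ (d * a.val) := by
  have hlt := ZMod.val_lt ((i : ZMod m) + (j : ZMod m))
  have hphi (t : ℕ) : phi d ξ (i + t) =
      1 - ((ξ ^ 2) ^ (t + 1))⁻¹ • (rootPow ξ (-(i : ZMod m)) • (X : k[X]) ^ d) := by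
    rw [rootPow_neg hξ, rootPow_natCast hξ, smul_smul, ← mul_inv, ← pow_add, phi,
      smul_eq_C_mul, show t + 1 + i = i + t + 1 by ring]
  rw [phiProd_eq_prod_range hξ d hi hj, Finset.prod_congr rfl fun t _ => hphi t,
    prod_one_sub_smul hξ _ _ (by omega), sum_zmod_eq_sum_range]
  refine Finset.sum_congr rfl fun l hl => ?_
  rw [_root_.smul_pow, smul_smul, ← pow_mul, ZMod.val_cast_of_lt (Finset.mem_range.1 hl), qChoose,
    ZMod.val_cast_of_lt (Finset.mem_range.1 hl), ← rootPow_nsmul hξ]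
  rw [show m - 1 - (m - 1 - ((i : ZMod m) + (j : ZMod m)).val) = ((i : ZMod m) + (j : ZMod m)).val by omega]
  congr 3
  ring

end Polynomials

/-! ### Models of the relations, and the multiplication of monomials in a model. -/

/-- Elements of a ring that are candidates for the images of `x`, `h = x^{-d} g`, `y`
and the `u_i`. -/
structure Data (m : ℕ) (B : Type*) [Ring B] where
  /-- The image of `x`. -/
  x : Bˣ
  /-- The image of `x^{-d} g`. -/
  h : B
  /-- The image of `y`. -/
  y : B
  /-- The images of the `u_i`. -/
  u : ZMod m → B

namespace Data

variable {k : Type*} [Field k] {m : ℕ} {B : Type*} [Ring B]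

/-- The monomial `x^a h^b y^c`. -/
def mon (M : Data m B) (a : ℤ) (b : ZMod m) (c : ℕ) : B :=
  ((M.x ^ a : Bˣ) : B) * M.h ^ b.val * M.y ^ c

/-- The monomial `x^a h^b u_i`. -/
def umon (M : Data m B) (a : ℤ) (b : ZMod m) (i : ZMod m) : B :=
  ((M.x ^ a : Bˣ) : B) * M.h ^ b.val * M.u i

/-- The defining relations of `D(m, d, ξ)`, in terms of `x`, `h = x^{-d} g`, `y` and the `u_i`. -/
structure IsModel [NeZero m] [Algebra k B] (d : ℕ) (ξ : k) (M : Data m B) : Prop where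
  x_h : (M.x : B) * M.h = M.h * M.x
  x_y : (M.x : B) * M.y = M.y * M.x
  y_h : M.y * M.h = ξ ^ 2 • (M.h * M.y)
  h_pow : M.h ^ m = 1
  y_pow : M.y ^ m = 1 - (M.x : B) ^ (m * d)
  x_u (i : ZMod m) : (M.x : B) * M.u i = M.u i * ((M.x⁻¹ : Bˣ) : B)
  y_u (i : ZMod m) : M.y * M.u i =
    M.u (i + 1) - rootPow ξ (-(i + 1)) • ((M.x : B) ^ d * M.u (i + 1))
  y_u' (i : ZMod m) : M.y * M.u i = ξ • ((M.x : B) ^ d * M.u i * M.y)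
  u_h (i : ZMod m) : M.u i * M.h = rootPow ξ i • (M.h * M.u i)
  u_u (i j : ZMod m) : M.u i * M.u j = ∑ a : ZMod m,
    (quadChar ξ j * (m : k)⁻¹ * rootPow ξ (i + j) *
      (qChoose ξ (i + j) a * rootPow ξ (-(i * a)))) •
        M.mon ((d : ℤ) * a.val + d - ((1 + m) * d / 2 : ℕ)) 1 (i + j).val

variable [Algebra k B] {d : ℕ} {ξ : k} {M : Data m B}

namespace IsModel

section

variable [NeZero m] (hM : M.IsModel d ξ)
include hM

theorem h_pow_val_add (a b : ZMod m) : M.h ^ (a + b).val = M.h ^ a.val * M.h ^ b.val := by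
  rw [← pow_add, ZMod.val_add]
  conv_rhs => rw [← Nat.mod_add_div (a.val + b.val) m, pow_add, pow_mul, hM.h_pow, one_pow, mul_one]

theorem h_pow_val_one : M.h ^ (1 : ZMod m).val = M.h := by
  rcases Nat.lt_or_ge 1 m with h | h
  · have : Fact (1 < m) := ⟨h⟩
    rw [ZMod.val_one, pow_one]
  · have h1 : m = 1 := le_antisymm h (NeZero.pos m)
    have h2 : M.h = 1 := by simpa [h1] using hM.h_pow
    rw [h2, one_pow]

theorem commute_zpow_h (a : ℤ) (b : ℕ) : Commute ((M.x ^ a : Bˣ) : B) (M.h ^ b) :=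
  (Commute.units_zpow_left hM.x_h a).pow_right b

theorem commute_zpow_y (a : ℤ) (b : ℕ) : Commute ((M.x ^ a : Bˣ) : B) (M.y ^ b) :=
  (Commute.units_zpow_left hM.x_y a).pow_right b

theorem u_zpow (a : ℤ) (i : ZMod m) :
    M.u i * ((M.x ^ a : Bˣ) : B) = ((M.x ^ (-a) : Bˣ) : B) * M.u i := by
  have h : SemiconjBy (M.u i) ((M.x⁻¹ : Bˣ) : B) (M.x : B) := (hM.x_u i).symm
  have := SemiconjBy.units_zpow_right h (-a)
  rw [inv_zpow', neg_neg] at this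
  exact this

end

theorem mon_zero : M.mon 0 0 0 = 1 := by
  simp [mon]

theorem mon_zero_y (c : ℕ) : M.mon 0 0 c = M.y ^ c := by
  simp [mon]

theorem mon_x (a : ℤ) : M.mon a 0 0 = ((M.x ^ a : Bˣ) : B) := by
  simp [mon]

theorem umon_zero (i : ZMod m) : M.umon 0 0 i = M.u i := by
  simp [umon]

section

variable [NeZero m] (hξ : IsPrimitiveRoot ξ (2 * m)) (hM : M.IsModel d ξ)

include hM in
theorem mon_h (b : ℕ) : M.mon 0 b 0 = M.h ^ b := by
  simp only [mon, zpow_zero, Units.val_one, one_mul, pow_zero, mul_one]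
  rw [ZMod.val_natCast]
  conv_rhs => rw [← Nat.mod_add_div b m, pow_add, pow_mul, hM.h_pow, one_pow, mul_one]

include hM in
theorem mon_h_one : M.mon 0 1 0 = M.h := by
  simpa using hM.mon_h 1

include hξ hM

theorem u_h_pow (i b : ZMod m) :
    M.u i * M.h ^ b.val = rootPow ξ (i * b) • (M.h ^ b.val * M.u i) := by
  have (n : ℕ) : M.u i * M.h ^ n = rootPow ξ (i * (n : ZMod m)) • (M.h ^ n * M.u i) := by
    induction n with
    | zero => simp
    | succ n ih =>
      rw [pow_succ, ← mul_assoc, ih, smul_mul_assoc, mul_assoc, hM.u_h, mul_smul_comm, smul_smul,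
        ← mul_assoc, ← rootPow_add hξ, Nat.cast_succ, mul_add, mul_one]
  simpa using this b.val

theorem y_pow_h_pow (c : ℕ) (b : ZMod m) :
    M.y ^ c * M.h ^ b.val = rootPow ξ ((c : ZMod m) * b) • (M.h ^ b.val * M.y ^ c) := by
  have h1 (n : ℕ) : M.y * M.h ^ n = rootPow ξ (n : ZMod m) • (M.h ^ n * M.y) := by
    induction n with
    | zero => simp
    | succ n ih =>
      rw [pow_succ, ← mul_assoc, ih, smul_mul_assoc, mul_assoc, hM.y_h, mul_smul_comm, smul_smul,
        ← mul_assoc, Nat.cast_succ, rootPow_add hξ, rootPow_one hξ]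
  have h2 := h1 b.val
  rw [ZMod.natCast_zmod_val] at h2
  induction c with
  | zero => simp
  | succ c ih =>
    rw [pow_succ, mul_assoc, h2, mul_smul_comm, ← mul_assoc, ih, smul_mul_assoc, smul_smul,
      mul_assoc, ← pow_succ, ← rootPow_add hξ, Nat.cast_succ, add_mul, one_mul, add_comm]

theorem mon_mul_mon (a a' : ℤ) (b b' : ZMod m) (c c' : ℕ) :
    M.mon a b c * M.mon a' b' c' =
      rootPow ξ ((c : ZMod m) * b') • M.mon (a + a') (b + b') (c + c') := by
  simp only [mon]
  calc _ = ((M.x ^ a : Bˣ) : B) * M.h ^ b.val * ((M.y ^ c * ((M.x ^ a' : Bˣ) : B)) *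
          (M.h ^ b'.val * M.y ^ c')) := by simp only [mul_assoc]
    _ = ((M.x ^ a : Bˣ) : B) * (M.h ^ b.val * ((M.x ^ a' : Bˣ) : B)) * (M.y ^ c *
          M.h ^ b'.val) * M.y ^ c' := by
        rw [← (hM.commute_zpow_y a' c).eq]
        simp only [mul_assoc]
    _ = _ := by
        rw [← (hM.commute_zpow_h a' _).eq, hM.y_pow_h_pow hξ, hM.h_pow_val_add, zpow_add, pow_add,
          Units.val_mul]
        simp only [mul_assoc, mul_smul_comm, smul_mul_assoc]

theorem mon_mul_umon (a a' : ℤ) (b b' i : ZMod m) :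
    M.mon a b 0 * M.umon a' b' i = M.umon (a + a') (b + b') i := by
  have := hM.mon_mul_mon hξ a a' b b' 0 0
  simp only [mon, pow_zero, mul_one, Nat.cast_zero, zero_mul, rootPow_zero, one_smul,
    add_zero] at this
  simp only [umon, mon, pow_zero, mul_one]
  rw [← mul_assoc, this]

theorem umon_mul_mon (a a' : ℤ) (b b' i : ZMod m) :
    M.umon a b i * M.mon a' b' 0 = rootPow ξ (i * b') • M.umon (a - a') (b + b') i := by
  simp only [mon, pow_zero, mul_one, umon]
  calc _ = ((M.x ^ a : Bˣ) : B) * M.h ^ b.val * (M.u i * ((M.x ^ a' : Bˣ) : B)) *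
          M.h ^ b'.val := by simp only [mul_assoc]
    _ = ((M.x ^ a : Bˣ) : B) * (M.h ^ b.val * ((M.x ^ (-a') : Bˣ) : B)) * (M.u i *
          M.h ^ b'.val) := by
        rw [hM.u_zpow]
        simp only [mul_assoc]
    _ = _ := by
        rw [← (hM.commute_zpow_h _ _).eq, hM.u_h_pow hξ, hM.h_pow_val_add, sub_eq_add_neg, zpow_add,
          Units.val_mul]
        simp only [mul_assoc, mul_smul_comm]

theorem y_mul_umon (a : ℤ) (b i : ZMod m) :
    M.y * M.umon a b i = rootPow ξ b •
      (M.umon a b (i + 1) - rootPow ξ (-(i + 1)) • M.umon (a + d) b (i + 1)) := by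
  have h1 := hM.mon_mul_mon hξ 0 a 0 b 1 0
  simp only [mon_zero_y, zero_add, Nat.cast_one, one_mul, pow_one, add_zero] at h1
  have h2 := hM.mon_mul_mon hξ a 0 b 0 0 1
  simp only [mon_zero_y, zero_add, Nat.cast_zero, zero_mul, rootPow_zero, one_smul, pow_one,
    add_zero] at h2
  have h3 (i) (a : ℤ) : M.umon a b i = M.mon a b 0 * M.u i := by simp [umon, mon]
  have h4 : ((M.x : B) ^ d) = M.mon d 0 0 := by simp [mon]
  rw [h3, ← mul_assoc, h1, smul_mul_assoc, ← h2, mul_assoc, hM.y_u, h4, mul_sub, mul_smul_comm,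
    ← mul_assoc, hM.mon_mul_mon hξ, h3, h3]
  simp

theorem umon_mul_y (a : ℤ) (b i : ZMod m) :
    M.umon a b i * M.y = ξ⁻¹ •
      (M.umon (a - d) b (i + 1) - rootPow ξ (-(i + 1)) • M.umon a b (i + 1)) := by
  have h3 (i) (a : ℤ) : M.umon a b i = M.mon a b 0 * M.u i := by simp [umon, mon]
  have h4 : ((M.x : B) ^ d) = M.mon d 0 0 := by simp [mon]
  -- The second expression for `y u_i` is solved for `u_i y`, after which the first one applies.
  have h5 : M.u i * M.y = ξ⁻¹ • (M.mon (-d) 0 0 * (M.y * M.u i)) := by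
    rw [hM.y_u', mul_smul_comm, smul_smul, inv_mul_cancel₀ (root_ne_zero hξ), one_smul, h4,
      ← mul_assoc, ← mul_assoc, hM.mon_mul_mon hξ]
    simp [mon_zero]
  rw [h3, mul_assoc, h5, hM.y_u, mul_smul_comm, mul_sub, mul_sub, h4, mul_smul_comm,
    mul_smul_comm, ← mul_assoc, ← mul_assoc, ← mul_assoc, hM.mon_mul_mon hξ, smul_mul_assoc,
    smul_mul_assoc, hM.mon_mul_mon hξ, h3, h3]
  simp [sub_eq_add_neg]

theorem umon_mul_umon (a a' : ℤ) (b b' i j : ZMod m) :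
    M.umon a b i * M.umon a' b' j = ∑ l : ZMod m,
      (quadChar ξ j * (m : k)⁻¹ * rootPow ξ (i + j) * rootPow ξ (i * b') *
      (qChoose ξ (i + j) l * rootPow ξ (-(i * l)))) •
        M.mon (a - a' + (d * l.val + d - ((1 + m) * d / 2 : ℕ))) (b + b' + 1) (i + j).val := by
  have h3 : M.umon a' b' j = M.mon a' b' 0 * M.u j := by simp [umon, mon]
  have h4 : M.umon (a - a') (b + b') i = M.mon (a - a') (b + b') 0 * M.u i := by simp [umon, mon]
  rw [h3, ← mul_assoc, hM.umon_mul_mon hξ, h4, smul_mul_assoc, mul_assoc, hM.u_u, Finset.mul_sum,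
    Finset.smul_sum]
  refine Finset.sum_congr rfl fun l _ => ?_
  rw [mul_smul_comm, smul_smul, hM.mon_mul_mon hξ, Nat.cast_zero, zero_mul, rootPow_zero, one_smul,
    zero_add]
  congr 1
  ring

end

end IsModel

/-- The image of a family of elements under an algebra homomorphism. -/
@[simps] def map {B' : Type*} [Ring B'] [Algebra k B'] (M : Data m B) (f : B →ₐ[k] B') :
    Data m B' where
  x := Units.map f M.x
  h := f M.h
  y := f M.y
  u i := f (M.u i)

theorem map_mon {B' : Type*} [Ring B'] [Algebra k B'] (M : Data m B) (f : B →ₐ[k] B')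
    (a : ℤ) (b : ZMod m) (c : ℕ) : f (M.mon a b c) = (M.map f).mon a b c := by
  simp only [mon, map_mul, map_pow, map_x, map_h, map_y]
  congr 2
  rw [← map_zpow]
  rfl

theorem map_umon {B' : Type*} [Ring B'] [Algebra k B'] (M : Data m B) (f : B →ₐ[k] B')
    (a : ℤ) (b : ZMod m) (i : ZMod m) : f (M.umon a b i) = (M.map f).umon a b i := by
  simp only [umon, map_mul, map_pow, map_x, map_h, map_u]
  congr 2
  rw [← map_zpow]
  rfl

end Data

end DHopf

namespace DHopf

/-! ### The universal property of `D`, in terms of `h` instead of `g`. -/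

section Lift

variable {k : Type*} [Field k] {m : ℕ} {ξ : k}

theorem uuCoeff_eq [NeZero m] (hξ : IsPrimitiveRoot ξ (2 * m)) (j : ℕ) :
    uuCoeff m ξ j = quadChar ξ (j : ZMod m) * (m : k)⁻¹ := by
  have h : (ξ ^ 2) ^ (j * (j + 1) / 2) = ξ ^ j * ξ ^ j ^ 2 := by
    rw [← pow_mul, Nat.two_mul_div_two_of_even (Nat.even_mul_succ_self j), ← pow_add]
    congr 1
    ring
  rw [uuCoeff, h, quadChar_natCast hξ, mul_assoc ((-1) ^ j), ← mul_assoc (_⁻¹),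
    inv_mul_cancel₀ (pow_ne_zero _ (root_ne_zero hξ)), one_mul]

/-- Moving `g = x^d h` to the left of `y^n` produces `γ^n`, and the product of the `φ`'s is
expanded. Only relations that do not involve the `u_i` are assumed, since the identity serves both
to show that a model satisfies the defining relations and to show that the generators of `D` form a
model. -/
theorem uu_normal_form [NeZero m] {B : Type*} [Ring B] [Algebra k B]
    (hξ : IsPrimitiveRoot ξ (2 * m)) (d : ℕ) (M : Data m B)
    (x_y : (M.x : B) * M.y = M.y * M.x)
    (y_h : M.y * M.h = ξ ^ 2 • (M.h * M.y)) (h_pow : M.h ^ m = 1)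
    {i j : ℕ} (hi : i < m) (hj : j < m) :
    uuCoeff m ξ j • (((M.x⁻¹ : Bˣ) : B) ^ ((1 + m) * d / 2) *
        Polynomial.aeval (M.x : B) (phiProd m d ξ i j) *
        M.y ^ (if i + j < m then i + j else i + j - m) * ((M.x : B) ^ d * M.h)) =
    ∑ a : ZMod m,
      (quadChar ξ (j : ZMod m) * (m : k)⁻¹ * rootPow ξ ((i : ZMod m) + (j : ZMod m)) *
        (qChoose ξ ((i : ZMod m) + (j : ZMod m)) a * rootPow ξ (-((i : ZMod m) * a)))) •
          M.mon ((d : ℤ) * a.val + d - ((1 + m) * d / 2 : ℕ)) 1 ((i : ZMod m) + (j : ZMod m)).val := by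
  have hv : (if i + j < m then i + j else i + j - m) = ((i : ZMod m) + (j : ZMod m)).val := by
    rw [← Nat.cast_add, ZMod.val_natCast]
    split_ifs with h
    · rw [Nat.mod_eq_of_lt h]
    · rw [Nat.mod_eq_sub_mod (by omega), Nat.mod_eq_of_lt (by omega)]
  have hyh (n : ℕ) : M.y ^ n * M.h = rootPow ξ (n : ZMod m) • (M.h * M.y ^ n) := by
    induction n with
    | zero => simp
    | succ n ih =>
      rw [pow_succ, mul_assoc, y_h, mul_smul_comm, ← mul_assoc, ih, smul_mul_assoc, smul_smul,
        Nat.cast_succ, rootPow_add hξ, rootPow_one hξ, mul_assoc, mul_comm (ξ ^ 2)]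
  have h1 : M.h ^ (1 : ZMod m).val = M.h := by
    rcases Nat.lt_or_ge 1 m with h | h
    · have : Fact (1 < m) := ⟨h⟩
      rw [ZMod.val_one, pow_one]
    · have h1 : m = 1 := le_antisymm h (NeZero.pos m)
      have h2 : M.h = 1 := by simpa [h1] using h_pow
      rw [h2, one_pow]
  rw [uuCoeff_eq hξ, phiProd_eq_sum hξ d hi hj, hv, map_sum, Finset.mul_sum, Finset.sum_mul,
    Finset.sum_mul, Finset.smul_sum]
  refine Finset.sum_congr rfl fun a _ => ?_
  generalize ((i : ZMod m) + (j : ZMod m)) = n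
  have e1 : M.y ^ n.val * ((M.x : B) ^ d * M.h) =
      rootPow ξ n • ((M.x : B) ^ d * (M.h * M.y ^ n.val)) := by
    have hc : Commute ((M.x : B) ^ d) (M.y ^ n.val) := (show Commute (M.x : B) M.y from x_y).pow_pow _ _
    rw [← mul_assoc, ← hc.eq, mul_assoc, hyh, mul_smul_comm, ZMod.natCast_zmod_val]
  have e2 : ((M.x ^ ((d : ℤ) * a.val + d - ((1 + m) * d / 2 : ℕ)) : Bˣ) : B) =
      ((M.x⁻¹ : Bˣ) : B) ^ ((1 + m) * d / 2) * (M.x : B) ^ (d * a.val) * (M.x : B) ^ d := by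
    rw [← Units.val_pow_eq_pow_val, ← Units.val_pow_eq_pow_val, ← Units.val_pow_eq_pow_val,
      ← Units.val_mul, ← Units.val_mul]
    congr 1
    rw [← zpow_natCast, ← zpow_natCast, ← zpow_natCast, inv_zpow', ← zpow_add, ← zpow_add]
    congr 1
    push_cast
    ring
  rw [map_smul, map_pow, Polynomial.aeval_X, Data.mon, e2, h1, mul_assoc _ (M.y ^ _), e1]
  simp only [mul_smul_comm, smul_mul_assoc, smul_smul, mul_assoc]

namespace Data

variable {B : Type*} [Ring B]

/-- The images of the generators of `D(m, d, ξ)`. -/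
def ofGen (d : ℕ) (M : Data m B) : Gen m → B
  | .x => M.x
  | .xinv => ((M.x⁻¹ : Bˣ) : B)
  | .g => (M.x : B) ^ d * M.h
  | .y => M.y
  | .u i => M.u i

variable [Algebra k B] [NeZero m] {d : ℕ} {M : Data m B}

theorem ofGen_rel (hξ : IsPrimitiveRoot ξ (2 * m)) (hM : M.IsModel d ξ)
    ⦃p q : FreeAlgebra k (Gen m)⦄ (h : Rel m d ξ p q) :
    FreeAlgebra.lift k (M.ofGen d) p = FreeAlgebra.lift k (M.ofGen d) q := by
  have hxh : Commute (M.x : B) M.h := hM.x_h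
  have hxy : Commute (M.x : B) M.y := hM.x_y
  have hg : ((M.x : B) ^ d * M.h) ^ m = (M.x : B) ^ (m * d) := by
    rw [(hxh.pow_left d).mul_pow, hM.h_pow, mul_one, ← pow_mul, mul_comm]
  cases h with
  | x_xinv => simp [ofGen]
  | xinv_x => simp [ofGen]
  | x_g =>
    simp only [map_mul, FreeAlgebra.lift_ι_apply, ofGen]
    exact (((Commute.refl _).pow_right d).mul_right hxh).eq
  | x_y =>
    simp only [map_mul, FreeAlgebra.lift_ι_apply, ofGen]
    exact hM.x_y
  | y_g =>
    simp only [map_mul, map_smul, FreeAlgebra.lift_ι_apply, ofGen]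
    rw [← mul_assoc, ← (hxy.pow_left d).eq, mul_assoc, hM.y_h, mul_smul_comm, mul_assoc]
  | y_pow_x =>
    simp only [map_sub, map_one, map_pow, FreeAlgebra.lift_ι_apply, ofGen]
    exact hM.y_pow
  | y_pow_g =>
    simp only [map_sub, map_one, map_pow, FreeAlgebra.lift_ι_apply, ofGen]
    rw [hg, hM.y_pow]
  | x_u i hi =>
    simp only [map_mul, FreeAlgebra.lift_ι_apply, ofGen]
    exact hM.x_u _
  | y_u i hi =>
    simp only [map_mul, FreeAlgebra.lift_ι_apply, ofGen, ← Polynomial.aeval_algHom_apply]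
    rw [hM.y_u, phi, ← Nat.cast_succ, rootPow_neg hξ, rootPow_natCast hξ, map_sub, map_one,
      ← Polynomial.smul_eq_C_mul, map_smul, map_pow, Polynomial.aeval_X, sub_mul, one_mul,
      smul_mul_assoc]
  | y_u' i hi =>
    simp only [map_mul, map_smul, map_pow, FreeAlgebra.lift_ι_apply, ofGen]
    exact hM.y_u' _
  | u_g i hi =>
    simp only [map_mul, map_smul, map_pow, FreeAlgebra.lift_ι_apply, ofGen]
    have e1 := hM.u_zpow (d : ℤ) (i : ZMod m)
    have e2 : ((M.x ^ (-d : ℤ) : Bˣ) : B) = ((M.x⁻¹ : Bˣ) : B) ^ (2 * d) * (M.x : B) ^ d := by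
      rw [← Units.val_pow_eq_pow_val, ← Units.val_pow_eq_pow_val, ← Units.val_mul]
      congr 1
      rw [← zpow_natCast, ← zpow_natCast, inv_zpow', ← zpow_add]
      congr 1
      push_cast
      ring
    rw [zpow_natCast, Units.val_pow_eq_pow_val] at e1
    rw [← mul_assoc, e1, mul_assoc, hM.u_h, e2, mul_smul_comm, rootPow_natCast hξ]
    simp only [mul_assoc]
  | u_u i j hi hj =>
    simp only [map_mul, map_smul, map_pow, FreeAlgebra.lift_ι_apply, ofGen,
      ← Polynomial.aeval_algHom_apply]
    rw [uu_normal_form hξ d M hM.x_y hM.y_h hM.h_pow hi hj, hM.u_u]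

/-- The algebra homomorphism from `D(m, d, ξ)` defined by elements that satisfy the relations. -/
noncomputable def lift (M : Data m B) (hξ : IsPrimitiveRoot ξ (2 * m)) (hM : M.IsModel d ξ) :
    D m d ξ →ₐ[k] B :=
  RingQuot.liftAlgHom k ⟨FreeAlgebra.lift k (M.ofGen d), ofGen_rel hξ hM⟩

theorem lift_of (hξ : IsPrimitiveRoot ξ (2 * m)) (hM : M.IsModel d ξ) (a : Gen m) :
    M.lift hξ hM (D.of m d ξ a) = M.ofGen d a := by
  rw [lift, D.of, RingQuot.liftAlgHom_mkAlgHom_apply, FreeAlgebra.lift_ι_apply]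

end Data

theorem D.rel {d : ℕ} {p q : FreeAlgebra k (Gen m)} (h : Rel m d ξ p q) :
    RingQuot.mkAlgHom k (Rel m d ξ) p = RingQuot.mkAlgHom k (Rel m d ξ) q :=
  RingQuot.mkAlgHom_rel k h

variable (m ξ) in
/-- The generators of `D(m, d, ξ)`. -/
noncomputable def D.data (d : ℕ) : Data m (D m d ξ) where
  x := ⟨D.of m d ξ .x, D.of m d ξ .xinv, by simpa [D.of] using D.rel Rel.x_xinv,
    by simpa [D.of] using D.rel Rel.xinv_x⟩
  h := D.of m d ξ .xinv ^ d * D.of m d ξ .g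
  y := D.of m d ξ .y
  u i := D.of m d ξ (.u i)

theorem D.x_pow_mul_h (d : ℕ) :
    ((D.data m ξ d).x : D m d ξ) ^ d * (D.data m ξ d).h = D.of m d ξ .g := by
  change ((D.data m ξ d).x : D m d ξ) ^ d *
    ((((D.data m ξ d).x⁻¹ : (D m d ξ)ˣ) : D m d ξ) ^ d * D.of m d ξ .g) = _
  rw [← mul_assoc, ← Units.val_pow_eq_pow_val, ← Units.val_pow_eq_pow_val, inv_pow, Units.mul_inv,
    one_mul]

theorem D.ofGen_data (d : ℕ) : (D.data m ξ d).ofGen d = D.of m d ξ := by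
  funext a
  cases a with
  | g => exact D.x_pow_mul_h d
  | _ => rfl

theorem D.isModel_data [NeZero m] (hξ : IsPrimitiveRoot ξ (2 * m)) (d : ℕ) :
    (D.data m ξ d).IsModel d ξ := by
  set M := D.data m ξ d with hMdef
  have hg : (M.x : D m d ξ) ^ d * M.h = D.of m d ξ .g := D.x_pow_mul_h d
  have hh : M.h = ((M.x⁻¹ : (D m d ξ)ˣ) : D m d ξ) ^ d * D.of m d ξ .g := rfl
  have cxg : Commute (M.x : D m d ξ) (D.of m d ξ .g) := by
    have h0 := D.rel (d := d) (ξ := ξ) (m := m) Rel.x_g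
    simp only [map_mul] at h0
    exact h0
  have cxy : Commute (M.x : D m d ξ) M.y := by
    have h0 := D.rel (d := d) (ξ := ξ) (m := m) Rel.x_y
    simp only [map_mul] at h0
    exact h0
  have cxig : Commute ((M.x⁻¹ : (D m d ξ)ˣ) : D m d ξ) (D.of m d ξ .g) := cxg.units_inv_left
  have cxiy : Commute ((M.x⁻¹ : (D m d ξ)ˣ) : D m d ξ) M.y := cxy.units_inv_left
  have cxxi : Commute (M.x : D m d ξ) ((M.x⁻¹ : (D m d ξ)ˣ) : D m d ξ) :=
    (Commute.refl (M.x : D m d ξ)).units_inv_right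
  have x_h : (M.x : D m d ξ) * M.h = M.h * M.x := ((cxxi.pow_right d).mul_right cxg).eq
  have y_g : M.y * D.of m d ξ .g = ξ ^ 2 • (D.of m d ξ .g * M.y) := by
    have h0 := D.rel (d := d) (ξ := ξ) (m := m) Rel.y_g
    simp only [map_mul, map_smul] at h0
    exact h0
  have y_h : M.y * M.h = ξ ^ 2 • (M.h * M.y) := by
    rw [hh, ← mul_assoc, ← (cxiy.pow_left d).eq, mul_assoc, y_g, mul_smul_comm, mul_assoc]
  have y_pow : M.y ^ m = 1 - (M.x : D m d ξ) ^ (m * d) := by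
    have h0 := D.rel (d := d) (ξ := ξ) (m := m) Rel.y_pow_x
    simp only [map_sub, map_pow, map_one] at h0
    exact h0
  have y_pow_g : M.y ^ m = 1 - D.of m d ξ .g ^ m := by
    have h0 := D.rel (d := d) (ξ := ξ) (m := m) Rel.y_pow_g
    simp only [map_sub, map_pow, map_one] at h0
    exact h0
  -- Comparing the two expressions for `y^m` gives `g^m = x^{md}`, whence `h^m = 1`.
  have g_pow : D.of m d ξ .g ^ m = (M.x : D m d ξ) ^ (m * d) :=
    (sub_right_injective (y_pow.symm.trans y_pow_g)).symm
  have h_pow : M.h ^ m = 1 := by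
    rw [hh, (cxig.pow_left d).mul_pow, g_pow, ← pow_mul, mul_comm d m, ← Units.val_pow_eq_pow_val,
      ← Units.val_pow_eq_pow_val, inv_pow, Units.inv_mul]
  have x_u (i : ZMod m) : (M.x : D m d ξ) * M.u i = M.u i * ((M.x⁻¹ : (D m d ξ)ˣ) : D m d ξ) := by
    have := D.rel (d := d) (ξ := ξ) (m := m) (Rel.x_u i.val (ZMod.val_lt i))
    rw [ZMod.natCast_zmod_val] at this
    simp only [map_mul] at this
    exact this
  refine ⟨x_h, cxy, y_h, h_pow, y_pow, x_u, fun i => ?_, fun i => ?_, fun i => ?_, fun i j => ?_⟩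
  · have := D.rel (d := d) (ξ := ξ) (m := m) (Rel.y_u i.val (ZMod.val_lt i))
    rw [ZMod.natCast_zmod_val, map_mul, map_mul, ← Polynomial.aeval_algHom_apply, phi, map_sub,
      map_one, ← Polynomial.smul_eq_C_mul, map_smul, map_pow, Polynomial.aeval_X, sub_mul, one_mul,
      smul_mul_assoc, ← rootPow_natCast hξ, Nat.cast_succ, ZMod.natCast_zmod_val,
      ← rootPow_neg hξ] at this
    exact this
  · have := D.rel (d := d) (ξ := ξ) (m := m) (Rel.y_u' i.val (ZMod.val_lt i))
    rw [ZMod.natCast_zmod_val] at this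
    simp only [map_mul, map_smul, map_pow] at this
    exact this
  · have := D.rel (d := d) (ξ := ξ) (m := m) (Rel.u_g i.val (ZMod.val_lt i))
    rw [ZMod.natCast_zmod_val, map_mul, map_smul, map_mul, map_mul, map_pow,
      ← rootPow_natCast hξ, ZMod.natCast_zmod_val] at this
    have ug : M.u i * D.of m d ξ .g = rootPow ξ i •
      (((M.x⁻¹ : (D m d ξ)ˣ) : D m d ξ) ^ (2 * d) * D.of m d ξ .g * M.u i) := this
    have uxi : M.u i * ((M.x⁻¹ : (D m d ξ)ˣ) : D m d ξ) ^ d = (M.x : D m d ξ) ^ d * M.u i :=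
      (SemiconjBy.pow_right (show SemiconjBy (M.u i) _ _ from (x_u i).symm) d)
    have e : (M.x : D m d ξ) ^ d * ((M.x⁻¹ : (D m d ξ)ˣ) : D m d ξ) ^ (2 * d) =
        ((M.x⁻¹ : (D m d ξ)ˣ) : D m d ξ) ^ d := by
      rw [two_mul, pow_add, ← mul_assoc, ← cxxi.mul_pow, Units.mul_inv, one_pow, one_mul]
    rw [hh, ← mul_assoc, uxi, mul_assoc, ug, mul_smul_comm, ← mul_assoc, ← mul_assoc, e]
  · have := D.rel (d := d) (ξ := ξ) (m := m) (Rel.u_u i.val j.val (ZMod.val_lt i) (ZMod.val_lt j))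
    rw [map_mul, map_smul, map_mul, map_mul, map_mul, map_pow, map_pow,
      ← Polynomial.aeval_algHom_apply] at this
    have h2 := uu_normal_form hξ d M cxy y_h h_pow (ZMod.val_lt i) (ZMod.val_lt j)
    rw [hg] at h2
    have := this.trans h2
    simp only [ZMod.natCast_zmod_val] at this
    exact this

/-- Two algebra homomorphisms from `D(m, d, ξ)` that agree on `x`, `g`, `y` and the `u_i` are
equal. -/
theorem D.algHom_ext_of {B : Type*} [Semiring B] [Algebra k B] {d : ℕ} {f f' : D m d ξ →ₐ[k] B}
    (hx : f (D.of m d ξ .x) = f' (D.of m d ξ .x)) (hg : f (D.of m d ξ .g) = f' (D.of m d ξ .g))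
    (hy : f (D.of m d ξ .y) = f' (D.of m d ξ .y))
    (hu : ∀ i, f (D.of m d ξ (.u i)) = f' (D.of m d ξ (.u i))) : f = f' := by
  apply RingQuot.ringQuot_ext'
  apply FreeAlgebra.hom_ext
  funext a
  change f (D.of m d ξ a) = f' (D.of m d ξ a)
  cases a with
  | x => exact hx
  | xinv =>
    have h1 : f ((D.data m ξ d).x) * f (((D.data m ξ d).x⁻¹ : (D m d ξ)ˣ)) = 1 := by
      rw [← map_mul, Units.mul_inv, map_one]
    have h2 : f' (((D.data m ξ d).x⁻¹ : (D m d ξ)ˣ)) * f' ((D.data m ξ d).x) = 1 := by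
      rw [← map_mul, Units.inv_mul, map_one]
    rw [show f (D.data m ξ d).x = f' (D.data m ξ d).x from hx] at h1
    exact (left_inv_eq_right_inv h2 h1).symm
  | g => exact hg
  | y => exact hy
  | u i => exact hu i

/-- Two algebra homomorphisms from `D(m, d, ξ)` that agree on `x`, `h`, `y` and the `u_i` are
equal. -/
theorem D.algHom_ext {B : Type*} [Semiring B] [Algebra k B] {d : ℕ} {f f' : D m d ξ →ₐ[k] B}
    (hx : f (D.data m ξ d).x = f' (D.data m ξ d).x)
    (hh : f (D.data m ξ d).h = f' (D.data m ξ d).h)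
    (hy : f (D.data m ξ d).y = f' (D.data m ξ d).y)
    (hu : ∀ i, f ((D.data m ξ d).u i) = f' ((D.data m ξ d).u i)) : f = f' := by
  refine D.algHom_ext_of hx ?_ hy hu
  rw [← D.x_pow_mul_h d, map_mul, map_mul, map_pow, map_pow, hx, hh]

/-- The elements of `D(m, d, ξ)` that are obtained from the generators by sums, products and scalar
multiples exhaust `D(m, d, ξ)`. -/
theorem D.adjoin_range_of (d : ℕ) : Algebra.adjoin k (Set.range (D.of m d ξ)) = ⊤ := by
  have h : Set.range (D.of m d ξ) =
      RingQuot.mkAlgHom k (Rel m d ξ) '' Set.range (FreeAlgebra.ι k) := by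
    rw [← Set.range_comp]
    rfl
  rw [h, ← AlgHom.map_adjoin, FreeAlgebra.adjoin_range_ι, Algebra.map_top,
    AlgHom.range_eq_top]
  exact RingQuot.mkAlgHom_surjective k _

end Lift

end DHopf

namespace DHopf

/-! ### Powers of a sum of two `γ`-commuting elements. -/

section QBinomial

variable {k : Type*} [Field k] {m : ℕ} {ξ : k}

/-- Gaussian binomial coefficients at `γ = ξ²`, by the Pascal recursion. -/
def qBinom (ξ : k) : ℕ → ℕ → k
  | 0, 0 => 1
  | 0, _ + 1 => 0
  | n + 1, 0 => qBinom ξ n 0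
  | n + 1, r + 1 => qBinom ξ n r + (ξ ^ 2) ^ (r + 1) * qBinom ξ n (r + 1)

@[simp] theorem qBinom_zero_right (n : ℕ) : qBinom ξ n 0 = 1 := by
  induction n with
  | zero => rfl
  | succ n ih => rw [qBinom, ih]

theorem qBinom_eq_zero {n r : ℕ} (h : n < r) : qBinom ξ n r = 0 := by
  induction n generalizing r with
  | zero =>
    obtain ⟨r, rfl⟩ : ∃ s, r = s + 1 := ⟨r - 1, by omega⟩
    rfl
  | succ n ih =>
    obtain ⟨r, rfl⟩ : ∃ s, r = s + 1 := ⟨r - 1, by omega⟩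
    rw [qBinom, ih (by omega), ih (by omega), mul_zero, add_zero]

@[simp] theorem qBinom_self (n : ℕ) : qBinom ξ n n = 1 := by
  induction n with
  | zero => rfl
  | succ n ih => rw [qBinom, ih, qBinom_eq_zero n.lt_succ_self, mul_zero, add_zero]

/-- Stated without division because the factorials vanish from `m` on, and the case `n = m` is
needed. The induction uses `1 - γ^{a+b} = (1 - γ^a) + γ^a (1 - γ^b)`. -/
theorem qBinom_mul_qFactorial {n r : ℕ} (h : r ≤ n) :
    qBinom ξ n r * (qFactorial ξ r * qFactorial ξ (n - r)) = qFactorial ξ n := by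
  induction n generalizing r with
  | zero =>
    obtain rfl : r = 0 := by omega
    simp
  | succ n ih =>
    rcases r with _ | r
    · simp
    rcases (Nat.lt_or_ge r n) with hr | hr
    · obtain ⟨l, rfl⟩ : ∃ l, n = r + 1 + l := ⟨n - r - 1, by omega⟩
      have h1 := ih (show r ≤ r + 1 + l by omega)
      have h2 := ih (show r + 1 ≤ r + 1 + l by omega)
      rw [show r + 1 + l - r = l + 1 by omega, qFactorial_succ] at h1
      rw [show r + 1 + l - (r + 1) = l by omega] at h2
      rw [show r + 1 + l + 1 - (r + 1) = l + 1 by omega, qBinom, qFactorial_succ (r + 1 + l),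
        qFactorial_succ l, add_mul]
      have e : (ξ ^ 2) ^ (r + 1 + l + 1) = (ξ ^ 2) ^ (r + 1) * (ξ ^ 2) ^ (l + 1) := by ring
      rw [e]
      have h3 := qFactorial_succ (ξ := ξ) r
      rw [h3] at h2 ⊢
      linear_combination (1 - (ξ ^ 2) ^ (r + 1)) * h1 +
        ((ξ ^ 2) ^ (r + 1) * (1 - (ξ ^ 2) ^ (l + 1))) * h2
    · obtain rfl : r = n := by omega
      simp

/-- The `γ`-binomial theorem. -/
theorem add_pow_of_qCommute {R : Type*} [Ring R] [Algebra k R] {a b : R}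
    (h : a * b = ξ ^ 2 • (b * a)) (n : ℕ) :
    (b + a) ^ n = ∑ r ∈ Finset.range (n + 1), qBinom ξ n r • (b ^ r * a ^ (n - r)) := by
  have hab (r : ℕ) : a * b ^ r = (ξ ^ 2) ^ r • (b ^ r * a) := by
    induction r with
    | zero => simp
    | succ r ih =>
      rw [pow_succ b, ← mul_assoc, ih, smul_mul_assoc, mul_assoc, h, mul_smul_comm, smul_smul,
        ← mul_assoc, pow_succ (ξ ^ 2)]
  induction n with
  | zero => simp
  | succ n ih =>
    rw [pow_succ', ih, add_mul, Finset.mul_sum, Finset.mul_sum, Finset.sum_range_succ' _ (n + 1)]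
    have e1 : ∑ r ∈ Finset.range (n + 1), b * qBinom ξ n r • (b ^ r * a ^ (n - r)) =
        ∑ r ∈ Finset.range (n + 1), qBinom ξ n r • (b ^ (r + 1) * a ^ (n - r)) := by
      refine Finset.sum_congr rfl fun r _ => ?_
      rw [mul_smul_comm, ← mul_assoc, pow_succ']
    have e2 : ∑ r ∈ Finset.range (n + 1), a * qBinom ξ n r • (b ^ r * a ^ (n - r)) =
        ∑ r ∈ Finset.range (n + 1),
          ((ξ ^ 2) ^ (r + 1) * qBinom ξ n (r + 1)) • (b ^ (r + 1) * a ^ (n - r)) +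
          a ^ (n + 1) := by
      have e3 : ∀ r ∈ Finset.range (n + 1), a * qBinom ξ n r • (b ^ r * a ^ (n - r)) =
          ((ξ ^ 2) ^ r * qBinom ξ n r) • (b ^ r * a ^ (n + 1 - r)) := by
        intro r hr
        rw [mul_smul_comm, ← mul_assoc, hab, smul_mul_assoc, smul_smul, mul_assoc, ← pow_succ',
          mul_comm (qBinom _ _ _), Nat.succ_sub (Nat.lt_succ_iff.1 (Finset.mem_range.1 hr))]
      rw [Finset.sum_congr rfl e3, Finset.sum_range_succ', Finset.sum_range_succ _ n,
        qBinom_eq_zero n.lt_succ_self]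
      simp
    rw [e1, e2, ← add_assoc, ← Finset.sum_add_distrib]
    congr 1
    · refine Finset.sum_congr rfl fun r _ => ?_
      rw [← add_smul, qBinom, Nat.add_sub_add_right]
    · simp

variable [NeZero m] (hξ : IsPrimitiveRoot ξ (2 * m))
include hξ

/-- For `0 < r < m` the coefficient times two nonzero factorials equals `(γ)_m = 0`, so only the
extreme terms remain. This gives `Δ(y)^m`. -/
theorem add_pow_modulus_of_qCommute {R : Type*} [Ring R] [Algebra k R] {a b : R}
    (h : a * b = ξ ^ 2 • (b * a)) : (b + a) ^ m = b ^ m + a ^ m := by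
  obtain ⟨l, rfl⟩ : ∃ l, m = l + 1 := ⟨m - 1, by have := NeZero.pos m; omega⟩
  rw [add_pow_of_qCommute h, Finset.sum_range_succ, Finset.sum_range_succ', Finset.sum_eq_zero]
  · simp [add_comm]
  · intro r hr
    have hr := Finset.mem_range.1 hr
    have h1 := qBinom_mul_qFactorial (ξ := ξ) (show r + 1 ≤ l + 1 by omega)
    rw [qFactorial_eq_zero hξ le_rfl] at h1
    rw [(mul_eq_zero.1 h1).resolve_right (mul_ne_zero (qFactorial_ne_zero hξ (by omega))
      (qFactorial_ne_zero hξ (by omega))), zero_smul]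

/-- The `γ`-binomial theorem with `r` running over all residues: if the representative of `r`
exceeds that of `n`, adding `r` and `n - r` carries and the coefficient is zero. -/
theorem add_pow_val_of_qCommute {R : Type*} [Ring R] [Algebra k R] {a b : R}
    (h : a * b = ξ ^ 2 • (b * a)) (n : ZMod m) :
    (b + a) ^ n.val = ∑ r : ZMod m, qChoose ξ r (n - r) • (b ^ r.val * a ^ (n - r).val) := by
  rw [add_pow_of_qCommute h, sum_zmod_eq_sum_range]
  refine Finset.sum_subset_zero_on_sdiff ?_ ?_ ?_
  · exact Finset.range_subset_range.2 (ZMod.val_lt n)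
  · intro r hr
    have h1 : r < m := Finset.mem_range.1 (Finset.mem_sdiff.1 hr).1
    have h2 : ¬ r < n.val + 1 := fun h => (Finset.mem_sdiff.1 hr).2 (Finset.mem_range.2 h)
    rw [qChoose_eq_zero hξ, zero_smul]
    by_contra hlt
    have := (val_add_val_lt_iff _ _).1 (not_le.1 hlt)
    rw [add_sub_cancel, ZMod.val_cast_of_lt h1] at this
    omega
  · intro r hr
    have hr := Finset.mem_range.1 hr
    have hn := ZMod.val_lt n
    have h1 : (r : ZMod m).val = r := ZMod.val_cast_of_lt (by omega)
    have h2 : (n - r).val = n.val - r := by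
      rw [ZMod.val_sub (by omega), h1]
    have h3 := qBinom_mul_qFactorial (ξ := ξ) (show r ≤ n.val by omega)
    rw [qChoose, h1, h2, Nat.add_sub_cancel' (by omega), ← h3, mul_div_cancel_right₀]
    exact mul_ne_zero (qFactorial_ne_zero hξ (by omega)) (qFactorial_ne_zero hξ (by omega))

end QBinomial

end DHopf

namespace DHopf

namespace Data

/-! ### The coproduct formulas define a model in a tensor product. -/

section Tensor

variable {k : Type*} [Field k] {m : ℕ} {A A' : Type*} [Ring A] [Algebra k A] [Ring A']
  [Algebra k A']

/-- The unit `a ⊗ b` of a tensor product, for units `a` and `b`. -/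
def tmulUnit (k : Type*) {A A' : Type*} [Field k] [Ring A] [Algebra k A] [Ring A'] [Algebra k A']
    (a : Aˣ) (b : A'ˣ) : (A ⊗[k] A')ˣ where
  val := (a : A) ⊗ₜ[k] (b : A')
  inv := ((a⁻¹ : Aˣ) : A) ⊗ₜ[k] ((b⁻¹ : A'ˣ) : A')
  val_inv := by
    rw [Algebra.TensorProduct.tmul_mul_tmul, Units.mul_inv, Units.mul_inv,
      Algebra.TensorProduct.one_def]
  inv_val := by
    rw [Algebra.TensorProduct.tmul_mul_tmul, Units.inv_mul, Units.inv_mul,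
      Algebra.TensorProduct.one_def]

theorem tmulUnit_zpow (a : Aˣ) (b : A'ˣ) (n : ℤ) :
    (tmulUnit k a b) ^ n = tmulUnit k (a ^ n) (b ^ n) := by
  let f : Aˣ × A'ˣ →* (A ⊗[k] A')ˣ :=
    { toFun := fun p => tmulUnit k p.1 p.2
      map_one' := Units.ext rfl
      map_mul' := fun p q => Units.ext (by
        simp [tmulUnit, Algebra.TensorProduct.tmul_mul_tmul]) }
  exact (map_zpow f (a, b) n).symm

theorem mon_eq_mul (M : Data m A) (a : ℤ) (b : ZMod m) (c : ℕ) :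
    M.mon a b c = M.mon a b 0 * M.y ^ c := by
  simp [mon]

theorem umon_eq_mul (M : Data m A) (a : ℤ) (b : ZMod m) (i : ZMod m) :
    M.umon a b i = M.mon a b 0 * M.u i := by
  simp [mon, umon]

variable [NeZero m]

/-- The elements of `A ⊗ A'` given by the formulas for the coproduct. -/
noncomputable def tensor (d : ℕ) (ξ : k) (M : Data m A) (M' : Data m A') :
    Data m (A ⊗[k] A') where
  x := tmulUnit k M.x M'.x
  h := M.h ⊗ₜ M'.h
  y := M.y ⊗ₜ M'.mon d 1 0 + 1 ⊗ₜ M'.y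
  u i := ∑ j : ZMod m, rootPow ξ (j * (i - j)) • (M.u j ⊗ₜ[k] M'.umon 0 j (i - j))

variable {d : ℕ} {ξ : k} {M : Data m A} {M' : Data m A'}

theorem tensor_mon_zero (a : ℤ) (b : ZMod m) :
    (tensor d ξ M M').mon a b 0 = M.mon a b 0 ⊗ₜ M'.mon a b 0 := by
  simp only [mon, tensor, tmulUnit_zpow, pow_zero, mul_one, Algebra.TensorProduct.tmul_pow]
  exact Algebra.TensorProduct.tmul_mul_tmul _ _ _ _

variable (hξ : IsPrimitiveRoot ξ (2 * m)) (hM : M.IsModel d ξ) (hM' : M'.IsModel d ξ)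
include hξ hM hM'

omit hM in
theorem tensor_y_qCommute : ((1 : A) ⊗ₜ[k] M'.y) * (M.y ⊗ₜ M'.mon d 1 0) =
    ξ ^ 2 • ((M.y ⊗ₜ M'.mon d 1 0) * ((1 : A) ⊗ₜ[k] M'.y)) := by
  rw [Algebra.TensorProduct.tmul_mul_tmul, Algebra.TensorProduct.tmul_mul_tmul, one_mul, mul_one,
    ← pow_one M'.y, ← IsModel.mon_zero_y, hM'.mon_mul_mon hξ, hM'.mon_mul_mon hξ,
    TensorProduct.tmul_smul, ← rootPow_one hξ]
  simp

omit hM in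
theorem mon_g_pow (n : ℕ) : M'.mon d 1 0 ^ n = M'.mon (d * n) n 0 := by
  induction n with
  | zero => simp [IsModel.mon_zero]
  | succ n ih =>
    rw [pow_succ, ih, hM'.mon_mul_mon hξ]
    simp [mul_add]

omit hM in
theorem tensor_y_pow_val (n : ZMod m) : (tensor d ξ M M').y ^ n.val =
    ∑ r : ZMod m, qChoose ξ r (n - r) •
      (M.mon 0 0 r.val ⊗ₜ[k] M'.mon (d * r.val) r (n - r).val) := by
  simp only [tensor]
  rw [add_pow_val_of_qCommute hξ (tensor_y_qCommute hξ hM')]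
  refine Finset.sum_congr rfl fun r _ => ?_
  rw [Algebra.TensorProduct.tmul_pow, Algebra.TensorProduct.tmul_pow,
    Algebra.TensorProduct.tmul_mul_tmul, one_pow, mul_one, mon_g_pow hξ hM', IsModel.mon_zero_y,
    ← mon_eq_mul, ZMod.natCast_zmod_val]

theorem tensor_mon (a : ℤ) (b n : ZMod m) : (tensor d ξ M M').mon a b n.val =
    ∑ r : ZMod m, qChoose ξ r (n - r) •
      (M.mon a b r.val ⊗ₜ[k] M'.mon (a + d * r.val) (b + r) (n - r).val) := by
  rw [mon_eq_mul, tensor_mon_zero, tensor_y_pow_val hξ hM', Finset.mul_sum]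
  refine Finset.sum_congr rfl fun r _ => ?_
  rw [mul_smul_comm, Algebra.TensorProduct.tmul_mul_tmul, hM.mon_mul_mon hξ, hM'.mon_mul_mon hξ]
  simp

omit hM in
theorem tensor_umon (a : ℤ) (b i : ZMod m) : (tensor d ξ M M').umon a b i =
    ∑ j : ZMod m, rootPow ξ (j * (i - j)) •
      (M.umon a b j ⊗ₜ[k] M'.umon a (b + j) (i - j)) := by
  rw [umon_eq_mul, tensor_mon_zero]
  simp only [tensor]
  rw [Finset.mul_sum]
  refine Finset.sum_congr rfl fun r _ => ?_
  rw [mul_smul_comm, Algebra.TensorProduct.tmul_mul_tmul, ← umon_eq_mul, hM'.mon_mul_umon hξ,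
    add_zero]

-- The two relations for `y u_i` are verified by bringing three expressions to one normal form, in
-- which both tensor factors carry the same power of `x`, namely `x^0` or `x^d`. The terms with
-- different powers in the two factors cancel.
omit hM in
theorem tensor_y_u_expand (i : ZMod m) :
    (tensor d ξ M M').u (i + 1) -
      rootPow ξ (-(i + 1)) • (((tensor d ξ M M').x : A ⊗[k] A') ^ d * (tensor d ξ M M').u (i + 1)) =
    ∑ j : ZMod m, (rootPow ξ (j * (i + 1 - j)) •
        (M.umon 0 0 j ⊗ₜ[k] M'.umon 0 j (i + 1 - j)) -
      rootPow ξ (j * (i + 1 - j) - (i + 1)) •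
        (M.umon d 0 j ⊗ₜ[k] M'.umon d j (i + 1 - j))) := by
  have h1 : ((tensor d ξ M M').x : A ⊗[k] A') ^ d = (tensor d ξ M M').mon d 0 0 := by
    simp [mon]
  rw [h1, ← umon_eq_mul, ← IsModel.umon_zero (M := tensor d ξ M M'), tensor_umon hξ hM',
    tensor_umon hξ hM', Finset.smul_sum, ← Finset.sum_sub_distrib]
  refine Finset.sum_congr rfl fun j _ => ?_
  rw [smul_smul, ← rootPow_add hξ, zero_add, sub_eq_neg_add _ (i + 1)]

theorem tensor_y_u (i : ZMod m) : (tensor d ξ M M').y * (tensor d ξ M M').u i =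
    ∑ j : ZMod m, (rootPow ξ (j * (i + 1 - j)) •
        (M.umon 0 0 j ⊗ₜ[k] M'.umon 0 j (i + 1 - j)) -
      rootPow ξ (j * (i + 1 - j) - (i + 1)) •
        (M.umon d 0 j ⊗ₜ[k] M'.umon d j (i + 1 - j))) := by
  -- Here `y` raises the index of the left factor, so the sum is reindexed by `j ↦ j + 1`; in the
  -- second sum it raises the index of the right factor and no shift is needed.
  have e1 : ∑ j : ZMod m, (M.y ⊗ₜ[k] M'.mon d 1 0) *
        rootPow ξ (j * (i - j)) • (M.u j ⊗ₜ[k] M'.umon 0 j (i - j)) =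
      ∑ j : ZMod m, (rootPow ξ (j * (i + 1 - j) - (i + 1 - j)) •
          (M.umon 0 0 j ⊗ₜ[k] M'.umon d j (i + 1 - j)) -
        rootPow ξ (j * (i + 1 - j) - (i + 1)) •
          (M.umon d 0 j ⊗ₜ[k] M'.umon d j (i + 1 - j))) := by
    refine Fintype.sum_equiv (Equiv.addRight 1) _ _ fun j => ?_
    rw [Equiv.coe_addRight, mul_smul_comm, Algebra.TensorProduct.tmul_mul_tmul,
      hM'.mon_mul_umon hξ, ← IsModel.umon_zero (M := M), hM.y_mul_umon hξ, rootPow_zero, one_smul,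
      TensorProduct.sub_tmul, ← TensorProduct.smul_tmul', smul_sub, smul_smul, ← rootPow_add hξ,
      zero_add, add_zero, add_comm 1 j, add_sub_add_right_eq_sub]
    congr 3 <;> ring
  have e2 : ∑ j : ZMod m, ((1 : A) ⊗ₜ[k] M'.y) *
        rootPow ξ (j * (i - j)) • (M.u j ⊗ₜ[k] M'.umon 0 j (i - j)) =
      ∑ j : ZMod m, (rootPow ξ (j * (i + 1 - j)) •
          (M.umon 0 0 j ⊗ₜ[k] M'.umon 0 j (i + 1 - j)) -
        rootPow ξ (j * (i + 1 - j) - (i + 1 - j)) •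
          (M.umon 0 0 j ⊗ₜ[k] M'.umon d j (i + 1 - j))) := by
    refine Finset.sum_congr rfl fun j _ => ?_
    rw [mul_smul_comm, Algebra.TensorProduct.tmul_mul_tmul, one_mul, hM'.y_mul_umon hξ,
      IsModel.umon_zero, TensorProduct.tmul_smul, TensorProduct.tmul_sub, TensorProduct.tmul_smul,
      smul_sub, smul_sub, smul_smul, smul_smul, smul_smul, ← rootPow_add hξ, ← rootPow_add hξ,
      zero_add, show i - j + 1 = i + 1 - j by ring]
    congr 3 <;> ring
  change (M.y ⊗ₜ[k] M'.mon d 1 0 + (1 : A) ⊗ₜ[k] M'.y) *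
    (∑ j : ZMod m, rootPow ξ (j * (i - j)) • (M.u j ⊗ₜ[k] M'.umon 0 j (i - j))) = _
  rw [add_mul, Finset.mul_sum, Finset.mul_sum, e1, e2, ← Finset.sum_add_distrib]
  refine Finset.sum_congr rfl fun j _ => ?_
  abel

theorem tensor_u_y (i : ZMod m) :
    ξ • (((tensor d ξ M M').x : A ⊗[k] A') ^ d * (tensor d ξ M M').u i * (tensor d ξ M M').y) =
    ∑ j : ZMod m, (rootPow ξ (j * (i + 1 - j)) •
        (M.umon 0 0 j ⊗ₜ[k] M'.umon 0 j (i + 1 - j)) -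
      rootPow ξ (j * (i + 1 - j) - (i + 1)) •
        (M.umon d 0 j ⊗ₜ[k] M'.umon d j (i + 1 - j))) := by
  have hξ0 := root_ne_zero hξ
  have e1 : ∑ j : ZMod m, (rootPow ξ (j * (i - j)) •
        (M.umon d 0 j ⊗ₜ[k] M'.umon d j (i - j))) * (M.y ⊗ₜ[k] M'.mon d 1 0) =
      ∑ j : ZMod m, ξ⁻¹ • (rootPow ξ (j * (i + 1 - j)) •
          (M.umon 0 0 j ⊗ₜ[k] M'.umon 0 j (i + 1 - j)) -
        rootPow ξ (j * (i + 1 - j) - j) •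
          (M.umon d 0 j ⊗ₜ[k] M'.umon 0 j (i + 1 - j))) := by
    refine Fintype.sum_equiv (Equiv.addRight 1) _ _ fun j => ?_
    rw [Equiv.coe_addRight, smul_mul_assoc, Algebra.TensorProduct.tmul_mul_tmul,
      hM'.umon_mul_mon hξ, hM.umon_mul_y hξ, ← TensorProduct.smul_tmul', TensorProduct.tmul_smul,
      TensorProduct.sub_tmul, ← TensorProduct.smul_tmul', smul_comm _ ξ⁻¹,
      smul_smul (rootPow _ _) (rootPow _ _), ← rootPow_add hξ, smul_sub (rootPow _ _), smul_smul, ← rootPow_add hξ, sub_self,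
      mul_one, add_sub_add_right_eq_sub]
    congr 4 <;> ring
  have e2 : ∑ j : ZMod m, (rootPow ξ (j * (i - j)) •
        (M.umon d 0 j ⊗ₜ[k] M'.umon d j (i - j))) * ((1 : A) ⊗ₜ[k] M'.y) =
      ∑ j : ZMod m, ξ⁻¹ • (rootPow ξ (j * (i + 1 - j) - j) •
          (M.umon d 0 j ⊗ₜ[k] M'.umon 0 j (i + 1 - j)) -
        rootPow ξ (j * (i + 1 - j) - (i + 1)) •
          (M.umon d 0 j ⊗ₜ[k] M'.umon d j (i + 1 - j))) := by
    refine Finset.sum_congr rfl fun j _ => ?_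
    rw [smul_mul_assoc, Algebra.TensorProduct.tmul_mul_tmul, mul_one, hM'.umon_mul_y hξ,
      TensorProduct.tmul_smul, TensorProduct.tmul_sub, TensorProduct.tmul_smul, smul_comm _ ξ⁻¹,
      smul_sub (rootPow _ _), smul_smul, ← rootPow_add hξ, sub_self,
      show i - j + 1 = i + 1 - j by ring]
    congr 4 <;> ring
  have h1 : ((tensor d ξ M M').x : A ⊗[k] A') ^ d = (tensor d ξ M M').mon d 0 0 := by
    simp [mon]
  rw [h1, ← umon_eq_mul, tensor_umon hξ hM']
  simp only [zero_add]
  change ξ • (_ * (M.y ⊗ₜ[k] M'.mon d 1 0 + (1 : A) ⊗ₜ[k] M'.y)) = _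
  rw [mul_add, Finset.sum_mul, Finset.sum_mul, e1, e2, ← Finset.sum_add_distrib, Finset.smul_sum]
  refine Finset.sum_congr rfl fun j _ => ?_
  rw [← smul_add, smul_smul, mul_inv_cancel₀ hξ0, one_smul]
  abel

/-- Multiply the sums for `u_i` and `u_j` with summation indices `s` and `r - s`, and let `a`, `b`
be the indices of the two expansions of products of `u`'s. As `q` is quadratic, `s` enters the
scalar only through the character `γ^{s(b-a-r)}`. Summing over `s` forces `b = a + r`, and the
trinomial identity matches the rest with the expansion of `y^n` in the tensor product. -/
theorem tensor_u_u (i j : ZMod m) (hm : (m : k) ≠ 0) :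
    (tensor d ξ M M').u i * (tensor d ξ M M').u j = ∑ a : ZMod m,
      (quadChar ξ j * (m : k)⁻¹ * rootPow ξ (i + j) *
        (qChoose ξ (i + j) a * rootPow ξ (-(i * a)))) •
        (tensor d ξ M M').mon ((d : ℤ) * a.val + d - ((1 + m) * d / 2 : ℕ)) 1 (i + j).val := by
  set c : ℤ := (((1 + m) * d / 2 : ℕ) : ℤ) with hc
  let T (r a b : ZMod m) : A ⊗[k] A' :=
    M.mon (d * a.val + d - c) 1 r.val ⊗ₜ[k] M'.mon (d * b.val + d - c) (1 + r) (i + j - r).val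
  have hprod (s r : ZMod m) :
      (rootPow ξ (s * (i - s)) • (M.u s ⊗ₜ[k] M'.umon 0 s (i - s))) *
        (rootPow ξ ((r - s) * (j - (r - s))) •
          (M.u (r - s) ⊗ₜ[k] M'.umon 0 (r - s) (j - (r - s)))) =
      ∑ a : ZMod m, ∑ b : ZMod m, (quadChar ξ j * (m : k)⁻¹ * (m : k)⁻¹ *
        rootPow ξ (i + j + i * r - i * b) * (qChoose ξ r a * qChoose ξ (i + j - r) b) *
        rootPow ξ (s * (b - (a + r)))) • T r a b := by
    rw [smul_mul_assoc, mul_smul_comm, Algebra.TensorProduct.tmul_mul_tmul,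
      ← IsModel.umon_zero (M := M), ← IsModel.umon_zero (M := M), hM.umon_mul_umon hξ,
      hM'.umon_mul_umon hξ, TensorProduct.sum_tmul, Finset.smul_sum, Finset.smul_sum]
    refine Finset.sum_congr rfl fun a _ => ?_
    rw [TensorProduct.tmul_sum, Finset.smul_sum, Finset.smul_sum]
    refine Finset.sum_congr rfl fun b _ => ?_
    rw [← TensorProduct.smul_tmul', TensorProduct.tmul_smul, smul_smul, smul_smul, smul_smul]
    have e1 : s + (r - s) = r := by ring
    have e2 : i - s + (j - (r - s)) = i + j - r := by ring
    rw [e1, e2]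
    simp only [T, sub_self, zero_add, add_comm r 1]
    congr 1
    -- The quadratic factors of the two tensor components recombine to `q(j)`.
    have hq : quadChar ξ j = quadChar ξ (r - s) * quadChar ξ (j - (r - s)) *
        rootPow ξ ((r - s) * (j - (r - s))) := by
      rw [← quadChar_add hξ]
      congr 1
      ring
    have hr : rootPow ξ (s * (i - s)) *
        (rootPow ξ r * rootPow ξ (s * 0) * rootPow ξ (-(s * a)) *
          (rootPow ξ (i + j - r) * rootPow ξ ((i - s) * (r - s)) * rootPow ξ (-((i - s) * b)))) =
        rootPow ξ (i + j + i * r - i * b) * rootPow ξ (s * (b - (a + r))) := by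
      simp only [← rootPow_add hξ]
      congr 1
      ring
    rw [hq]
    linear_combination (quadChar ξ (r - s) * quadChar ξ (j - (r - s)) *
        rootPow ξ ((r - s) * (j - (r - s))) * (m : k)⁻¹ * (m : k)⁻¹ * qChoose ξ r a *
        qChoose ξ (i + j - r) b) * hr
  have hsum (r : ZMod m) : ∑ s : ZMod m,
      (rootPow ξ (s * (i - s)) • (M.u s ⊗ₜ[k] M'.umon 0 s (i - s))) *
        (rootPow ξ ((r - s) * (j - (r - s))) •
          (M.u (r - s) ⊗ₜ[k] M'.umon 0 (r - s) (j - (r - s)))) =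
      ∑ a : ZMod m, (quadChar ξ j * (m : k)⁻¹ * rootPow ξ (i + j - i * a) *
        (qChoose ξ r a * qChoose ξ (i + j - r) (a + r))) • T r a (a + r) := by
    rw [Finset.sum_congr rfl fun s _ => hprod s r, Finset.sum_comm]
    refine Finset.sum_congr rfl fun a _ => ?_
    rw [Finset.sum_comm, Finset.sum_eq_single (a + r)]
    · rw [← Finset.sum_smul, ← Finset.mul_sum, sum_rootPow_mul hξ, sub_self, if_pos rfl]
      congr 1
      rw [show i + j + i * r - i * (a + r) = i + j - i * a by ring]
      field_simp
    · intro b _ hb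
      rw [← Finset.sum_smul, ← Finset.mul_sum, sum_rootPow_mul hξ, if_neg (sub_ne_zero.2 hb),
        mul_zero, zero_smul]
    · exact fun h => absurd (Finset.mem_univ _) h
  change (∑ s : ZMod m, rootPow ξ (s * (i - s)) • (M.u s ⊗ₜ[k] M'.umon 0 s (i - s))) *
    (∑ t : ZMod m, rootPow ξ (t * (j - t)) • (M.u t ⊗ₜ[k] M'.umon 0 t (j - t))) = _
  rw [Finset.sum_mul_sum]
  have hshift (s : ZMod m) : ∑ t : ZMod m,
      (rootPow ξ (s * (i - s)) • (M.u s ⊗ₜ[k] M'.umon 0 s (i - s))) *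
        (rootPow ξ (t * (j - t)) • (M.u t ⊗ₜ[k] M'.umon 0 t (j - t))) =
      ∑ r : ZMod m, (rootPow ξ (s * (i - s)) • (M.u s ⊗ₜ[k] M'.umon 0 s (i - s))) *
        (rootPow ξ ((r - s) * (j - (r - s))) •
          (M.u (r - s) ⊗ₜ[k] M'.umon 0 (r - s) (j - (r - s)))) :=
    (Fintype.sum_equiv (Equiv.subRight s) _ _ fun r => rfl).symm
  rw [Finset.sum_congr rfl fun s _ => hshift s, Finset.sum_comm,
    Finset.sum_congr rfl fun r _ => hsum r, Finset.sum_comm]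
  refine Finset.sum_congr rfl fun a _ => ?_
  rw [tensor_mon hξ hM hM', Finset.smul_sum]
  refine Finset.sum_congr rfl fun r _ => ?_
  rw [smul_smul, sub_eq_add_neg (i + j) (i * a), rootPow_add hξ (i + j)]
  have hco := qChoose_mul_qChoose hξ r (i + j - r) a
  rw [add_sub_cancel] at hco
  -- Without a carry in `a + r` the powers of `x` agree on both sides; with a carry they may differ,
  -- but both coefficients are zero.
  by_cases h : r.val + a.val < m
  · have h1 : (a + r).val = a.val + r.val := (val_add_val_lt_iff a r).1 (by omega)
    have hT : T r a (a + r) = M.mon (d * a.val + d - c) 1 r.val ⊗ₜ[k]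
        M'.mon (d * a.val + d - c + d * r.val) (1 + r) (i + j - r).val := by
      simp only [T, h1]
      congr 2
      push_cast
      ring
    rw [hT, add_comm a r, hco]
    congr 1
    ring
  · rw [add_comm a r, hco, mul_assoc _ (qChoose ξ (i + j) a * _) (qChoose ξ r (i + j - r)),
      mul_right_comm (qChoose ξ (i + j) a), mul_comm (qChoose ξ (i + j) a), ← hco,
      qChoose_eq_zero hξ (not_lt.1 h)]
    simp

/-- The formulas for the coproduct respect the relations. -/
theorem IsModel.tensor (hm : (m : k) ≠ 0) : (Data.tensor d ξ M M').IsModel d ξ := by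
  refine ⟨?_, ?_, ?_, ?_, ?_, fun i => ?_, fun i => ?_, fun i => ?_, fun i => ?_,
    fun i j => tensor_u_u hξ hM hM' i j hm⟩
  · change (M.x : A) ⊗ₜ[k] (M'.x : A') * (M.h ⊗ₜ M'.h) = _ * ((M.x : A) ⊗ₜ[k] (M'.x : A'))
    rw [Algebra.TensorProduct.tmul_mul_tmul, hM.x_h, hM'.x_h]
    exact (Algebra.TensorProduct.tmul_mul_tmul _ _ _ _).symm
  · have h1 : (M'.x : A') * M'.mon d 1 0 = M'.mon d 1 0 * (M'.x : A') := by
      have : (M'.x : A') = M'.mon 1 0 0 := by simp [IsModel.mon_x]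
      rw [this, hM'.mon_mul_mon hξ, hM'.mon_mul_mon hξ]
      simp [add_comm]
    change (M.x : A) ⊗ₜ[k] (M'.x : A') * (M.y ⊗ₜ M'.mon d 1 0 + 1 ⊗ₜ M'.y) =
      (M.y ⊗ₜ M'.mon d 1 0 + 1 ⊗ₜ M'.y) * ((M.x : A) ⊗ₜ[k] (M'.x : A'))
    simp only [mul_add, add_mul, Algebra.TensorProduct.tmul_mul_tmul, hM.x_y, hM'.x_y, one_mul,
      mul_one, h1]
  · have h1 : M'.mon d 1 0 * M'.h = M'.h * M'.mon d 1 0 := by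
      rw [← hM'.mon_h_one, hM'.mon_mul_mon hξ, hM'.mon_mul_mon hξ]
      simp
    change (M.y ⊗ₜ M'.mon d 1 0 + 1 ⊗ₜ M'.y) * (M.h ⊗ₜ M'.h) =
      ξ ^ 2 • ((M.h ⊗ₜ M'.h) * (M.y ⊗ₜ[k] M'.mon d 1 0 + 1 ⊗ₜ M'.y))
    simp only [mul_add, add_mul, Algebra.TensorProduct.tmul_mul_tmul, one_mul,
      mul_one, h1, hM.y_h, hM'.y_h, smul_add, TensorProduct.tmul_smul, ← TensorProduct.smul_tmul']
  · change (M.h ⊗ₜ[k] M'.h) ^ m = 1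
    rw [Algebra.TensorProduct.tmul_pow, hM.h_pow, hM'.h_pow, Algebra.TensorProduct.one_def]
  · change (M.y ⊗ₜ M'.mon d 1 0 + 1 ⊗ₜ M'.y) ^ m = 1 - ((M.x : A) ⊗ₜ[k] (M'.x : A')) ^ (m * d)
    -- Since `g^m = x^{md}`, with `X = x^{md}` the identity is `(1 - X) ⊗ X + 1 ⊗ (1 - X) = 1 - X ⊗
    -- X`.
    have h1 : M'.mon d 1 0 ^ m = (M'.x : A') ^ (m * d) := by
      rw [mon_g_pow hξ hM', ZMod.natCast_self, IsModel.mon_x, ← Units.val_pow_eq_pow_val,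
        ← zpow_natCast, mul_comm (d : ℤ), Nat.cast_mul]
    rw [add_pow_modulus_of_qCommute hξ (tensor_y_qCommute hξ hM'), Algebra.TensorProduct.tmul_pow,
      Algebra.TensorProduct.tmul_pow, Algebra.TensorProduct.tmul_pow, h1, hM.y_pow, hM'.y_pow,
      one_pow, TensorProduct.sub_tmul, TensorProduct.tmul_sub, Algebra.TensorProduct.one_def]
    abel
  · change (M.x : A) ⊗ₜ[k] (M'.x : A') *
        (∑ j : ZMod m, rootPow ξ (j * (i - j)) • (M.u j ⊗ₜ[k] M'.umon 0 j (i - j))) =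
      (∑ j : ZMod m, rootPow ξ (j * (i - j)) • (M.u j ⊗ₜ[k] M'.umon 0 j (i - j))) *
        (((M.x⁻¹ : Aˣ) : A) ⊗ₜ[k] ((M'.x⁻¹ : A'ˣ) : A'))
    have h1 : (M'.x : A') = M'.mon 1 0 0 := by simp [IsModel.mon_x]
    have h2 : ((M'.x⁻¹ : A'ˣ) : A') = M'.mon (-1) 0 0 := by simp [IsModel.mon_x]
    rw [Finset.mul_sum, Finset.sum_mul]
    refine Finset.sum_congr rfl fun j _ => ?_
    rw [mul_smul_comm, smul_mul_assoc, Algebra.TensorProduct.tmul_mul_tmul,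
      Algebra.TensorProduct.tmul_mul_tmul, hM.x_u, h1, h2, hM'.mon_mul_umon hξ,
      hM'.umon_mul_mon hξ]
    simp
  · rw [tensor_y_u hξ hM hM', tensor_y_u_expand hξ hM']
  · rw [tensor_y_u hξ hM hM', tensor_u_y hξ hM hM']
  · change (∑ j : ZMod m, rootPow ξ (j * (i - j)) • (M.u j ⊗ₜ[k] M'.umon 0 j (i - j))) *
        (M.h ⊗ₜ[k] M'.h) = rootPow ξ i • ((M.h ⊗ₜ[k] M'.h) *
        (∑ j : ZMod m, rootPow ξ (j * (i - j)) • (M.u j ⊗ₜ[k] M'.umon 0 j (i - j))))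
    rw [Finset.mul_sum, Finset.sum_mul, Finset.smul_sum]
    refine Finset.sum_congr rfl fun j _ => ?_
    rw [mul_smul_comm, smul_mul_assoc, Algebra.TensorProduct.tmul_mul_tmul,
      Algebra.TensorProduct.tmul_mul_tmul, hM.u_h, ← hM'.mon_h_one, hM'.mon_mul_umon hξ,
      hM'.umon_mul_mon hξ, ← TensorProduct.smul_tmul', TensorProduct.tmul_smul, smul_comm (rootPow ξ i),
      smul_smul (rootPow ξ j), ← rootPow_add hξ, add_comm j 1]
    simp

end Tensor

end Data

end DHopf

namespace DHopf

/-! ### Reflection of Gaussian coefficients at a root of unity. -/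

section Reflection

variable {k : Type*} [Field k] {m : ℕ} [NeZero m] {ξ : k} (hξ : IsPrimitiveRoot ξ (2 * m))
include hξ

theorem quadChar_neg (a : ZMod m) : quadChar ξ (-a) = quadChar ξ a := by
  have h := quadChar_add hξ a (-a)
  rw [add_neg_cancel, quadChar_zero, mul_neg, rootPow_neg hξ, ← quadChar_sq hξ] at h
  have h0 := quadChar_ne_zero hξ a
  field_simp at h
  exact h.symm

omit [NeZero m] hξ in
theorem rootPow_eq_mul_self (a : ZMod m) : rootPow ξ a = ξ ^ a.val * ξ ^ a.val := by
  rw [rootPow, ← pow_mul, ← pow_add, two_mul]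

/-- If `n + a` does not carry, `l = -1-n-a` is represented by `m-1-n-a`. The factorials of `a` and
`n + l`, and those of `l` and `n + a`, are then complementary, and `qFactorial_mul_reflect` relates
the two quotients. If `n + a` carries, so does `n + l`, and both coefficients vanish. -/
theorem qChoose_reflect (n a : ZMod m) :
    qChoose ξ n (-1 - n - a) * (quadChar ξ n * rootPow ξ (n * a) * ξ ^ n.val) = qChoose ξ n a := by
  by_cases h : n.val + a.val < m
  · have hv : ((-1 - n - a : ZMod m)).val = m - 1 - n.val - a.val := by
      have e : (-1 - n - a : ZMod m) = ((m - 1 - n.val - a.val : ℕ) : ZMod m) := by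
        rw [Nat.sub_sub, Nat.sub_sub, Nat.cast_sub (by omega)]
        push_cast
        rw [ZMod.natCast_zmod_val, ZMod.natCast_zmod_val, ZMod.natCast_self]
        ring
      rw [e, ZMod.val_cast_of_lt (by omega)]
    set l : ZMod m := -1 - n - a with hl
    have hF (x : ZMod m) : qFactorial ξ x.val ≠ 0 := qFactorial_ne_zero hξ (ZMod.val_lt x)
    have r1 := qFactorial_mul_reflect hξ a.val (ZMod.val_lt a)
    have r2 := qFactorial_mul_reflect hξ l.val (ZMod.val_lt l)
    rw [show m - 1 - a.val = n.val + l.val by omega] at r1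
    rw [show m - 1 - l.val = n.val + a.val by omega] at r2
    have s1 : (-1) ^ a.val * ξ ^ (a.val * (a.val + 1)) = quadChar ξ a * ξ ^ a.val := by
      rw [quadChar, mul_assoc, ← pow_add]
      congr 2
      ring
    have s2 : (-1) ^ l.val * ξ ^ (l.val * (l.val + 1)) = quadChar ξ l * ξ ^ l.val := by
      rw [quadChar, mul_assoc, ← pow_add]
      congr 2
      ring
    rw [s1] at r1
    rw [s2] at r2
    have s3 : quadChar ξ l = -ξ * quadChar ξ n * quadChar ξ a *
        (rootPow ξ n * rootPow ξ a * rootPow ξ (n * a)) := by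
      rw [hl, show (-1 - n - a : ZMod m) = -(1 + n + a) by ring, quadChar_neg hξ, quadChar_add hξ,
        quadChar_add hξ, quadChar_one hξ, add_mul, one_mul, one_mul, rootPow_add hξ a]
      ring
    have s4 : ξ ^ l.val * ξ ^ n.val * ξ ^ a.val * ξ = -1 := by
      rw [← pow_add, ← pow_add, ← pow_succ, ← pow_eq_neg_one hξ]
      congr 1
      omega
    rw [s3, rootPow_eq_mul_self n, rootPow_eq_mul_self a] at r2
    have hξ0 := root_ne_zero hξ
    have hm1 : qFactorial ξ (m - 1) ≠ 0 :=
      qFactorial_ne_zero hξ (by have := NeZero.pos m; omega)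
    rw [qChoose, qChoose]
    have hFl := hF l
    have hFn := hF n
    have hFa := hF a
    have hq := quadChar_ne_zero hξ a
    have hxa : ξ ^ a.val ≠ 0 := pow_ne_zero _ hξ0
    rw [div_mul_eq_mul_div, div_eq_div_iff (mul_ne_zero hFn hFl) (mul_ne_zero hFn hFa)]
    have r3 : qFactorial ξ (n.val + a.val) * qFactorial ξ l.val = qFactorial ξ (m - 1) *
        (quadChar ξ n * quadChar ξ a * ξ ^ n.val * ξ ^ a.val * rootPow ξ (n * a)) := by
      rw [r2]
      linear_combination (-qFactorial ξ (m - 1) * quadChar ξ n * quadChar ξ a * ξ ^ n.val *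
        ξ ^ a.val * rootPow ξ (n * a)) * s4
    linear_combination (qFactorial ξ n.val * (quadChar ξ n * rootPow ξ (n * a) * ξ ^ n.val)) * r1 -
      qFactorial ξ n.val * r3
  · rw [qChoose_eq_zero hξ (not_lt.1 h), qChoose_eq_zero hξ, zero_mul]
    by_contra hlt
    have h1 := (val_add_val_lt_iff _ _).1 (not_le.1 hlt)
    have h2 : (-1 - a : ZMod m).val + a.val = m - 1 := by
      have e : (-1 - a : ZMod m) = ((m - 1 - a.val : ℕ) : ZMod m) := by
        have := ZMod.val_lt a
        rw [Nat.sub_sub, Nat.cast_sub (by omega)]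
        push_cast
        rw [ZMod.natCast_zmod_val, ZMod.natCast_self]
        ring
      have := ZMod.val_lt a
      rw [e, ZMod.val_cast_of_lt (by omega)]
      omega
    rw [show n + (-1 - n - a) = -1 - a by ring] at h1
    omega

/-- Compares the scalars in `S(u_{i+1})` and `S(u_i)`; the value `q(1) = -ξ` supplies the sign that
`S(y)` carries. -/
theorem quadChar_inv_succ (i : ZMod m) : (quadChar ξ (i + 1))⁻¹ * rootPow ξ (-(i + 1)) =
    -((quadChar ξ i)⁻¹ * rootPow ξ (-i) * rootPow ξ (-(i + 1)) * ξ⁻¹) := by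
  rw [quadChar_add hξ, quadChar_one hξ, mul_one, mul_inv, mul_inv, ← rootPow_neg hξ]
  have := root_ne_zero hξ
  field_simp

end Reflection

/-! ### The antipode formulas define a model in the opposite algebra. -/

namespace Data

open MulOpposite

variable {k : Type*} [Field k] {m : ℕ} [NeZero m] {A : Type*} [Ring A] [Algebra k A]

/-- The elements given by the formulas for the antipode. -/
noncomputable def opposite (d : ℕ) (ξ : k) (M : Data m A) : Data m Aᵐᵒᵖ where
  x := ⟨op ((M.x⁻¹ : Aˣ) : A), op (M.x : A), by rw [← op_mul, Units.mul_inv, op_one],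
    by rw [← op_mul, Units.inv_mul, op_one]⟩
  h := op (M.mon 0 (-1) 0)
  y := op (-rootPow ξ (-1 : ZMod m) • M.mon (-d) (-1) 1)
  u i := op (((quadChar ξ i)⁻¹ * rootPow ξ (-i)) •
    M.umon (d - ((1 + m) * d / 2 : ℕ)) (-(i + 1)) i)

variable {d : ℕ} {ξ : k} {M : Data m A} (hξ : IsPrimitiveRoot ξ (2 * m)) (hM : M.IsModel d ξ)

omit [NeZero m] in
theorem opposite_x_zpow (a : ℤ) :
    (((opposite d ξ M).x ^ a : (Aᵐᵒᵖ)ˣ) : Aᵐᵒᵖ) = op (M.mon (-a) 0 0) := by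
  let f : Aˣ →* (Aᵐᵒᵖ)ˣ :=
    { toFun := fun z => ⟨op ((z⁻¹ : Aˣ) : A), op (z : A), by rw [← op_mul, Units.mul_inv, op_one],
        by rw [← op_mul, Units.inv_mul, op_one]⟩
      map_one' := Units.ext (by simp)
      map_mul' := fun p q => Units.ext (by simp [mul_inv_rev]) }
  have h := map_zpow f M.x a
  rw [IsModel.mon_x, zpow_neg]
  exact congrArg Units.val h.symm

include hξ hM

theorem opposite_h_pow (b : ZMod m) : (opposite d ξ M).h ^ b.val = op (M.mon 0 (-b) 0) := by
  have (n : ℕ) : M.mon 0 (-1) 0 ^ n = M.mon 0 (-n) 0 := by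
    induction n with
    | zero => simp [IsModel.mon_zero]
    | succ n ih =>
      rw [pow_succ, ih, hM.mon_mul_mon hξ]
      simp [neg_add_rev, add_comm]
  change op (M.mon 0 (-1) 0) ^ b.val = _
  rw [← op_pow, this, ZMod.natCast_zmod_val]

theorem opposite_y_pow (n : ℕ) : (opposite d ξ M).y ^ n =
    op (((-1) ^ n * (ξ ^ (n * (n + 1)))⁻¹) • M.mon (-(d * n)) (-n) n) := by
  change op (-rootPow ξ (-1 : ZMod m) • M.mon (-d) (-1) 1) ^ n = _
  rw [← op_pow]
  congr 1
  induction n with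
  | zero => simp [IsModel.mon_zero]
  | succ n ih =>
    rw [pow_succ, ih, smul_mul_assoc, mul_smul_comm, hM.mon_mul_mon hξ, smul_smul, smul_smul,
      mul_neg_one, rootPow_neg hξ, rootPow_neg hξ, rootPow_natCast hξ, rootPow_one hξ]
    have h1 : (-(d * n) + -d : ℤ) = -(d * (n + 1 : ℕ)) := by push_cast; ring
    have h2 : (-(n : ZMod m) + -1) = -((n + 1 : ℕ) : ZMod m) := by push_cast; ring
    have h3 : ξ ^ ((n + 1) * (n + 1 + 1)) = ξ ^ (n * (n + 1)) * (ξ ^ 2) ^ n * ξ ^ 2 := by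
      rw [← pow_mul, ← pow_add, ← pow_add]
      congr 1
      ring
    rw [h1, h2, h3, mul_inv, mul_inv]
    congr 1
    ring

theorem opposite_y_pow_val (n : ZMod m) : (opposite d ξ M).y ^ n.val =
    op (((quadChar ξ n)⁻¹ * (ξ ^ n.val)⁻¹) • M.mon (-(d * n.val)) (-n) n.val) := by
  rw [opposite_y_pow hξ hM, ZMod.natCast_zmod_val]
  congr 2
  have h1 : ξ ^ (n.val * (n.val + 1)) = ξ ^ n.val ^ 2 * ξ ^ n.val := by
    rw [← pow_add]
    congr 1
    ring
  rw [h1, quadChar, mul_inv, mul_inv, ← inv_pow (-1), inv_neg_one, mul_assoc]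

theorem opposite_mon (a : ℤ) (b n : ZMod m) : (opposite d ξ M).mon a b n.val =
    op (((quadChar ξ n)⁻¹ * (ξ ^ n.val)⁻¹ * rootPow ξ (-(n * b))) •
      M.mon (-(d * n.val) - a) (-n - b) n.val) := by
  rw [mon, opposite_x_zpow, opposite_h_pow hξ hM, opposite_y_pow_val hξ hM, ← op_mul, ← op_mul,
    hM.mon_mul_mon hξ, smul_mul_assoc, mul_smul_comm, hM.mon_mul_mon hξ]
  simp only [Nat.cast_zero, mul_zero, add_zero, rootPow_zero, smul_smul, one_mul,
    zero_add, ZMod.natCast_zmod_val, mul_neg, sub_eq_add_neg]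

theorem umon_mul_mon_one (a a' : ℤ) (b b' i : ZMod m) : M.umon a b i * M.mon a' b' 1 =
    (rootPow ξ (i * b') * ξ⁻¹) • (M.umon (a - a' - d) (b + b') (i + 1) -
      rootPow ξ (-(i + 1)) • M.umon (a - a') (b + b') (i + 1)) := by
  rw [mon_eq_mul, pow_one, ← mul_assoc, hM.umon_mul_mon hξ, smul_mul_assoc, hM.umon_mul_y hξ,
    smul_smul]

theorem mon_one_mul_umon (a a' : ℤ) (b b' i : ZMod m) : M.mon a b 1 * M.umon a' b' i =
    rootPow ξ b' • (M.umon (a + a') (b + b') (i + 1) -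
      rootPow ξ (-(i + 1)) • M.umon (a + a' + d) (b + b') (i + 1)) := by
  rw [mon_eq_mul, pow_one, mul_assoc, hM.y_mul_umon hξ, mul_smul_comm, mul_sub, mul_smul_comm,
    hM.mon_mul_umon hξ, hM.mon_mul_umon hξ, add_assoc]

/-- In the opposite algebra the factors are exchanged, and `S` inverts `x`, so the powers of `x` in
the Gaussian sum appear in reverse order. The substitution `a ↦ -1-n-a` restores them, and
`qChoose_reflect` compares the coefficients. -/
theorem opposite_u_u (hmd : Even ((1 + m) * d)) (i j : ZMod m) :
    (opposite d ξ M).u i * (opposite d ξ M).u j = ∑ a : ZMod m,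
      (quadChar ξ j * (m : k)⁻¹ * rootPow ξ (i + j) *
        (qChoose ξ (i + j) a * rootPow ξ (-(i * a)))) •
        (opposite d ξ M).mon ((d : ℤ) * a.val + d - ((1 + m) * d / 2 : ℕ)) 1 (i + j).val := by
  obtain ⟨c, hc⟩ : ∃ c, (1 + m) * d = 2 * c := hmd.two_dvd
  have hc' : (1 + m) * d / 2 = c := by omega
  have hcz : ((1 : ℤ) + m) * d = 2 * c := by exact_mod_cast hc
  change op _ * op _ = _
  rw [← op_mul, smul_mul_assoc, mul_smul_comm, hM.umon_mul_umon hξ, Finset.smul_sum,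
    Finset.smul_sum, Finset.op_sum]
  simp only [hc']
  refine (Fintype.sum_equiv (Equiv.subLeft (-1 - (i + j))) _ _ fun a => ?_).symm
  rw [opposite_mon hξ hM, Equiv.subLeft_apply, ← op_smul, smul_smul, smul_smul, smul_smul]
  congr 1
  rw [add_comm j i]
  set n := i + j with hn
  by_cases h : n.val + a.val < m
  · have hv : ((-1 - n - a : ZMod m)).val = m - 1 - n.val - a.val := by
      have e : (-1 - n - a : ZMod m) = ((m - 1 - n.val - a.val : ℕ) : ZMod m) := by
        rw [Nat.sub_sub, Nat.sub_sub, Nat.cast_sub (by omega)]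
        push_cast
        rw [ZMod.natCast_zmod_val, ZMod.natCast_zmod_val, ZMod.natCast_self]
        ring
      rw [e, ZMod.val_cast_of_lt (by omega)]
    -- The exponents of `x` agree exactly because `2c = (1 + m)d`; this is where the parity of `(1 +
    -- m)d` enters.
    have e1 : (d - c - (d - c) + (d * ((-1 - n - a : ZMod m).val : ℤ) + d - c) : ℤ) =
        -(d * n.val) - (d * a.val + d - c) := by
      rw [hv, Nat.sub_sub, Nat.sub_sub, Nat.cast_sub (by omega)]
      push_cast
      linear_combination hcz
    have e2 : -(j + 1) + -(i + 1) + 1 = -n - 1 := by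
      rw [hn]
      ring
    rw [e1, e2]
    congr 1
    have hq := qChoose_reflect hξ n a
    have hqn := quadChar_ne_zero hξ n
    have hqi := quadChar_ne_zero hξ i
    have hqj := quadChar_ne_zero hξ j
    have hξn : ξ ^ n.val ≠ 0 := pow_ne_zero _ (root_ne_zero hξ)
    have hsq := quadChar_sq hξ j
    have hr : rootPow ξ (j * j) * (rootPow ξ (n * a) * rootPow ξ (-(i * a)) *
          rootPow ξ (-(n * 1))) =
        rootPow ξ (-j) * rootPow ξ (-i) *
          (rootPow ξ (j * -(i + 1)) * rootPow ξ (-(j * (-1 - n - a)))) := by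
      simp only [← rootPow_add hξ]
      congr 1
      rw [hn]
      ring
    rw [← hsq] at hr
    rw [← hq]
    field_simp
    linear_combination ((m : k)⁻¹ * rootPow ξ n * qChoose ξ n (-1 - n - a)) * hr
  · have hz : qChoose ξ n a = 0 := qChoose_eq_zero hξ (not_lt.1 h)
    have hz' : qChoose ξ n (-1 - n - a) = 0 := by
      have hq := qChoose_reflect hξ n a
      rw [hz] at hq
      exact (mul_eq_zero.1 hq).resolve_right (mul_ne_zero (mul_ne_zero (quadChar_ne_zero hξ n)
        (rootPow_ne_zero hξ _)) (pow_ne_zero _ (root_ne_zero hξ)))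
    rw [hz, hz']
    simp

/-- The formulas for the antipode respect the relations. -/
theorem IsModel.opposite (hmd : Even ((1 + m) * d)) : (Data.opposite d ξ M).IsModel d ξ := by
  have hξ0 := root_ne_zero hξ
  have hx (a : ℕ) : ((Data.opposite d ξ M).x : Aᵐᵒᵖ) ^ a = op (M.mon (-a) 0 0) := by
    rw [← opposite_x_zpow (d := d) (ξ := ξ), zpow_natCast, Units.val_pow_eq_pow_val]
  have hx1 : ((Data.opposite d ξ M).x : Aᵐᵒᵖ) = op (M.mon (-1) 0 0) := by simpa using hx 1
  have hxi : (((Data.opposite d ξ M).x⁻¹ : (Aᵐᵒᵖ)ˣ) : Aᵐᵒᵖ) = op (M.mon 1 0 0) := by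
    simpa using opposite_x_zpow (d := d) (ξ := ξ) (M := M) (-1)
  have e1 : rootPow ξ (-1 : ZMod m) * ξ ^ 2 = 1 := by
    rw [rootPow_neg hξ, rootPow_one hξ, inv_mul_cancel₀ (pow_ne_zero _ hξ0)]
  refine ⟨?_, ?_, ?_, ?_, ?_, fun i => ?_, fun i => ?_, fun i => ?_, fun i => ?_,
    fun i j => opposite_u_u hξ hM hmd i j⟩
  · rw [hx1]
    change op _ * op _ = op _ * op _
    rw [← op_mul, ← op_mul, hM.mon_mul_mon hξ, hM.mon_mul_mon hξ]
    simp
  · rw [hx1]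
    change op _ * op _ = op _ * op _
    rw [← op_mul, ← op_mul, smul_mul_assoc, mul_smul_comm, hM.mon_mul_mon hξ, hM.mon_mul_mon hξ]
    simp [add_comm]
  · change op _ * op _ = ξ ^ 2 • (op _ * op _)
    rw [← op_mul, ← op_mul, ← op_smul, smul_mul_assoc, mul_smul_comm, hM.mon_mul_mon hξ,
      hM.mon_mul_mon hξ, smul_smul, smul_smul, smul_smul]
    simp only [Nat.cast_zero, zero_mul, rootPow_zero, mul_one, Nat.cast_one, one_mul, zero_add,
      add_zero]
    congr 2
    linear_combination (rootPow ξ (-1 : ZMod m)) * e1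
  · change op (M.mon 0 (-1) 0) ^ m = 1
    have h2 (n : ℕ) : M.mon 0 (-1) 0 ^ n = M.mon 0 (-n) 0 := by
      induction n with
      | zero => simp [IsModel.mon_zero]
      | succ n ih =>
        rw [pow_succ, ih, hM.mon_mul_mon hξ]
        simp [neg_add_rev, add_comm]
    rw [← op_pow, h2, ZMod.natCast_self, neg_zero, mon_zero, op_one]
  -- As `ξ^m = -1`, the scalar of `S(y)^m` is `(-1)^m (-1)^{m+1} = -1`, and `-x^{-md} y^m = 1 -
  -- x^{-md}`.
  · have h1 : (-1 : k) ^ m * (ξ ^ (m * (m + 1)))⁻¹ = -1 := by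
      rw [pow_mul, pow_eq_neg_one hξ, pow_succ (-1 : k), mul_inv, inv_neg_one, ← mul_assoc,
        mul_inv_cancel₀ (pow_ne_zero _ (neg_ne_zero.2 one_ne_zero)), one_mul]
    have h2 : M.mon (-(d * m)) 0 m = M.mon (-(d * m)) 0 0 - 1 := by
      have h3 : (M.x : A) ^ (m * d) = M.mon (d * m) 0 0 := by
        rw [IsModel.mon_x, mul_comm, ← Units.val_pow_eq_pow_val, ← zpow_natCast]
        push_cast
        rfl
      rw [mon_eq_mul, hM.y_pow, mul_sub, mul_one, h3, hM.mon_mul_mon hξ]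
      simp [IsModel.mon_zero]
    rw [opposite_y_pow hξ hM, hx, h1, ZMod.natCast_self, neg_zero, h2, neg_one_smul, neg_sub,
      op_sub, op_one]
    push_cast
    rw [mul_comm (d : ℤ)]
  · rw [hx1, hxi]
    change op _ * op _ = op _ * op _
    rw [← op_mul, ← op_mul, smul_mul_assoc, mul_smul_comm, hM.mon_mul_umon hξ, hM.umon_mul_mon hξ]
    simp [add_comm]
  · rw [hx]
    change op _ * op _ = op _ - rootPow ξ (-(i + 1)) • (op _ * op _)
    rw [← op_mul, ← op_mul, ← op_smul, ← op_sub, smul_mul_assoc, mul_smul_comm,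
      umon_mul_mon_one hξ hM, smul_mul_assoc, hM.umon_mul_mon hξ, quadChar_inv_succ hξ]
    simp only [mul_zero, rootPow_zero, one_smul, add_zero, sub_neg_eq_add, smul_smul,
      add_sub_cancel_right, smul_sub, mul_neg, mul_one, neg_add_rev, neg_smul, rootPow_add hξ]
    rw [show -1 + (-1 + -i) = -1 + -i + -1 by ring, show (d - ((1 + m) * d / 2 : ℕ) + d : ℤ) =
      d + (d - ((1 + m) * d / 2 : ℕ)) by ring]
    congr 1
    module
  · rw [hx]
    change op _ * op _ = ξ • (op _ * op _ * op _)
    generalize (((1 + m) * d / 2 : ℕ) : ℤ) = c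
    rw [mul_assoc, ← op_mul, ← op_mul, ← op_mul, ← op_smul]
    simp only [smul_mul_assoc, mul_smul_comm, umon_mul_mon_one hξ hM, mon_one_mul_umon hξ hM,
      sub_mul, hM.umon_mul_mon hξ]
    rw [show (d - c - -d - d : ℤ) = d - c by ring, show (d - c - -d : ℤ) = d + d - c by ring,
      show (-d + (d - c) - -d : ℤ) = d - c by ring, show (-d + (d - c) + d - -d : ℤ) = d + d - c by
      ring, add_comm (-1) (-(i + 1)), add_zero, mul_neg_one, mul_zero, rootPow_zero, one_smul,
      one_smul, neg_add_rev, rootPow_add hξ (-1) (-i)]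
    have e2 : rootPow ξ (-1 : ZMod m) * ξ = ξ⁻¹ := by
      rw [← mul_eq_one_iff_eq_inv₀ hξ0, mul_assoc, ← sq, e1]
    rw [← e2]
    congr 1
    module
  · change op _ * op _ = rootPow ξ i • (op _ * op _)
    rw [← op_mul, ← op_mul, ← op_smul, smul_mul_assoc, mul_smul_comm, hM.mon_mul_umon hξ,
      hM.umon_mul_mon hξ, smul_comm (rootPow ξ i), smul_smul (rootPow ξ i), ← rootPow_add hξ,
      add_comm (-(i + 1))]
    simp

end Data

end DHopf

namespace DHopf

/-! ### Characters and a two-dimensional representation. -/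

section Representations

variable {k : Type*} [Field k] {m : ℕ}

/-- The elements of `k` that define the character `x ↦ 1`, `y ↦ 0`, `g ↦ ζ²`, `u_0 ↦ ζ`,
`u_i ↦ 0` for `i ≠ 0`. -/
def charData (m : ℕ) (ζ : k) : Data m k where
  x := 1
  h := ζ ^ 2
  y := 0
  u i := if i = 0 then ζ else 0

/-- The matrices that define a two-dimensional representation, an extension of the character
with `ζ = ξ` by the trivial character. -/
def extensionData (m : ℕ) (ξ : k) : Data m (Matrix (Fin 2) (Fin 2) k) where
  x := 1
  h := !![1, 0; 0, ξ ^ 2]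
  y := !![0, 1; 0, 0]
  u i := if i = 0 then !![1, 0; 0, ξ] else if i = 1 then !![0, -ξ ^ 3 / (1 - ξ ^ 2); 0, 0] else 0

variable [NeZero m] {ξ : k} (hξ : IsPrimitiveRoot ξ (2 * m)) (hm : 2 ≤ m) (hm0 : (m : k) ≠ 0)
include hξ

/-- When `x = 1` the monomial leaves the sum in the relation for `u_i u_j`, and a scalar sum
remains. In the representations below `y² = 0`, so only `n = 0` and `n = 1` matter. For `n = 0` the
coefficients are all `1` and orthogonality applies. -/
theorem sum_qChoose_zero (i : ZMod m) :
    ∑ a, qChoose ξ 0 a * rootPow ξ (-(i * a)) = if i = 0 then (m : k) else 0 := by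
  have h (a : ZMod m) : qChoose ξ 0 a * rootPow ξ (-(i * a)) = rootPow ξ (a * -i) := by
    rw [qChoose_zero_left hξ, one_mul, ← neg_mul, mul_comm]
  simp_rw [h, sum_rootPow_mul hξ, neg_eq_zero]

-- Here the Gaussian coefficient is `(1 - γ^{a+1}) / (1 - γ)`, a combination of two characters of
-- `a`.
include hm in
theorem sum_qChoose_one (i : ZMod m) :
    ∑ a, qChoose ξ 1 a * rootPow ξ (-(i * a)) =
      (1 - ξ ^ 2)⁻¹ * ((if i = 0 then (m : k) else 0) - ξ ^ 2 * if i = 1 then (m : k) else 0) := by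
  have : Fact (1 < m) := ⟨by omega⟩
  have h1 := qFactorial_ne_zero hξ (show 1 < m by omega)
  have h2 : qFactorial ξ 1 = 1 - ξ ^ 2 := by simp [qFactorial]
  have h (a : ZMod m) : qChoose ξ 1 a * rootPow ξ (-(i * a)) =
      (1 - ξ ^ 2)⁻¹ * (rootPow ξ (a * -i) - ξ ^ 2 * rootPow ξ (a * (1 - i))) := by
    have h3 := qFactorial_ne_zero hξ (ZMod.val_lt a)
    rw [qChoose, ZMod.val_one, add_comm 1, qFactorial_succ, h2]
    rw [h2] at h1
    have h4 : rootPow ξ (a * (1 - i)) = (ξ ^ 2) ^ a.val * rootPow ξ (a * -i) := by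
      rw [show a * (1 - i) = a + a * -i by ring, rootPow_add hξ]
      rfl
    rw [h4, show -(i * a) = a * -i by ring]
    field_simp
    ring
  simp_rw [h]
  rw [← Finset.mul_sum, Finset.sum_sub_distrib, ← Finset.mul_sum, sum_rootPow_mul hξ,
    sum_rootPow_mul hξ]
  simp only [neg_eq_zero, sub_eq_zero, eq_comm (a := (1 : ZMod m))]

omit hξ [NeZero m] in
theorem Data.mon_of_x_eq_one {B : Type*} [Ring B] {M : Data m B} (hx : M.x = 1) (a : ℤ)
    (b : ZMod m) (c : ℕ) : M.mon a b c = M.h ^ b.val * M.y ^ c := by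
  simp [Data.mon, hx]

include hm hm0

/-- The constraints that remain are `h^m = 1` and `u_0² = h`, which hold for every `2m`-th root of
unity `ζ`. The value `ζ = 1` gives the counit; the powers of `ξ` later separate the powers of `h`.
-/
theorem isModel_charData (d : ℕ) {ζ : k} (hζ : ζ ^ (2 * m) = 1) :
    (charData m ζ).IsModel d ξ := by
  have : Fact (1 < m) := ⟨by omega⟩
  have hm1 : m ≠ 0 := by omega
  refine ⟨?_, ?_, ?_, ?_, ?_, fun i => ?_, fun i => ?_, fun i => ?_, fun i => ?_, fun i j => ?_⟩
  · simp [charData]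
  · simp [charData]
  · simp [charData]
  · simp [charData, ← pow_mul, hζ]
  · simp [charData, hm1]
  · simp [charData]
  · by_cases h : i + 1 = 0 <;> simp [charData, h]
  · simp [charData]
  · by_cases h : i = 0 <;> simp [charData, h, mul_comm]
  · simp_rw [Data.mon_of_x_eq_one (show (charData m ζ).x = 1 from rfl)]
    rw [← Finset.sum_smul, ← Finset.mul_sum]
    by_cases h : i + j = 0
    · rw [h, sum_qChoose_zero hξ]
      by_cases hi : i = 0
      · obtain rfl : j = 0 := by simpa [hi] using h
        subst hi
        simp [charData, ZMod.val_one, hm0, sq]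
      · simp [charData, hi]
    · have hv : (i + j).val ≠ 0 := fun h' => h ((ZMod.val_eq_zero _).1 h')
      have : (charData m ζ).u i * (charData m ζ).u j = 0 := by
        by_cases hi : i = 0
        · have hj : j ≠ 0 := fun hj => h (by simp [hi, hj])
          simp [charData, hj]
        · simp [charData, hi]
      rw [this]
      simp [charData, hv]

theorem isModel_extensionData (d : ℕ) : (extensionData m ξ).IsModel d ξ := by
  have : Fact (1 < m) := ⟨by omega⟩
  have hξ0 := root_ne_zero hξ
  have h1 : 1 - ξ ^ 2 ≠ 0 := by simpa using one_sub_pow_ne_zero hξ one_pos (show 1 < m by omega)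
  have hyy : (extensionData m ξ).y ^ 2 = 0 := by
    ext i j
    fin_cases i <;> fin_cases j <;> simp [extensionData, sq, Matrix.mul_apply]
  have hy (n : ℕ) (hn : 2 ≤ n) : (extensionData m ξ).y ^ n = 0 := pow_eq_zero_of_le hn hyy
  have u0 : (extensionData m ξ).u 0 = !![1, 0; 0, ξ] := by simp [extensionData]
  have u1 : (extensionData m ξ).u 1 = !![0, -ξ ^ 3 / (1 - ξ ^ 2); 0, 0] := by simp [extensionData]
  have u2 (i : ZMod m) (h0 : i ≠ 0) (h1 : i ≠ 1) : (extensionData m ξ).u i = 0 := by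
    simp [extensionData, h0, h1]
  have yu (i : ZMod m) (h0 : i ≠ 0) : (extensionData m ξ).y * (extensionData m ξ).u i = 0 := by
    by_cases hi : i = 1
    · subst hi
      rw [u1]
      ext i j
      fin_cases i <;> fin_cases j <;> simp [extensionData, Matrix.mul_apply]
    · rw [u2 i h0 hi, mul_zero]
  have uy (i : ZMod m) (h0 : i ≠ 0) : (extensionData m ξ).u i * (extensionData m ξ).y = 0 := by
    by_cases hi : i = 1
    · subst hi
      rw [u1]
      ext i j
      fin_cases i <;> fin_cases j <;> simp [extensionData, Matrix.mul_apply]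
    · rw [u2 i h0 hi, zero_mul]
  have hx : ((extensionData m ξ).x : Matrix (Fin 2) (Fin 2) k) = 1 := rfl
  have hxi : (((extensionData m ξ).x⁻¹ : (Matrix (Fin 2) (Fin 2) k)ˣ) :
      Matrix (Fin 2) (Fin 2) k) = 1 := by
    simp [extensionData]
  refine ⟨?_, ?_, ?_, ?_, ?_, fun i => ?_, fun i => ?_, fun i => ?_, fun i => ?_, fun i j => ?_⟩
  · rw [hx, one_mul, mul_one]
  · rw [hx, one_mul, mul_one]
  · ext i j
    fin_cases i <;> fin_cases j <;> simp [extensionData, Matrix.mul_apply]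
  · have : (extensionData m ξ).h = Matrix.diagonal ![1, ξ ^ 2] := by
      ext i j
      fin_cases i <;> fin_cases j <;> simp [extensionData]
    rw [this, Matrix.diagonal_pow, ← Matrix.diagonal_one]
    congr 1
    funext i
    fin_cases i
    · simp
    · simpa using (isPrimitiveRoot_sq hξ).pow_eq_one
  · rw [hy m hm, hx, one_pow, sub_self]
  · rw [hx, hxi, one_mul, mul_one]
  · by_cases h0 : i = 0
    · subst h0
      -- At `x = 1` the relation reads `y u_0 = (1 - γ⁻¹) u_1`, and the left side has upper right
      -- entry `ξ`. This determines the entry `-ξ³/(1 - ξ²)` of `u_1`.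
      rw [zero_add, u0, u1, hx, one_pow, one_mul, rootPow_neg hξ, rootPow_one hξ]
      ext i j
      fin_cases i <;> fin_cases j <;> simp [extensionData, Matrix.mul_apply]
      field_simp
      ring
    · rw [yu i h0, hx, one_pow, one_mul]
      by_cases h2 : i + 1 = 0
      · simp [h2]
      · rw [u2 (i + 1) h2 (by simpa using h0), smul_zero, sub_zero]
  · rw [hx, one_pow, one_mul]
    by_cases h0 : i = 0
    · subst h0
      rw [u0]
      ext i j
      fin_cases i <;> fin_cases j <;> simp [extensionData, Matrix.mul_apply]
    · rw [yu i h0, uy i h0, smul_zero]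
  · by_cases h0 : i = 0
    · subst h0
      rw [u0]
      ext i j
      fin_cases i <;> fin_cases j <;> simp [extensionData, Matrix.mul_apply, mul_comm]
    · by_cases hi : i = 1
      · subst hi
        rw [u1, rootPow_one hξ]
        ext i j
        fin_cases i <;> fin_cases j <;> simp [extensionData, Matrix.mul_apply, mul_comm]
      · rw [u2 i h0 hi, zero_mul, mul_zero, smul_zero]
  · simp_rw [Data.mon_of_x_eq_one (show (extensionData m ξ).x = 1 from rfl)]
    rw [← Finset.sum_smul, ← Finset.mul_sum, ZMod.val_one, pow_one]
    have uu1 : (extensionData m ξ).u 1 * (extensionData m ξ).u 1 = 0 := by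
      rw [u1]
      ext i j
      fin_cases i <;> fin_cases j <;> simp [Matrix.mul_apply]
    have hz (hi : i ≠ 0) (hj : j ≠ 0) : (extensionData m ξ).u i * (extensionData m ξ).u j = 0 := by
      by_cases hi1 : i = 1
      · by_cases hj1 : j = 1
        · rw [hi1, hj1, uu1]
        · rw [u2 j hj hj1, mul_zero]
      · rw [u2 i hi hi1, zero_mul]
    by_cases h : i + j = 0
    · rw [h, sum_qChoose_zero hξ]
      by_cases hi : i = 0
      · obtain rfl : j = 0 := by simpa [hi] using h
        subst hi
        rw [u0]
        ext i j
        fin_cases i <;> fin_cases j <;> simp [extensionData, Matrix.mul_apply, hm0, sq]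
      · rw [hz hi (fun hj => hi (by simpa [hj] using h))]
        simp [hi]
    · by_cases h' : i + j = 1
      · rw [h', sum_qChoose_one hξ hm, ZMod.val_one, pow_one, rootPow_one hξ]
        by_cases hi : i = 0
        · obtain rfl : j = 1 := by simpa [hi] using h'
          subst hi
          rw [u0, u1, quadChar_one hξ]
          ext i j
          fin_cases i <;> fin_cases j <;> simp [extensionData, Matrix.mul_apply]
          field_simp
        · by_cases hi1 : i = 1
          · obtain rfl : j = 0 := by simpa [hi1] using h'
            subst hi1
            rw [u0, u1, quadChar_zero]
            ext i j
            fin_cases i <;> fin_cases j <;> simp [extensionData, Matrix.mul_apply]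
            field_simp
          · rw [u2 i hi hi1]
            simp [hi, hi1]
      · have hv : 2 ≤ (i + j).val := by
          by_contra hlt
          have h2 : (i + j).val = 0 ∨ (i + j).val = 1 := by omega
          rcases h2 with h2 | h2
          · exact h ((ZMod.val_eq_zero _).1 h2)
          · exact h' (by rw [← ZMod.natCast_zmod_val (i + j), h2, Nat.cast_one])
        rw [hy _ hv, mul_zero, smul_zero]
        by_cases hi : i = 0
        · rw [u2 j (fun hj => h (by simp [hi, hj])) (fun hj => h' (by simp [hi, hj])), mul_zero]
        · by_cases hj : j = 0
          · rw [u2 i hi (fun hi => h' (by simp [hi, hj])), zero_mul]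
          · exact hz hi hj

end Representations

end DHopf

namespace DHopf

namespace Data

/-! ### Values of the lifted homomorphisms on monomials. -/

section Lift

variable {k : Type*} [Field k] {m : ℕ} [NeZero m] {B : Type*} [Ring B] [Algebra k B] {d : ℕ} {ξ : k}
  {M : Data m B} (hξ : IsPrimitiveRoot ξ (2 * m)) (hM : M.IsModel d ξ)

@[simp] theorem map_lift : (D.data m ξ d).map (M.lift hξ hM) = M := by
  have hx : Units.map (M.lift hξ hM : D m d ξ →* B) (D.data m ξ d).x = M.x :=
    Units.ext (lift_of hξ hM .x)
  have hh : M.lift hξ hM (D.data m ξ d).h = M.h := by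
    change M.lift hξ hM (D.of m d ξ .xinv ^ d * D.of m d ξ .g) = M.h
    rw [map_mul, map_pow, lift_of, lift_of]
    simp only [ofGen]
    rw [← mul_assoc, ← Units.val_pow_eq_pow_val, ← Units.val_pow_eq_pow_val, inv_pow,
      Units.inv_mul, one_mul]
  have hy : M.lift hξ hM (D.data m ξ d).y = M.y := lift_of hξ hM .y
  have hu : (fun i => M.lift hξ hM ((D.data m ξ d).u i)) = M.u :=
    funext fun i => lift_of hξ hM (.u i)
  rw [map, hh, hy, hu]
  congr

theorem lift_mon (a : ℤ) (b : ZMod m) (c : ℕ) :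
    M.lift hξ hM ((D.data m ξ d).mon a b c) = M.mon a b c := by
  rw [map_mon, map_lift]

theorem lift_umon (a : ℤ) (b : ZMod m) (i : ZMod m) :
    M.lift hξ hM ((D.data m ξ d).umon a b i) = M.umon a b i := by
  rw [map_umon, map_lift]

theorem lift_x : M.lift hξ hM (D.data m ξ d).x = M.x := lift_of hξ hM .x

theorem lift_h : M.lift hξ hM (D.data m ξ d).h = M.h :=
  congrArg Data.h (map_lift hξ hM)

theorem lift_y : M.lift hξ hM (D.data m ξ d).y = M.y := lift_of hξ hM .y

theorem lift_u (i : ZMod m) : M.lift hξ hM ((D.data m ξ d).u i) = M.u i := lift_of hξ hM (.u i)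

omit [NeZero m] in
theorem charData_umon (ζ : k) (a : ℤ) (b i : ZMod m) :
    (charData m ζ).umon a b i = if i = 0 then (ζ ^ 2) ^ b.val * ζ else 0 := by
  by_cases h : i = 0 <;> simp [umon, charData, h]

omit [NeZero m] in
theorem charData_mon_zero (ζ : k) (a : ℤ) (b : ZMod m) :
    (charData m ζ).mon a b 0 = (ζ ^ 2) ^ b.val := by
  simp [mon, charData]

end Lift

end Data

namespace D

/-! ### The bialgebra structure. -/

section Bialgebra

open Data

variable {k : Type*} [Field k] {m : ℕ} [NeZero m] {d : ℕ} {ξ : k}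
  (hξ : IsPrimitiveRoot ξ (2 * m)) (hm : 2 ≤ m) (hm0 : (m : k) ≠ 0)

/-- The coproduct of `D(m, d, ξ)`. -/
noncomputable def comulAlgHom (d : ℕ) : D m d ξ →ₐ[k] D m d ξ ⊗[k] D m d ξ :=
  (tensor d ξ (data m ξ d) (data m ξ d)).lift hξ
    (IsModel.tensor hξ (isModel_data hξ d) (isModel_data hξ d) hm0)

include hm hm0 in
/-- The character of `D(m, d, ξ)` with `x ↦ 1`, `g ↦ ζ²`, `u_0 ↦ ζ`. -/
noncomputable def character (d : ℕ) (ζ : k) (hζ : ζ ^ (2 * m) = 1) : D m d ξ →ₐ[k] k :=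
  (charData m ζ).lift hξ (isModel_charData hξ hm hm0 d hζ)

include hm hm0 in
/-- The counit of `D(m, d, ξ)`. -/
noncomputable def counitAlgHom (d : ℕ) : D m d ξ →ₐ[k] k :=
  character hξ hm hm0 d 1 (one_pow _)

theorem comul_mon (a : ℤ) (b : ZMod m) : comulAlgHom hξ hm0 d ((data m ξ d).mon a b 0) =
    (data m ξ d).mon a b 0 ⊗ₜ (data m ξ d).mon a b 0 := by
  rw [comulAlgHom, lift_mon, tensor_mon_zero]

theorem comul_umon (a : ℤ) (b i : ZMod m) : comulAlgHom hξ hm0 d ((data m ξ d).umon a b i) =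
    ∑ j : ZMod m, rootPow ξ (j * (i - j)) •
      ((data m ξ d).umon a b j ⊗ₜ[k] (data m ξ d).umon a (b + j) (i - j)) := by
  rw [comulAlgHom, lift_umon, tensor_umon hξ (isModel_data hξ d)]

theorem comul_u (i : ZMod m) : comulAlgHom hξ hm0 d ((data m ξ d).u i) =
    ∑ j : ZMod m, rootPow ξ (j * (i - j)) •
      ((data m ξ d).u j ⊗ₜ[k] (data m ξ d).umon 0 j (i - j)) :=
  lift_u _ _ i

theorem comul_y : comulAlgHom hξ hm0 d (data m ξ d).y =
    (data m ξ d).y ⊗ₜ (data m ξ d).mon d 1 0 + 1 ⊗ₜ (data m ξ d).y :=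
  lift_y _ _

theorem comul_x : comulAlgHom hξ hm0 d (data m ξ d).x =
    ((data m ξ d).x : D m d ξ) ⊗ₜ ((data m ξ d).x : D m d ξ) :=
  lift_x _ _

theorem comul_h : comulAlgHom hξ hm0 d (data m ξ d).h =
    (data m ξ d).h ⊗ₜ (data m ξ d).h :=
  lift_h _ _

theorem counit_umon (a : ℤ) (b i : ZMod m) :
    counitAlgHom hξ hm hm0 d ((data m ξ d).umon a b i) = if i = 0 then 1 else 0 := by
  rw [counitAlgHom, character, lift_umon, charData_umon]
  simp

theorem counit_mon (a : ℤ) (b : ZMod m) :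
    counitAlgHom hξ hm hm0 d ((data m ξ d).mon a b 0) = 1 := by
  rw [counitAlgHom, character, lift_mon, charData_mon_zero]
  simp

theorem counit_y : counitAlgHom hξ hm hm0 d (data m ξ d).y = 0 := by
  rw [counitAlgHom, character, lift_y]
  rfl

theorem counit_u (i : ZMod m) :
    counitAlgHom hξ hm hm0 d ((data m ξ d).u i) = if i = 0 then 1 else 0 := by
  rw [counitAlgHom, character, lift_u]
  rfl

theorem counit_x : counitAlgHom hξ hm hm0 d (data m ξ d).x = 1 := by
  rw [counitAlgHom, character, lift_x]
  rfl

theorem counit_h : counitAlgHom hξ hm hm0 d (data m ξ d).h = 1 := by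
  rw [counitAlgHom, character, lift_h]
  simp [charData]

/-- Two algebra homomorphisms are compared on generators. On `u_i` both are sums of multiples of
`u_l ⊗ h^l u_{j-l} ⊗ h^j u_{i-j}`, and the exponents of `γ` agree because `j(i-j) + l(j-l) = l(i-l)
+ (j-l)(i-j)`. -/
theorem coassoc : (Algebra.TensorProduct.assoc k k k (D m d ξ) (D m d ξ) (D m d ξ)).toAlgHom.comp
      ((Algebra.TensorProduct.map (comulAlgHom hξ hm0 d) (.id k (D m d ξ))).comp
        (comulAlgHom hξ hm0 d)) =
    (Algebra.TensorProduct.map (.id k (D m d ξ)) (comulAlgHom hξ hm0 d)).comp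
      (comulAlgHom hξ hm0 d) := by
  refine algHom_ext ?_ ?_ ?_ fun i => ?_
  · simp [comul_x]
  · simp [comul_h]
  · simp [comul_y, comul_mon, TensorProduct.add_tmul, TensorProduct.tmul_add, add_assoc,
      Algebra.TensorProduct.one_def]
  · simp only [AlgHom.comp_apply, comul_u, map_sum, map_smul, Algebra.TensorProduct.map_tmul,
      AlgHom.id_apply, comul_umon, TensorProduct.sum_tmul, TensorProduct.tmul_sum,
      ← TensorProduct.smul_tmul', TensorProduct.tmul_smul, Finset.smul_sum, smul_smul]
    rw [Finset.sum_comm]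
    refine Finset.sum_congr rfl fun l _ => ?_
    refine Fintype.sum_equiv (Equiv.subRight l) _ _ fun j => ?_
    rw [Equiv.subRight_apply, ← rootPow_add hξ, ← rootPow_add hξ]
    simp only [add_sub_cancel]
    erw [Algebra.TensorProduct.assoc_tmul]
    rw [show j * (i - j) + l * (j - l) = l * (i - l) + (j - l) * (i - l - (j - l)) by ring,
      show i - l - (j - l) = i - j by ring]

theorem rTensor_counit : (Algebra.TensorProduct.map (counitAlgHom hξ hm hm0 d)
      (.id k (D m d ξ))).comp (comulAlgHom hξ hm0 d) =
    (Algebra.TensorProduct.lid k (D m d ξ)).symm := by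
  refine algHom_ext ?_ ?_ ?_ fun i => ?_
  · simp [comul_x, counit_x]
  · simp [comul_h, counit_h]
  · simp [comul_y, counit_y]
  · simp only [AlgHom.comp_apply, comul_u, map_sum, map_smul, Algebra.TensorProduct.map_tmul,
      AlgHom.id_apply, counit_u]
    rw [Finset.sum_eq_single 0]
    · simp [IsModel.umon_zero]
    · intro j _ hj
      simp [hj]
    · simp

theorem lTensor_counit : (Algebra.TensorProduct.map (.id k (D m d ξ))
      (counitAlgHom hξ hm hm0 d)).comp (comulAlgHom hξ hm0 d) =
    (Algebra.TensorProduct.rid k k (D m d ξ)).symm := by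
  refine algHom_ext ?_ ?_ ?_ fun i => ?_
  · simp [comul_x, counit_x]
  · simp [comul_h, counit_h]
  · simp [comul_y, counit_y, counit_mon]
  · simp only [AlgHom.comp_apply, comul_u, map_sum, map_smul, Algebra.TensorProduct.map_tmul,
      AlgHom.id_apply, counit_umon]
    rw [Finset.sum_eq_single i]
    · simp
    · intro j _ hj
      simp [sub_eq_zero, hj.symm]
    · simp

end Bialgebra

end D

/-! ### Reduction of the antipode axioms to generators. -/

section Antipode

variable {k A : Type*} [Field k] [Ring A] [Algebra k A]

/-- The map `a ⊗ b ↦ S(a) b`, for an algebra homomorphism `S` to the opposite algebra. -/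
noncomputable def antipodeMul (S : A →ₐ[k] Aᵐᵒᵖ) : A ⊗[k] A →ₗ[k] A :=
  LinearMap.mul' k A ∘ₗ ((MulOpposite.opLinearEquiv k).symm.toLinearMap ∘ₗ S.toLinearMap).rTensor A

/-- The map `a ⊗ b ↦ a S(b)`, for an algebra homomorphism `S` to the opposite algebra. -/
noncomputable def mulAntipode (S : A →ₐ[k] Aᵐᵒᵖ) : A ⊗[k] A →ₗ[k] A :=
  LinearMap.mul' k A ∘ₗ ((MulOpposite.opLinearEquiv k).symm.toLinearMap ∘ₗ S.toLinearMap).lTensor A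

variable (S : A →ₐ[k] Aᵐᵒᵖ)

@[simp] theorem antipodeMul_tmul (a b : A) : antipodeMul S (a ⊗ₜ b) = (S a).unop * b := rfl

@[simp] theorem mulAntipode_tmul (a b : A) : mulAntipode S (a ⊗ₜ b) = a * (S b).unop := rfl

/-- As `S` reverses products, the image of `w · (a ⊗ b)` is `S(a)`, then the image of `w`, then `b`;
if the middle factor is a scalar it comes out. Hence the elements that satisfy the antipode axiom
are closed under products. -/
theorem antipodeMul_mul (w t : A ⊗[k] A) {c : k} (hw : antipodeMul S w = algebraMap k A c) :
    antipodeMul S (w * t) = c • antipodeMul S t := by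
  induction t with
  | zero => simp
  | add t t' h h' => rw [mul_add, map_add, h, h', map_add, smul_add]
  | tmul a b =>
    have h (w : A ⊗[k] A) : antipodeMul S (w * a ⊗ₜ b) = (S a).unop * antipodeMul S w * b := by
      induction w with
      | zero => simp
      | add t t' h h' => rw [add_mul, map_add, h, h', map_add, mul_add, add_mul]
      | tmul a' b' => simp [Algebra.TensorProduct.tmul_mul_tmul, mul_assoc]
    rw [h, hw, antipodeMul_tmul, ← Algebra.commutes, mul_assoc, Algebra.smul_def]

theorem mulAntipode_mul (w t : A ⊗[k] A) {c : k} (ht : mulAntipode S t = algebraMap k A c) :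
    mulAntipode S (w * t) = c • mulAntipode S w := by
  induction w with
  | zero => simp
  | add t t' h h' => rw [add_mul, map_add, h, h', map_add, smul_add]
  | tmul a b =>
    have h (t : A ⊗[k] A) : mulAntipode S (a ⊗ₜ b * t) = a * mulAntipode S t * (S b).unop := by
      induction t with
      | zero => simp
      | add t t' h h' => rw [mul_add, map_add, h, h', map_add, mul_add, add_mul]
      | tmul a' b' => simp [Algebra.TensorProduct.tmul_mul_tmul, mul_assoc]
    rw [h, ht, mulAntipode_tmul, ← Algebra.commutes, mul_assoc, Algebra.smul_def]

variable (Δ : A →ₐ[k] A ⊗[k] A) (ε : A →ₐ[k] k) {s : Set A}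

theorem antipodeMul_comul_eq (hs : Algebra.adjoin k s = ⊤)
    (h : ∀ a ∈ s, antipodeMul S (Δ a) = algebraMap k A (ε a)) (a : A) :
    antipodeMul S (Δ a) = algebraMap k A (ε a) := by
  have ha : a ∈ Algebra.adjoin k s := hs ▸ Algebra.mem_top
  induction ha using Algebra.adjoin_induction with
  | mem a ha => exact h a ha
  | algebraMap c =>
    rw [AlgHom.commutes, AlgHom.commutes, Algebra.algebraMap_eq_smul_one, map_smul,
      Algebra.TensorProduct.one_def, antipodeMul_tmul]
    simp [Algebra.algebraMap_eq_smul_one]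
  | add a b _ _ ha hb => rw [map_add, map_add, ha, hb, map_add, map_add]
  | mul a b _ _ ha hb =>
    rw [map_mul, antipodeMul_mul S _ _ ha, hb, map_mul, map_mul, Algebra.smul_def]

theorem mulAntipode_comul_eq (hs : Algebra.adjoin k s = ⊤)
    (h : ∀ a ∈ s, mulAntipode S (Δ a) = algebraMap k A (ε a)) (a : A) :
    mulAntipode S (Δ a) = algebraMap k A (ε a) := by
  have ha : a ∈ Algebra.adjoin k s := hs ▸ Algebra.mem_top
  induction ha using Algebra.adjoin_induction with
  | mem a ha => exact h a ha
  | algebraMap c =>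
    rw [AlgHom.commutes, AlgHom.commutes, Algebra.algebraMap_eq_smul_one, map_smul,
      Algebra.TensorProduct.one_def, mulAntipode_tmul]
    simp [Algebra.algebraMap_eq_smul_one]
  | add a b _ _ ha hb => rw [map_add, map_add, ha, hb, map_add, map_add]
  | mul a b _ _ ha hb =>
    rw [map_mul, mulAntipode_mul S _ _ hb, ha, map_mul, map_mul, Algebra.smul_def,
      Algebra.commutes]

end Antipode

end DHopf

namespace DHopf

namespace D

/-! ### The Hopf algebra structure. -/

section Hopf

open Data MulOpposite

variable {k : Type*} [Field k] {m : ℕ} [NeZero m] {d : ℕ} {ξ : k}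
  (hξ : IsPrimitiveRoot ξ (2 * m)) (hm : 2 ≤ m) (hm0 : (m : k) ≠ 0) (hmd : Even ((1 + m) * d))

include hmd in
/-- The antipode of `D(m, d, ξ)`, as an algebra homomorphism to the opposite algebra. -/
noncomputable def antipodeAlgHom : D m d ξ →ₐ[k] (D m d ξ)ᵐᵒᵖ :=
  (opposite d ξ (data m ξ d)).lift hξ (IsModel.opposite hξ (isModel_data hξ d) hmd)

theorem antipode_mon (a : ℤ) (b : ZMod m) :
    (antipodeAlgHom hξ hmd ((data m ξ d).mon a b 0)).unop = (data m ξ d).mon (-a) (-b) 0 := by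
  have h := opposite_mon hξ (isModel_data hξ d) a b 0
  rw [ZMod.val_zero] at h
  rw [antipodeAlgHom, lift_mon, h]
  simp

theorem antipode_y : (antipodeAlgHom hξ hmd (data m ξ d).y).unop =
    -rootPow ξ (-1 : ZMod m) • (data m ξ d).mon (-d) (-1) 1 := by
  rw [antipodeAlgHom, lift_y]
  rfl

theorem antipode_u (i : ZMod m) : (antipodeAlgHom hξ hmd ((data m ξ d).u i)).unop =
    ((quadChar ξ i)⁻¹ * rootPow ξ (-i)) •
      (data m ξ d).umon (d - ((1 + m) * d / 2 : ℕ)) (-(i + 1)) i := by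
  rw [antipodeAlgHom, lift_u]
  rfl

theorem antipode_umon (b i : ZMod m) :
    (antipodeAlgHom hξ hmd ((data m ξ d).umon 0 b i)).unop =
    ((quadChar ξ i)⁻¹ * rootPow ξ (-i) * rootPow ξ (-(i * b))) •
      (data m ξ d).umon (d - ((1 + m) * d / 2 : ℕ)) (-(i + 1) - b) i := by
  rw [umon_eq_mul, map_mul, unop_mul, antipode_mon, antipode_u, smul_mul_assoc,
    (isModel_data hξ d).umon_mul_mon hξ, smul_smul]
  simp [sub_eq_add_neg]

/-- Summing over the index `j` of the coproduct forces `l = -1`, represented by `m - 1`. The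
coefficient then vanishes unless `i = 0`, and for `i = 0` the exponent of `x` is `2(d-c) + d(m-1) =
0`. -/
theorem antipodeMul_comul_u (i : ZMod m) :
    antipodeMul (antipodeAlgHom hξ hmd) (comulAlgHom hξ hm0 d ((data m ξ d).u i)) =
      if i = 0 then 1 else 0 := by
  have hterm (j : ZMod m) : rootPow ξ (j * (i - j)) •
      ((antipodeAlgHom hξ hmd ((data m ξ d).u j)).unop * (data m ξ d).umon 0 j (i - j)) =
      ∑ l : ZMod m, (quadChar ξ i * rootPow ξ i * (m : k)⁻¹ * qChoose ξ i l *
        rootPow ξ (j * (-1 - l))) •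
        (data m ξ d).mon (2 * (d - ((1 + m) * d / 2 : ℕ)) + d * l.val) 0 i.val := by
    rw [antipode_u, smul_mul_assoc, (isModel_data hξ d).umon_mul_umon hξ, Finset.smul_sum,
      Finset.smul_sum]
    refine Finset.sum_congr rfl fun l _ => ?_
    rw [smul_smul, smul_smul, add_sub_cancel]
    have e1 : (d - ((1 + m) * d / 2 : ℕ) - 0 + (d * l.val + d - ((1 + m) * d / 2 : ℕ)) : ℤ) =
      2 * (d - ((1 + m) * d / 2 : ℕ)) + d * l.val := by ring
    have e2 : -(j + 1) + j + 1 = 0 := by ring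
    rw [e1, e2]
    congr 1
    have hq := quadChar_add hξ j (i - j)
    rw [add_sub_cancel] at hq
    have hsq := quadChar_sq hξ j
    have hj := quadChar_ne_zero hξ j
    have hr : rootPow ξ (j * (-1 - l)) = rootPow ξ (-j) * rootPow ξ (-(j * l)) := by
      rw [← rootPow_add hξ]
      congr 1
      ring
    rw [hq, hr, ← hsq]
    field_simp
  rw [comul_u, map_sum]
  simp only [map_smul, antipodeMul_tmul]
  rw [Finset.sum_congr rfl fun j _ => hterm j, Finset.sum_comm]
  simp_rw [← Finset.sum_smul, ← Finset.mul_sum, sum_rootPow_mul hξ]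
  rw [Finset.sum_eq_single (-1)]
  · rw [sub_self, if_pos rfl]
    have hv : (-1 : ZMod m).val = m - 1 := by
      have e : (-1 : ZMod m) = ((m - 1 : ℕ) : ZMod m) := by
        rw [Nat.cast_sub (NeZero.pos m), ZMod.natCast_self, Nat.cast_one, zero_sub]
      rw [e, ZMod.val_cast_of_lt (by have := NeZero.pos m; omega)]
    split_ifs with h
    · subst h
      rw [qChoose_zero_left hξ, quadChar_zero, rootPow_zero, hv]
      obtain ⟨c, hc⟩ : ∃ c, (1 + m) * d = 2 * c := hmd.two_dvd
      have hc' : (1 + m) * d / 2 = c := by omega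
      have hcz : ((1 : ℤ) + m) * d = 2 * c := by exact_mod_cast hc
      have e1 : (2 * (d - ((1 + m) * d / 2 : ℕ)) + d * (m - 1 : ℕ) : ℤ) = 0 := by
        rw [hc', Nat.cast_sub (NeZero.pos m)]
        push_cast
        linear_combination hcz
      rw [e1, ZMod.val_zero, IsModel.mon_zero]
      simp [hm0]
    · have hi : i.val ≠ 0 := fun h' => h ((ZMod.val_eq_zero i).1 h')
      rw [qChoose_eq_zero hξ (by omega)]
      simp
  · intro l _ hl
    rw [if_neg (fun h => hl (sub_eq_zero.1 h).symm), mul_zero, zero_smul]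
  · simp

/-- Here orthogonality forces `l = -i`. For `i ≠ 0` the representatives of `i` and `-i` add up to
`m` and the coefficient vanishes. -/
theorem mulAntipode_comul_u (i : ZMod m) :
    mulAntipode (antipodeAlgHom hξ hmd) (comulAlgHom hξ hm0 d ((data m ξ d).u i)) =
      if i = 0 then 1 else 0 := by
  have hterm (j : ZMod m) : rootPow ξ (j * (i - j)) •
      ((data m ξ d).u j * (antipodeAlgHom hξ hmd ((data m ξ d).umon 0 j (i - j))).unop) =
      ∑ l : ZMod m, ((m : k)⁻¹ * qChoose ξ i l * rootPow ξ (j * (-i - l))) •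
        (data m ξ d).mon (d * l.val) (-i) i.val := by
    rw [antipode_umon, mul_smul_comm, ← IsModel.umon_zero (M := data m ξ d),
      (isModel_data hξ d).umon_mul_umon hξ, Finset.smul_sum, Finset.smul_sum]
    refine Finset.sum_congr rfl fun l _ => ?_
    rw [smul_smul, smul_smul, add_sub_cancel]
    have e1 : (0 - (d - ((1 + m) * d / 2 : ℕ)) + (d * l.val + d - ((1 + m) * d / 2 : ℕ)) : ℤ) =
      d * l.val := by ring
    have e2 : 0 + (-(i - j + 1) - j) + 1 = -i := by ring
    rw [e1, e2]
    congr 1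
    have hj := quadChar_ne_zero hξ (i - j)
    have hr : rootPow ξ (j * (-i - l)) = rootPow ξ (j * (i - j)) * rootPow ξ (-(i - j)) *
        rootPow ξ (-((i - j) * j)) * rootPow ξ i * rootPow ξ (j * (-(i - j + 1) - j)) *
        rootPow ξ (-(j * l)) := by
      simp only [← rootPow_add hξ]
      congr 1
      ring
    rw [hr]
    field_simp
  rw [comul_u, map_sum]
  simp only [map_smul, mulAntipode_tmul]
  rw [Finset.sum_congr rfl fun j _ => hterm j, Finset.sum_comm]
  simp_rw [← Finset.sum_smul, ← Finset.mul_sum, sum_rootPow_mul hξ]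
  rw [Finset.sum_eq_single (-i)]
  · rw [sub_self, if_pos rfl]
    split_ifs with h
    · subst h
      simp [qChoose_zero_left hξ, IsModel.mon_zero, hm0]
    · have : NeZero i := ⟨h⟩
      have hi := ZMod.val_neg_of_ne_zero i
      have hlt := ZMod.val_lt i
      rw [qChoose_eq_zero hξ (by omega)]
      simp
  · intro l _ hl
    rw [if_neg (fun h => hl (sub_eq_zero.1 h).symm), mul_zero, zero_smul]
  · simp

omit [NeZero m] in
theorem of_eq_ofGen : of m d ξ = (data m ξ d).ofGen d := (ofGen_data d).symm

omit [NeZero m] in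
theorem mon_x : (data m ξ d).mon 1 0 0 = of m d ξ .x := by
  rw [IsModel.mon_x, zpow_one]
  rfl

omit [NeZero m] in
theorem mon_xinv : (data m ξ d).mon (-1) 0 0 = of m d ξ .xinv := by
  rw [IsModel.mon_x, zpow_neg_one]
  rfl

include hξ in
theorem mon_g : (data m ξ d).mon d 1 0 = of m d ξ .g := by
  rw [of_eq_ofGen, mon, (isModel_data hξ d).h_pow_val_one, zpow_natCast, Units.val_pow_eq_pow_val,
    pow_zero, mul_one]
  rfl

theorem antipodeMul_comul (a : D m d ξ) :
    antipodeMul (antipodeAlgHom hξ hmd) (comulAlgHom hξ hm0 d a) =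
      algebraMap k _ (counitAlgHom hξ hm hm0 d a) := by
  refine antipodeMul_comul_eq _ _ _ (adjoin_range_of d) ?_ a
  have hmon (a : ℤ) (b : ZMod m) : antipodeMul (antipodeAlgHom hξ hmd)
      (comulAlgHom hξ hm0 d ((data m ξ d).mon a b 0)) =
      algebraMap k _ (counitAlgHom hξ hm hm0 d ((data m ξ d).mon a b 0)) := by
    rw [comul_mon, counit_mon, map_one, antipodeMul_tmul, antipode_mon,
      (isModel_data hξ d).mon_mul_mon hξ]
    simp [IsModel.mon_zero]
  rintro _ ⟨a, rfl⟩
  cases a with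
  | x => rw [← mon_x, hmon]
  | xinv => rw [← mon_xinv, hmon]
  | g => rw [← mon_g hξ, hmon]
  | y =>
    change antipodeMul _ (comulAlgHom hξ hm0 d (data m ξ d).y) =
      algebraMap k _ (counitAlgHom hξ hm hm0 d (data m ξ d).y)
    rw [comul_y, counit_y, map_add, antipodeMul_tmul, antipodeMul_tmul, antipode_y, smul_mul_assoc,
      (isModel_data hξ d).mon_mul_mon hξ, smul_smul, map_one, unop_one, one_mul, Nat.cast_one,
      one_mul, neg_mul, ← rootPow_add hξ]
    simp [IsModel.mon_zero_y]
  | u i =>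
    change antipodeMul _ (comulAlgHom hξ hm0 d ((data m ξ d).u i)) =
      algebraMap k _ (counitAlgHom hξ hm hm0 d ((data m ξ d).u i))
    rw [antipodeMul_comul_u, counit_u]
    split_ifs <;> simp

theorem mulAntipode_comul (a : D m d ξ) :
    mulAntipode (antipodeAlgHom hξ hmd) (comulAlgHom hξ hm0 d a) =
      algebraMap k _ (counitAlgHom hξ hm hm0 d a) := by
  refine mulAntipode_comul_eq _ _ _ (adjoin_range_of d) ?_ a
  have hmon (a : ℤ) (b : ZMod m) : mulAntipode (antipodeAlgHom hξ hmd)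
      (comulAlgHom hξ hm0 d ((data m ξ d).mon a b 0)) =
      algebraMap k _ (counitAlgHom hξ hm hm0 d ((data m ξ d).mon a b 0)) := by
    rw [comul_mon, counit_mon, map_one, mulAntipode_tmul, antipode_mon,
      (isModel_data hξ d).mon_mul_mon hξ]
    simp [IsModel.mon_zero]
  rintro _ ⟨a, rfl⟩
  cases a with
  | x => rw [← mon_x, hmon]
  | xinv => rw [← mon_xinv, hmon]
  | g => rw [← mon_g hξ, hmon]
  | y =>
    change mulAntipode _ (comulAlgHom hξ hm0 d (data m ξ d).y) =
      algebraMap k _ (counitAlgHom hξ hm hm0 d (data m ξ d).y)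
    rw [comul_y, counit_y, map_add, mulAntipode_tmul, mulAntipode_tmul, antipode_y, antipode_mon,
      ← pow_one (data m ξ d).y, ← IsModel.mon_zero_y, (isModel_data hξ d).mon_mul_mon hξ]
    simp only [Nat.cast_one, one_mul, zero_add, add_zero, map_zero]
    rw [neg_smul (rootPow ξ (-1 : ZMod m)) ((data m ξ d).mon (-d) (-1) 1), add_neg_cancel]
  | u i =>
    change mulAntipode _ (comulAlgHom hξ hm0 d ((data m ξ d).u i)) =
      algebraMap k _ (counitAlgHom hξ hm hm0 d ((data m ξ d).u i))
    rw [mulAntipode_comul_u, counit_u]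
    split_ifs <;> simp

/-- The Hopf algebra structure of `D(m, d, ξ)`. -/
@[reducible] noncomputable def hopfAlgebra : HopfAlgebra k (D m d ξ) where
  __ := Bialgebra.ofAlgHom (comulAlgHom hξ hm0 d) (counitAlgHom hξ hm hm0 d) (coassoc hξ hm0)
    (rTensor_counit hξ hm hm0) (lTensor_counit hξ hm hm0)
  antipode := (MulOpposite.opLinearEquiv k).symm.toLinearMap ∘ₗ
    (antipodeAlgHom hξ hmd).toLinearMap
  mul_antipode_rTensor_comul := LinearMap.ext (antipodeMul_comul hξ hm hm0 hmd)
  mul_antipode_lTensor_comul := LinearMap.ext (mulAntipode_comul hξ hm hm0 hmd)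

omit [NeZero m] in
theorem xinv_pow (n : ℕ) : of m d ξ .xinv ^ n = (data m ξ d).mon (-n) 0 0 := by
  rw [IsModel.mon_x, zpow_neg, ← inv_zpow, zpow_natCast, Units.val_pow_eq_pow_val]
  rfl

omit [NeZero m] in
theorem x_pow (n : ℕ) : of m d ξ .x ^ n = (data m ξ d).mon n 0 0 := by
  rw [IsModel.mon_x, zpow_natCast, Units.val_pow_eq_pow_val]
  rfl

include hξ in
theorem g_pow (n : ℕ) : of m d ξ .g ^ n = (data m ξ d).mon (d * n) n 0 := by
  rw [← mon_g hξ, mon_g_pow hξ (isModel_data hξ d)]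

include hξ in
theorem g_inv : of m d ξ .xinv ^ (m * d) * of m d ξ .g ^ (m - 1) =
    (data m ξ d).mon (-d) (-1) 0 := by
  rw [xinv_pow, g_pow hξ, (isModel_data hξ d).mon_mul_mon hξ, Nat.cast_sub (NeZero.pos m),
    Nat.cast_sub (NeZero.pos m), ZMod.natCast_self]
  simp only [Nat.cast_zero, zero_mul, rootPow_zero, one_smul, add_zero, zero_add, Nat.cast_one,
    zero_sub]
  congr 1
  push_cast
  ring

theorem isHopfStructure_hopfAlgebra :
    IsHopfStructure m d ξ (hopfAlgebra hξ hm hm0 hmd) := by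
  refine ⟨rfl, ?_⟩
  let _ := hopfAlgebra hξ hm hm0 hmd
  have hM := isModel_data hξ d
  constructor
  · exact comul_x hξ hm0
  · rw [← mon_g hξ]
    exact comul_mon hξ hm0 d 1
  · rw [← mon_g hξ]
    exact comul_y hξ hm0
  · intro i hi
    refine (comul_u hξ hm0 (i : ZMod m)).trans ?_
    rw [sum_zmod_eq_sum_range]
    refine Finset.sum_congr rfl fun j _ => ?_
    rw [← rootPow_intCast hξ]
    push_cast
    congr 2
    rw [xinv_pow, g_pow hξ, hM.mon_mul_mon hξ, umon_eq_mul]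
    simp only [Nat.cast_zero, zero_mul, rootPow_zero, one_smul, add_zero, zero_add]
    congr 2
    push_cast
    ring
  · exact counit_x hξ hm hm0
  · rw [← mon_g hξ]
    exact counit_mon hξ hm hm0 d 1
  · exact counit_y hξ hm hm0
  · exact (counit_u hξ hm hm0 0).trans (if_pos rfl)
  · intro s h1 h2
    refine (counit_u hξ hm hm0 (s : ZMod m)).trans (if_neg fun h => ?_)
    have := (ZMod.natCast_eq_zero_iff s m).1 h
    exact absurd (Nat.le_of_dvd h1 this) (not_le.2 h2)
  · rw [← mon_x, ← mon_xinv]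
    exact (antipode_mon hξ hmd 1 0).trans (by rw [neg_zero])
  · rw [g_inv hξ, ← mon_g hξ]
    exact antipode_mon hξ hmd d 1
  · rw [g_inv hξ]
    refine (antipode_y hξ hmd).trans ?_
    change _ = -((data m ξ d).y * _)
    rw [← pow_one (data m ξ d).y, ← IsModel.mon_zero_y, hM.mon_mul_mon hξ]
    simp only [Nat.cast_one, one_mul, zero_add, add_zero]
    exact neg_smul (rootPow ξ (-1 : ZMod m)) ((data m ξ d).mon (-d) (-1) 1)
  · intro i hi
    refine (antipode_u hξ hmd (i : ZMod m)).trans ?_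
    obtain ⟨c, hc⟩ : ∃ c, (1 + m) * d = 2 * c := hmd.two_dvd
    have hc' : (1 + m) * d / 2 = c := by omega
    have hcz : ((1 : ℤ) + m) * d = 2 * c := by exact_mod_cast hc
    have hcd : (m - 1) * d + 2 * d = 2 * c := by
      rw [← hc, ← add_mul]
      congr 1
      omega
    -- The division is exact, as `(m-1)d = 2(c-d)`. The exponent of `x` in the stated formula,
    -- rewritten with `g = x^d h`, is `id - 3(c-d) + d(m-1-i) = d - c`.
    have hmu : (m - 1) * d / 2 = c - d := by omega
    have hdc : d ≤ c := by omega
    rw [x_pow, xinv_pow, g_pow hξ, hM.mon_mul_mon hξ, hc', hmu]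
    simp only [Nat.cast_zero, zero_mul, rootPow_zero, one_smul, add_zero]
    rw [hM.mon_mul_mon hξ, umon_eq_mul]
    simp only [Nat.cast_zero, zero_mul, rootPow_zero, one_smul, add_zero]
    congr 1
    · rw [quadChar_natCast hξ, rootPow_neg hξ, rootPow_natCast hξ, ← pow_mul ξ 2 (_ / 2),
        Nat.two_mul_div_two_of_even (Nat.even_mul_succ_self i), mul_inv, ← inv_pow (-1 : k),
        inv_neg_one, mul_assoc, mul_assoc, ← mul_inv, ← mul_inv, ← pow_mul, ← pow_add, ← pow_add]
      congr 3
      ring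
    · congr 2
      · rw [Nat.sub_sub]
        push_cast [Nat.cast_sub hdc, Nat.cast_sub (show 1 + i ≤ m by omega)]
        linear_combination (-1 : ℤ) * hcz
      · rw [Nat.sub_sub, Nat.cast_sub (by omega), ZMod.natCast_self]
        push_cast
        ring

end Hopf

end D

end DHopf

namespace DHopf

/-! ### Comatrix coalgebras are simple. -/

section Comatrix

variable {k C ι : Type*} [Field k] [AddCommGroup C] [Module k C]

/-- Applied to `t = Δ(w)`: a subcoalgebra is stable under contracting one tensor factor of the
coproduct with any functional. -/
theorem lid_rTensor_mem {W : Submodule k C} (f : C →ₗ[k] k) {t : C ⊗[k] C}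
    (ht : t ∈ LinearMap.range (TensorProduct.map W.subtype W.subtype)) :
    TensorProduct.lid k C (f.rTensor C t) ∈ W := by
  obtain ⟨s, rfl⟩ := ht
  induction s with
  | zero => simp
  | add a b ha hb =>
    rw [map_add, map_add, map_add]
    exact W.add_mem ha hb
  | tmul a b => simpa using W.smul_mem _ b.2

theorem rid_lTensor_mem {W : Submodule k C} (f : C →ₗ[k] k) {t : C ⊗[k] C}
    (ht : t ∈ LinearMap.range (TensorProduct.map W.subtype W.subtype)) :
    TensorProduct.rid k C (f.lTensor C t) ∈ W := by
  obtain ⟨s, rfl⟩ := ht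
  induction s with
  | zero => simp
  | add a b ha hb =>
    rw [map_add, map_add, map_add]
    exact W.add_mem ha hb
  | tmul a b => simpa using W.smul_mem _ a.2

variable [Coalgebra k C] [Fintype ι] [DecidableEq ι] {c : ι → ι → C}
  (hc : ∀ i j, Coalgebra.comul (R := k) (c i j) = ∑ l, c i l ⊗ₜ[k] c l j)
  {f : ι → ι → C →ₗ[k] k}
  (hf : ∀ i j p q, f i j (c p q) = if i = p ∧ j = q then 1 else 0)
include hc

omit [DecidableEq ι] in
theorem isSubcoalgebra_span_comatrix :
    IsSubcoalgebra (Submodule.span k (Set.range fun p : ι × ι => c p.1 p.2)) := by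
  intro w hw
  have hmem (p q : ι) : c p q ∈ Submodule.span k (Set.range fun p : ι × ι => c p.1 p.2) :=
    Submodule.subset_span ⟨(p, q), rfl⟩
  induction hw using Submodule.span_induction with
  | mem w hw =>
    obtain ⟨⟨p, q⟩, rfl⟩ := hw
    rw [hc]
    exact Submodule.sum_mem _ fun l _ => ⟨⟨c p l, hmem p l⟩ ⊗ₜ ⟨c l q, hmem l q⟩, by simp⟩
  | zero => simp
  | add a b _ _ ha hb =>
    rw [map_add]
    exact Submodule.add_mem _ ha hb
  | smul r a _ ha =>
    rw [map_smul]
    exact Submodule.smul_mem _ r ha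

include hf

/-- The argument for simplicity of a matrix algebra, dualised. If `w = ∑ a_{ij} c_{ij}` lies in `W`
and `a_{pq} ≠ 0`, contracting the left factor of `Δ(w)` with `f_{ps}` gives `∑_j a_{pj} c_{sj}`.
Contracting the right factor of its coproduct with `f_{tq}` gives `a_{pq} c_{st}`, so every `c_{st}`
lies in `W`. -/
theorem isSimpleSubcoalgebra_span_comatrix [Nonempty ι] :
    IsSimpleSubcoalgebra (Submodule.span k (Set.range fun p : ι × ι => c p.1 p.2)) where
  isSubcoalgebra := isSubcoalgebra_span_comatrix hc
  ne_bot h := by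
    obtain ⟨i⟩ := ‹Nonempty ι›
    have hmem : c i i ∈ Submodule.span k (Set.range fun p : ι × ι => c p.1 p.2) :=
      Submodule.subset_span ⟨(i, i), rfl⟩
    rw [h, Submodule.mem_bot] at hmem
    have := hf i i i i
    rw [hmem] at this
    simp at this
  eq_bot_or_eq W hW hWV := by
    refine or_iff_not_imp_left.2 fun hne => le_antisymm hWV ?_
    obtain ⟨w, hw, hw0⟩ := Submodule.exists_mem_ne_zero_of_ne_bot hne
    obtain ⟨a, rfl⟩ := (Submodule.mem_span_range_iff_exists_fun k).1 (hWV hw)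
    obtain ⟨⟨p, q⟩, ha⟩ : ∃ p, a p ≠ 0 := by
      by_contra! h
      simp [h] at hw0
    have h1 (s : ι) : ∑ j, a (p, j) • c s j ∈ W := by
      have := lid_rTensor_mem (f p s) (hW _ hw)
      simp only [map_sum, map_smul, hc, LinearMap.rTensor_tmul, TensorProduct.lid_tmul, hf] at this
      have e : ∑ i, a i • ∑ l, (if p = i.1 ∧ s = l then (1 : k) else 0) • c l i.2 =
          ∑ j, a (p, j) • c s j := by
        rw [Fintype.sum_prod_type, Finset.sum_comm]
        refine Finset.sum_congr rfl fun j _ => ?_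
        rw [Finset.sum_eq_single p]
        · rw [Finset.sum_eq_single s]
          · simp
          · intro l _ hl
            simp [hl.symm]
          · simp
        · intro i _ hi
          simp [hi.symm]
        · simp
      rwa [e] at this
    rw [Submodule.span_le]
    rintro _ ⟨⟨s, t⟩, rfl⟩
    have := rid_lTensor_mem (f t q) (hW _ (h1 s))
    simp only [map_sum, map_smul, hc, LinearMap.lTensor_tmul, TensorProduct.rid_tmul, hf] at this
    have e : ∑ j, a (p, j) • ∑ l, (if t = l ∧ q = j then (1 : k) else 0) • c s l =
        a (p, q) • c s t := by
      rw [Finset.sum_eq_single q]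
      · rw [Finset.sum_eq_single t]
        · simp
        · intro l _ hl
          simp [hl.symm]
        · simp
      · intro j _ hj
        simp [hj.symm]
      · simp
    rw [e] at this
    exact (W.smul_mem_iff ha).1 this

/-- A coalgebra that contains a comatrix coalgebra of size at least two is not pointed. -/
theorem not_isPointedCoalgebra_of_comatrix [Nontrivial ι] : ¬ IsPointedCoalgebra k C := by
  intro h
  have h1 := h _ (isSimpleSubcoalgebra_span_comatrix hc hf)
  have hli : LinearIndependent k fun p : ι × ι => c p.1 p.2 := by
    rw [Fintype.linearIndependent_iff]
    rintro g hg ⟨p, q⟩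
    have h2 := congrArg (f p q) hg
    simp only [map_sum, map_smul, hf, map_zero] at h2
    rw [Finset.sum_eq_single (p, q)] at h2
    · simpa using h2
    · rintro ⟨i, j⟩ _ hij
      have : ¬ (p = i ∧ q = j) := fun h => hij (by rw [h.1, h.2])
      simp [this]
    · simp
  rw [finrank_span_eq_card hli, Fintype.card_prod] at h1
  have := Fintype.one_lt_card (α := ι)
  nlinarith

end Comatrix

namespace D

/-! ### Functionals dual to the elements `h^l u_i`. -/

section Functionals

open Data

variable {k : Type*} [Field k] {m : ℕ} [NeZero m] {d : ℕ} {ξ : k}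
  (hξ : IsPrimitiveRoot ξ (2 * m)) (hm : 2 ≤ m) (hm0 : (m : k) ≠ 0)

/-- The convolution product of two functionals on `D(m, d, ξ)`. -/
noncomputable def convolution (f f' : D m d ξ →ₗ[k] k) : D m d ξ →ₗ[k] k :=
  LinearMap.mul' k k ∘ₗ TensorProduct.map f f' ∘ₗ (comulAlgHom hξ hm0 d).toLinearMap

theorem convolution_umon (f f' : D m d ξ →ₗ[k] k) (a : ℤ) (b i : ZMod m) :
    convolution hξ hm0 f f' ((data m ξ d).umon a b i) =
      ∑ j : ZMod m, rootPow ξ (j * (i - j)) *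
        (f ((data m ξ d).umon a b j) * f' ((data m ξ d).umon a (b + j) (i - j))) := by
  simp [convolution, comul_umon]

include hξ hm hm0

/-- The upper right matrix entry of the two-dimensional representation: only `u_1` has a nonzero
one, and `h^l`, being diagonal with first entry `1`, does not change it. -/
theorem exists_functional_umon_one : ∃ f : D m d ξ →ₗ[k] k, ∃ c : k, c ≠ 0 ∧
    ∀ l i : ZMod m, f ((data m ξ d).umon 0 l i) = if i = 1 then c else 0 := by
  have : Fact (1 < m) := ⟨by omega⟩
  have h1 : 1 - ξ ^ 2 ≠ 0 := by simpa using one_sub_pow_ne_zero hξ one_pos (show 1 < m by omega)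
  refine ⟨Matrix.entryLinearMap k k (0 : Fin 2) (1 : Fin 2) ∘ₗ
    ((extensionData m ξ).lift hξ (isModel_extensionData hξ hm hm0 d)).toLinearMap,
    -ξ ^ 3 / (1 - ξ ^ 2), div_ne_zero (neg_ne_zero.2 (pow_ne_zero _ (root_ne_zero hξ))) h1,
    fun l i => ?_⟩
  have hh : (extensionData m ξ).h = Matrix.diagonal ![1, ξ ^ 2] := by
    ext i j
    fin_cases i <;> fin_cases j <;> simp [extensionData]
  rw [LinearMap.comp_apply, AlgHom.toLinearMap_apply, lift_umon, umon, hh, Matrix.diagonal_pow]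
  simp only [Matrix.entryLinearMap_apply, zpow_zero, Units.val_one, one_mul,
    Matrix.diagonal_mul]
  by_cases h0 : i = 0
  · simp [extensionData, h0]
  · by_cases h2 : i = 1 <;> simp [extensionData, h0, h2]

/-- Convolution with the functional that detects `u_1` selects the term `h^l u_1 ⊗ h^{l+1} u_{i-1}`
of the coproduct, so each convolution raises the detected index by one. The nonzero value may depend
on `l`. -/
theorem exists_functional_umon_natCast (n : ℕ) : ∃ f : D m d ξ →ₗ[k] k, ∃ c : ZMod m → k,
    (∀ l, c l ≠ 0) ∧
    ∀ l i : ZMod m, f ((data m ξ d).umon 0 l i) = if i = n then c l else 0 := by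
  induction n with
  | zero =>
    refine ⟨(counitAlgHom hξ hm hm0 d).toLinearMap, fun _ => 1, fun _ => one_ne_zero, fun l i => ?_⟩
    rw [AlgHom.toLinearMap_apply, counit_umon, Nat.cast_zero]
  | succ n ih =>
    obtain ⟨f, c, hc, hf⟩ := ih
    obtain ⟨f₁, c₁, hc₁, hf₁⟩ := exists_functional_umon_one (d := d) hξ hm hm0
    refine ⟨convolution hξ hm0 f₁ f, fun l => rootPow ξ (n : ZMod m) * (c₁ * c (l + 1)),
      fun l => mul_ne_zero (rootPow_ne_zero hξ _) (mul_ne_zero hc₁ (hc _)), fun l i => ?_⟩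
    rw [convolution_umon, Finset.sum_eq_single 1]
    · rw [hf, hf₁, if_pos rfl, one_mul, Nat.cast_succ]
      by_cases h : i = n + 1
      · rw [if_pos h, if_pos (by rw [h, add_sub_cancel_right]), h, add_sub_cancel_right]
      · rw [if_neg h, if_neg (fun h' => h (by rw [← h', sub_add_cancel])), mul_zero, mul_zero]
    · intro j _ hj
      rw [hf₁, if_neg hj, zero_mul, mul_zero]
    · simp

/-- Convolution with the character for `ζ = ξ^a` multiplies the value at `h^l u_i` by `γ^{al} ξ^a`.
A combination over all `a`, by Fourier inversion on `ℤ/m`, isolates `l = l₀`. -/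
theorem exists_functional_umon (l₀ i₀ : ZMod m) : ∃ f : D m d ξ →ₗ[k] k,
    ∀ l i : ZMod m, f ((data m ξ d).umon 0 l i) = if l₀ = l ∧ i₀ = i then 1 else 0 := by
  obtain ⟨f, c, hc, hf⟩ := exists_functional_umon_natCast (d := d) hξ hm hm0 i₀.val
  have hζ (a : ZMod m) : (ξ ^ a.val) ^ (2 * m) = 1 := by
    rw [← pow_mul, mul_comm, pow_mul, hξ.pow_eq_one, one_pow]
  let χ (a : ZMod m) : D m d ξ →ₗ[k] k := (character hξ hm hm0 d _ (hζ a)).toLinearMap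
  have hχ (a l i : ZMod m) : χ a ((data m ξ d).umon 0 l i) =
      if i = 0 then rootPow ξ (a * l) * ξ ^ a.val else 0 := by
    simp only [χ, AlgHom.toLinearMap_apply]
    rw [character, lift_umon, charData_umon]
    congr 2
    have := rootPow_nsmul hξ a l.val
    rw [ZMod.natCast_zmod_val] at this
    rw [mul_comm a l, this, rootPow]
    ring
  refine ⟨((m : k)⁻¹ * (c l₀)⁻¹) • ∑ a : ZMod m, (rootPow ξ (a * -l₀) * (ξ ^ a.val)⁻¹) •
    convolution hξ hm0 (χ a) f, fun l i => ?_⟩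
  have hterm (a : ZMod m) : (rootPow ξ (a * -l₀) * (ξ ^ a.val)⁻¹) *
      convolution hξ hm0 (χ a) f ((data m ξ d).umon 0 l i) =
      rootPow ξ (a * (l - l₀)) * f ((data m ξ d).umon 0 l i) := by
    rw [convolution_umon, Finset.sum_eq_single 0]
    · have h1 : rootPow ξ (a * (l - l₀)) = rootPow ξ (a * -l₀) * rootPow ξ (a * l) := by
        rw [← rootPow_add hξ]
        congr 1
        ring
      have h2 : ξ ^ a.val ≠ 0 := pow_ne_zero _ (root_ne_zero hξ)
      rw [hχ, if_pos rfl, zero_mul, rootPow_zero, add_zero, sub_zero, h1]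
      field_simp
    · intro j _ hj
      rw [hχ, if_neg hj, zero_mul, mul_zero]
    · simp
  simp only [LinearMap.smul_apply, LinearMap.sum_apply, smul_eq_mul, hterm]
  rw [← Finset.sum_mul, sum_rootPow_mul hξ, hf, ZMod.natCast_zmod_val]
  by_cases h1 : l = l₀
  · subst h1
    by_cases h2 : i = i₀
    · subst h2
      have := hc l
      simp
      field_simp
    · simp [h2, Ne.symm h2]
  · simp [sub_eq_zero, h1, Ne.symm h1]

end Functionals

theorem comulAlgHom_of_u {k : Type*} [Field k] {m : ℕ} [NeZero m] {d : ℕ} {ξ : k}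
    (hξ : IsPrimitiveRoot ξ (2 * m)) (hm : 2 ≤ m) (hm0 : (m : k) ≠ 0)
    (hmd : Even ((1 + m) * d)) {i : ℕ} (hi : i < m) :
    comulAlgHom hξ hm0 d (D.of m d ξ (Gen.u i)) =
      ∑ j ∈ Finset.range m, (ξ ^ 2) ^ ((j : ℤ) * ((i : ℤ) - (j : ℤ))) •
        (D.of m d ξ (Gen.u j) ⊗ₜ[k] (D.of m d ξ Gen.xinv ^ (j * d) * D.of m d ξ Gen.g ^ j *
          D.of m d ξ (Gen.u ((i : ZMod m) - (j : ZMod m))))) :=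
  let _ : HopfAlgebra k (D m d ξ) := hopfAlgebra hξ hm hm0 hmd
  (isHopfStructure_hopfAlgebra hξ hm hm0 hmd).2.comul_u i hi

theorem not_isPointed {k : Type*} [Field k] {m : ℕ} [NeZero m] {d : ℕ} {ξ : k}
    (hξ : IsPrimitiveRoot ξ (2 * m)) (hm : 2 ≤ m) (hm0 : (m : k) ≠ 0)
    (hmd : Even ((1 + m) * d)) (H : HopfAlgebra k (D m d ξ)) (hH : IsHopfStructure m d ξ H) :
    ¬ IsPointedHopfAlgebra k (D m d ξ) := by
  have : Fact (1 < m) := ⟨by omega⟩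
  obtain ⟨halg, hform⟩ := hH
  -- The structure is taken apart so that its algebra part can be replaced by the given algebra
  -- structure of `D`; the rest is then reassembled over it.
  obtain @⟨hS, anti₁, anti₂⟩ := H
  obtain @⟨hB, S⟩ := hS
  obtain @⟨alg, coalg, counit_one, mul_counit, comul_one, mul_comul⟩ := hB
  change alg = _ at halg
  subst halg
  let _ : Bialgebra k (D m d ξ) :=
    Bialgebra.mk counit_one mul_counit comul_one mul_comul
  let _ : HopfAlgebraStruct k (D m d ξ) := ⟨S⟩
  let _ : HopfAlgebra k (D m d ξ) := ⟨anti₁, anti₂⟩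
  -- A coproduct is an algebra homomorphism, so the formulas on the generators determine it.
  have hcomul : Bialgebra.comulAlgHom k (D m d ξ) = comulAlgHom hξ hm0 d := by
    refine algHom_ext_of ?_ ?_ ?_ fun i => ?_
    · exact hform.comul_x.trans (comul_x hξ hm0).symm
    · refine hform.comul_g.trans ?_
      rw [← mon_g hξ, comul_mon]
    · refine hform.comul_y.trans ?_
      rw [← mon_g hξ]
      exact (comul_y hξ hm0).symm
    · have h1 := hform.comul_u i.val (ZMod.val_lt i)
      have h2 := comulAlgHom_of_u hξ hm hm0 hmd (ZMod.val_lt i)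
      have h3 := h1.trans h2.symm
      rw [ZMod.natCast_zmod_val] at h3
      exact h3
  have hΔ (a : D m d ξ) : Coalgebra.comul (R := k) a = comulAlgHom hξ hm0 d a :=
    DFunLike.congr_fun hcomul a
  choose F hF using fun l i => exists_functional_umon (d := d) hξ hm hm0 l i
  refine not_isPointedCoalgebra_of_comatrix (k := k) (C := D m d ξ) (ι := ZMod m)
    -- The scalar `γ^{i(j-i)}` absorbs the coefficients of `Δ(h^i u_{j-i})`, so that the coproduct
    -- takes the comatrix form exactly.
    (c := fun i j => rootPow ξ (i * (j - i)) • (Data.umon (data m ξ d) 0 i (j - i)))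
    (f := fun i j => (rootPow ξ (i * (j - i)))⁻¹ • F i (j - i)) (fun i j => ?_) fun i j p q => ?_
  · rw [hΔ, map_smul, comul_umon, Finset.smul_sum]
    refine Fintype.sum_equiv (Equiv.addLeft i) _ _ fun l => ?_
    rw [Equiv.coe_addLeft, add_sub_cancel_left, ← TensorProduct.smul_tmul',
      TensorProduct.tmul_smul, smul_smul, smul_smul, ← rootPow_add hξ, ← rootPow_add hξ,
      show j - (i + l) = j - i - l by ring]
    congr 2
    ring
  · rw [LinearMap.smul_apply, map_smul, hF]
    by_cases h : i = p ∧ j = q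
    · obtain ⟨rfl, rfl⟩ := h
      simp [rootPow_ne_zero hξ]
    · have h' : ¬ (i = p ∧ j - i = q - p) := by
        rintro ⟨rfl, h2⟩
        exact h ⟨rfl, sub_left_injective h2⟩
      simp [h, h']

end D

end DHopf

theorem mainTheorem5 {k : Type*} [Field k] [IsAlgClosed k] [CharZero k]
    (m d : ℕ) (hm : 2 ≤ m) (hd : 1 ≤ d) (hmd : Even ((1 + m) * d))
    (ξ : k) (hξ : IsPrimitiveRoot ξ (2 * m)) :
    (∃ H : HopfAlgebra k (DHopf.D m d ξ), DHopf.IsHopfStructure m d ξ H) ∧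
    ∀ H : HopfAlgebra k (DHopf.D m d ξ), DHopf.IsHopfStructure m d ξ H →
      ¬ IsPointedHopfAlgebra k (DHopf.D m d ξ) := by
  have : NeZero m := ⟨by omega⟩
  have hm0 : (m : k) ≠ 0 := Nat.cast_ne_zero.2 (by omega)
  exact ⟨⟨_, DHopf.D.isHopfStructure_hopfAlgebra hξ hm hm0 hmd⟩,
    fun H hH => DHopf.D.not_isPointed hξ hm hm0 hmd H hH⟩
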